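/- Let $k$ be a field, $R$ a (unital associative, not necessarily commutative) $k$-algebra, and $A$ a finite-dimensional $k$-algebra such that $A/J_A$ is a separable $k$-algebra, where $J_A$ is the Jacobson radical of $A$. (A $k$-algebra $B$ is separable if the multiplication map $B\otimes_k B\to B$ is a split epimorphism of $B$-bimodules.) For a ring $S$ let $\mathsf{mod}\,S$ be the category of finitely generated right $S$-modules, and let $\mathsf{D}^{\mathrm b}(\mathsf{mod}\,S)$ be its bounded derived category, i.e. the Verdier quotient of the homotopy category $\mathsf{K}^{\mathrm b}(\mathsf{mod}\,S)$ of bounded complexes by the acyclic complexes. A stable t-structure in a triangulated category $\mathcal{D}$ with translation $\Sigma$ is a pair $(\mathcal{U},\mathcal{V})$ of full subcategories such that (a) $\mathcal{U}=\Sigma\mathcal{U}$ and $\mathcal{V}=\Sigma\mathcal{V}$ (up to isomorphism of objects), (b) $\operatorname{Hom}_{\mathcal{D}}(\mathcal{U},\mathcal{V})=0$, and (c) every $X\in\mathcal{D}$ admits a triangle $U\to X\to V\to\Sigma U$ with $U\in\mathcal{U}$ and $V\in\mathcal{V}$. For a full subcategory $\mathcal{U}$ of $\mathsf{D}^{\mathrm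 b}(\mathsf{mod}\,A)$ let $\mathcal{U}^R$ be the thick subcategory of $\mathsf{D}^{\mathrm b}(\mathsf{mod}\,R\otimes_k A)$ generated by the objects $L\otimes_k X$ with $L\in\mathsf{D}^{\mathrm b}(\mathsf{mod}\,R)$ and $X\in\mathcal{U}$. Then for every stable t-structure $(\mathcal{U},\mathcal{V})$ in $\mathsf{D}^{\mathrm b}(\mathsf{mod}\,A)$, the pair $(\mathcal{U}^R,\mathcal{V}^R)$ is a stable t-structure in $\mathsf{D}^{\mathrm b}(\mathsf{mod}\,R\otimes_k A)$. -/

import Mathlib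

open CategoryTheory CategoryTheory.Limits CategoryTheory.Pretriangulated
open scoped TensorProduct ZeroObject

universe u

noncomputable section

/-! ### Stable t-structures -/

section StableTStructure

variable {D : Type*} [Category D] [HasZeroObject D] [HasShift D ℤ] [Preadditive D]
  [∀ n : ℤ, (shiftFunctor D n).Additive] [Pretriangulated D]

/-- A pair `(U, V)` of full subcategories of a triangulated category is a stable t-structure.
Full subcategories are given by predicates on objects. No closure under isomorphisms is required,
so the equalities `U = ΣU` and `V = ΣV` are read up to isomorphism of objects. -/
structure IsStableTStructure (U V : ObjectProperty D) : Prop where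
  shift_left : ∀ X : D, U.isoClosure (X⟦(1 : ℤ)⟧) ↔ U.isoClosure X
  shift_right : ∀ X : D, V.isoClosure (X⟦(1 : ℤ)⟧) ↔ V.isoClosure X
  hom_eq_zero : ∀ (X Y : D), U X → V Y → ∀ f : X ⟶ Y, f = 0
  exists_triangle : ∀ X : D, ∃ (Y Z : D) (f : Y ⟶ X) (g : X ⟶ Z) (h : Z ⟶ Y⟦(1 : ℤ)⟧),
    U Y ∧ V Z ∧ Triangle.mk f g h ∈ distTriang D

end StableTStructure

/-! ### The bounded derived category of finitely generated right modules -/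

/-- Bounded cochain complexes of finitely generated right `S`-modules. Right `S`-modules are
modules over the opposite ring. -/
def IsBoundedFG (S : Type u) [Ring S] :
    ObjectProperty (CochainComplex (ModuleCat.{u} Sᵐᵒᵖ) ℤ) := fun K =>
  (∀ n : ℤ, Module.Finite Sᵐᵒᵖ (K.X n)) ∧ ∃ a b : ℤ, ∀ n : ℤ, n < a ∨ b < n → IsZero (K.X n)

/-- The objects of `K^b(mod S)`. As `mod S` is a full subcategory of `Mod S`, the category
`K^b(mod S)` is a full subcategory of the homotopy category of all complexes of right
`S`-modules. -/
def boundedFG (S : Type u) [Ring S] :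
    ObjectProperty (HomotopyCategory (ModuleCat.{u} Sᵐᵒᵖ) (ComplexShape.up ℤ)) := fun X =>
  ∃ K : CochainComplex (ModuleCat.{u} Sᵐᵒᵖ) ℤ, IsBoundedFG S K ∧
    Nonempty (X ≅ (HomotopyCategory.quotient _ _).obj K)

section

variable (S : Type u) [Ring S]

lemma finite_of_isZero (M : ModuleCat.{u} Sᵐᵒᵖ) (h : IsZero M) : Module.Finite Sᵐᵒᵖ M := by
  have := ModuleCat.subsingleton_of_isZero h
  infer_instance

instance : (boundedFG S).IsClosedUnderIsomorphisms where
  of_iso := by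
    rintro X Y e ⟨K, hK, ⟨i⟩⟩
    exact ⟨K, hK, ⟨e.symm ≪≫ i⟩⟩

instance : (boundedFG S).ContainsZero where
  exists_zero := ⟨(HomotopyCategory.quotient _ _).obj 0, Functor.map_isZero _ (isZero_zero _), 0,
    ⟨fun n => finite_of_isZero S _ ((HomologicalComplex.eval _ _ n).map_isZero (isZero_zero _)),
      0, 0, fun n _ => (HomologicalComplex.eval _ _ n).map_isZero (isZero_zero _)⟩,
    ⟨Iso.refl _⟩⟩

instance : (boundedFG S).IsStableUnderShift ℤ where
  isStableUnderShiftBy n :=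
    { le_shift := by
        rintro X ⟨K, ⟨h₁, a, b, h₂⟩, ⟨e⟩⟩
        refine ⟨K⟦n⟧, ⟨fun i => h₁ (i + n), a - n, b - n, fun i hi => h₂ (i + n) (by omega)⟩,
          ⟨(shiftFunctor _ n).mapIso e ≪≫
            ((HomotopyCategory.quotient _ _).commShiftIso n).symm.app K⟩⟩ }

lemma isBoundedFG_mappingCone {K L : CochainComplex (ModuleCat.{u} Sᵐᵒᵖ) ℤ} (f : K ⟶ L)
    (hK : IsBoundedFG S K) (hL : IsBoundedFG S L) :
    IsBoundedFG S (CochainComplex.mappingCone f) := by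
  obtain ⟨hK₁, a, b, hK₂⟩ := hK
  obtain ⟨hL₁, a', b', hL₂⟩ := hL
  refine ⟨fun n => ?_, min (a - 1) a', max b b', fun n hn => ?_⟩
  · have e : (CochainComplex.mappingCone f).X n ≅ K.X (n + 1) ⊞ L.X n :=
      HomologicalComplex.homotopyCofiber.XIsoBiprod f n (n + 1) rfl
    have e' := (e ≪≫ ModuleCat.biprodIsoProd _ _).toLinearEquiv
    have := hK₁ (n + 1)
    have := hL₁ n
    have : Module.Finite Sᵐᵒᵖ (ModuleCat.of Sᵐᵒᵖ (K.X (n + 1) × L.X n)) :=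
      inferInstanceAs (Module.Finite Sᵐᵒᵖ (K.X (n + 1) × L.X n))
    exact Module.Finite.equiv e'.symm
  · rw [CochainComplex.mappingCone.isZero_X_iff]
    exact ⟨hK₂ _ (by omega), hL₂ _ (by omega)⟩

instance : (boundedFG S).IsTriangulatedClosed₃ where
  ext₃' T hT h₁ h₂ := by
    obtain ⟨K, hK, ⟨e₁⟩⟩ := h₁
    obtain ⟨L, hL, ⟨e₂⟩⟩ := h₂
    obtain ⟨f : K ⟶ L, hf⟩ :=
      (HomotopyCategory.quotient _ _).map_surjective (e₁.inv ≫ T.mor₁ ≫ e₂.hom)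
    exact ObjectProperty.le_isoClosure _ _ ⟨_, isBoundedFG_mappingCone S f hK hL,
      ⟨Triangle.π₃.mapIso (isoTriangleOfIso₁₂ T _ hT
        (HomotopyCategory.mappingCone_triangleh_distinguished f) e₁ e₂
        (by
          change T.mor₁ ≫ e₂.hom = e₁.hom ≫ (HomotopyCategory.quotient _ _).map f
          rw [hf, Iso.hom_inv_id_assoc]))⟩⟩

instance : (boundedFG S).IsTriangulated where
  toIsTriangulatedClosed₂ := .of_isTriangulatedClosed₃

end

/-- The homotopy category `K^b(mod S)`. -/
abbrev KbMod (S : Type u) [Ring S] := (boundedFG S).FullSubcategory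

/-- The acyclic complexes in `K^b(mod S)`. -/
abbrev acyclicKbMod (S : Type u) [Ring S] : ObjectProperty (KbMod S) :=
  (HomotopyCategory.subcategoryAcyclic (ModuleCat.{u} Sᵐᵒᵖ)).inverseImage (boundedFG S).ι

/-- The bounded derived category `D^b(mod S)`: the Verdier quotient of `K^b(mod S)` by the acyclic
complexes, i.e. its localization at the quasi-isomorphisms. -/
abbrev DbMod (S : Type u) [Ring S] := (acyclicKbMod S).trW.Localization

/-- A bounded complex of finitely generated right `S`-modules, as an object of `D^b(mod S)`. -/
def DbMod.of {S : Type u} [Ring S] (K : CochainComplex (ModuleCat.{u} Sᵐᵒᵖ) ℤ)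
    (hK : IsBoundedFG S K) : DbMod S :=
  (acyclicKbMod S).trW.Q.obj ⟨(HomotopyCategory.quotient _ _).obj K, K, hK, ⟨Iso.refl _⟩⟩

/-! ### The tensor product of complexes over `k` -/

section Tensor

variable (k : Type u) [Field k] (R : Type u) [Ring R] [Algebra k R]
  (A : Type u) [Ring A] [Algebra k A]

open scoped ModuleCat

/-- The action of `(R ⊗ A)ᵐᵒᵖ` on `M ⊗ N`, for right modules `M` over `R` and `N` over `A`:
the element `r ⊗ a` sends `m ⊗ n` to `m r ⊗ n a`. -/
def tensorAction (M : ModuleCat.{u} Rᵐᵒᵖ) (N : ModuleCat.{u} Aᵐᵒᵖ) :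
    (R ⊗[k] A)ᵐᵒᵖ →ₐ[k] Module.End k (M ⊗[k] N) :=
  (Module.endTensorEndAlgHom (R := k) (S := k) (A := k) (M := M) (N := N)).comp
    ((Algebra.TensorProduct.map (Algebra.lsmul k k M) (Algebra.lsmul k k N)).comp
      (Algebra.TensorProduct.opAlgEquiv k k R A).symm.toAlgHom)

lemma tensorAction_apply (M : ModuleCat.{u} Rᵐᵒᵖ) (N : ModuleCat.{u} Aᵐᵒᵖ)
    (r : R) (a : A) (m : M) (n : N) :
    tensorAction k R A M N (MulOpposite.op (r ⊗ₜ[k] a)) (m ⊗ₜ[k] n) =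
      (MulOpposite.op r • m) ⊗ₜ[k] (MulOpposite.op a • n) := rfl

/-- The right `R ⊗ A`-module `M ⊗ N`. -/
def tensorObj (M : ModuleCat.{u} Rᵐᵒᵖ) (N : ModuleCat.{u} Aᵐᵒᵖ) :
    ModuleCat.{u} (R ⊗[k] A)ᵐᵒᵖ :=
  letI : Module (R ⊗[k] A)ᵐᵒᵖ (M ⊗[k] N) :=
    Module.compHom _ (tensorAction k R A M N).toRingHom
  ModuleCat.of (R ⊗[k] A)ᵐᵒᵖ (M ⊗[k] N)

/-- The map `f ⊗ g` between modules `M ⊗ N`. -/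
def tensorMap {M M' : ModuleCat.{u} Rᵐᵒᵖ} {N N' : ModuleCat.{u} Aᵐᵒᵖ} (f : M ⟶ M')
    (g : N ⟶ N') : tensorObj k R A M N ⟶ tensorObj k R A M' N' :=
  letI (M : ModuleCat.{u} Rᵐᵒᵖ) (N : ModuleCat.{u} Aᵐᵒᵖ) : Module (R ⊗[k] A)ᵐᵒᵖ (M ⊗[k] N) :=
    Module.compHom _ (tensorAction k R A M N).toRingHom
  let φ : M ⊗[k] N →ₗ[k] M' ⊗[k] N' :=
    TensorProduct.map (f.hom.restrictScalars k) (g.hom.restrictScalars k)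
  ModuleCat.ofHom (X := M ⊗[k] N) (Y := M' ⊗[k] N')
    { toFun := φ
      map_add' := φ.map_add
      map_smul' := by
        intro x y
        change φ (tensorAction k R A M N x y) = tensorAction k R A M' N' x (φ y)
        obtain ⟨x, rfl⟩ := MulOpposite.op_surjective x
        induction x with
        | zero => simp
        | add x₁ x₂ h₁ h₂ => simp [h₁, h₂]
        | tmul r a =>
          induction y with
          | zero => simp
          | add y₁ y₂ h₁ h₂ => simp [h₁, h₂]
          | tmul m n => simp [φ, tensorAction_apply] }

lemma tensorMap_tmul {M M' : ModuleCat.{u} Rᵐᵒᵖ} {N N' : ModuleCat.{u} Aᵐᵒᵖ} (f : M ⟶ M')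
    (g : N ⟶ N') (m : M) (n : N) :
    (tensorMap k R A f g).hom (show tensorObj k R A M N from m ⊗ₜ[k] n) =
      (show tensorObj k R A M' N' from f.hom m ⊗ₜ[k] g.hom n) := rfl

lemma tensorObj_hom_ext {M : ModuleCat.{u} Rᵐᵒᵖ} {N : ModuleCat.{u} Aᵐᵒᵖ}
    {P : ModuleCat.{u} (R ⊗[k] A)ᵐᵒᵖ} {f g : tensorObj k R A M N ⟶ P}
    (h : ∀ (m : M) (n : N), f.hom (show tensorObj k R A M N from m ⊗ₜ[k] n) =
      g.hom (show tensorObj k R A M N from m ⊗ₜ[k] n)) : f = g := by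
  apply ModuleCat.hom_ext
  apply LinearMap.ext
  intro x
  change M ⊗[k] N at x
  induction x with
  | zero => exact (map_zero f.hom).trans (map_zero g.hom).symm
  | add x y hx hy => exact (map_add f.hom _ _).trans ((congrArg₂ _ hx hy).trans
      (map_add g.hom _ _).symm)
  | tmul m n => exact h m n

/-- The bifunctor `(M, N) ↦ M ⊗ N` from right modules over `R` and `A` to right modules
over `R ⊗ A`. -/
def tensorBifunctor :
    ModuleCat.{u} Rᵐᵒᵖ ⥤ ModuleCat.{u} Aᵐᵒᵖ ⥤ ModuleCat.{u} (R ⊗[k] A)ᵐᵒᵖ where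
  obj M :=
    { obj := fun N => tensorObj k R A M N
      map := fun g => tensorMap k R A (𝟙 M) g
      map_id := fun _ => tensorObj_hom_ext k R A fun _ _ => rfl
      map_comp := fun _ _ => tensorObj_hom_ext k R A fun _ _ => rfl }
  map f :=
    { app := fun N => tensorMap k R A f (𝟙 N)
      naturality := fun _ _ _ => tensorObj_hom_ext k R A fun _ _ => rfl }
  map_id _ := NatTrans.ext (funext fun _ => tensorObj_hom_ext k R A fun _ _ => rfl)
  map_comp _ _ := NatTrans.ext (funext fun _ => tensorObj_hom_ext k R A fun _ _ => rfl)

instance (M : ModuleCat.{u} Rᵐᵒᵖ) : ((tensorBifunctor k R A).obj M).Additive where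
  map_add := tensorObj_hom_ext k R A fun _ _ => TensorProduct.tmul_add _ _ _

instance : (tensorBifunctor k R A).Additive where
  map_add := NatTrans.ext (funext fun _ =>
    tensorObj_hom_ext k R A fun _ _ => TensorProduct.add_tmul _ _ _)

/-- The tensor product `K ⊗ L` over `k` of complexes of right modules over `R` and `A`: in degree
`n` it is the direct sum of the `K.X i ⊗ L.X j` with `i + j = n`, and its differential is
`d ⊗ 1 + (-1) ^ i (1 ⊗ d)` on `K.X i ⊗ L.X j`. -/
def tensorComplex (K : CochainComplex (ModuleCat.{u} Rᵐᵒᵖ) ℤ)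
    (L : CochainComplex (ModuleCat.{u} Aᵐᵒᵖ) ℤ) :
    CochainComplex (ModuleCat.{u} (R ⊗[k] A)ᵐᵒᵖ) ℤ :=
  HomologicalComplex.mapBifunctor K L (tensorBifunctor k R A) (ComplexShape.up ℤ)

lemma finite_tensorObj (M : ModuleCat.{u} Rᵐᵒᵖ) (N : ModuleCat.{u} Aᵐᵒᵖ)
    (hM : Module.Finite Rᵐᵒᵖ M) (hN : Module.Finite Aᵐᵒᵖ N) :
    Module.Finite (R ⊗[k] A)ᵐᵒᵖ (tensorObj k R A M N) := by
  obtain ⟨s, hs⟩ := hM.fg_top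
  obtain ⟨t, ht⟩ := hN.fg_top
  let τ (m : M) (n : N) : tensorObj k R A M N := m ⊗ₜ[k] n
  have hτ (r : R) (a : A) (m : M) (n : N) :
      τ (MulOpposite.op r • m) (MulOpposite.op a • n) =
        MulOpposite.op (r ⊗ₜ[k] a) • τ m n := rfl
  let G : Set (tensorObj k R A M N) := (fun x : M × N => τ x.1 x.2) '' (s ×ˢ t : Finset (M × N))
  let W := Submodule.span (R ⊗[k] A)ᵐᵒᵖ G
  have hW : W.FG := Submodule.fg_span ((Finset.finite_toSet _).image _)
  suffices h : W = ⊤ from ⟨h ▸ hW⟩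
  refine eq_top_iff.2 fun x _ => ?_
  have h₁ (m : M) : τ m 0 = 0 := TensorProduct.tmul_zero N m
  have h₂ (m : M) (n n' : N) : τ m (n + n') = τ m n + τ m n' := TensorProduct.tmul_add m n n'
  have h₃ (n : N) : τ 0 n = 0 := TensorProduct.zero_tmul M n
  have h₄ (m m' : M) (n : N) : τ (m + m') n = τ m n + τ m' n := TensorProduct.add_tmul m m' n
  have key (m : M) (n : N) : τ m n ∈ W := by
    have hm : m ∈ Submodule.span Rᵐᵒᵖ (s : Set M) := hs ▸ Submodule.mem_top
    have hn : n ∈ Submodule.span Aᵐᵒᵖ (t : Set N) := ht ▸ Submodule.mem_top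
    induction hm using Submodule.span_induction with
    | mem m hm =>
      induction hn using Submodule.span_induction with
      | mem n hn =>
        exact Submodule.subset_span
          ⟨(m, n), Finset.mem_coe.2 (Finset.mem_product.2 ⟨hm, hn⟩), rfl⟩
      | zero => exact h₁ m ▸ W.zero_mem
      | add n n' _ _ h h' =>
        exact h₂ m n n' ▸ W.add_mem h h'
      | smul a n _ h =>
        have := hτ 1 a.unop m n
        rw [MulOpposite.op_one, one_smul, MulOpposite.op_unop] at this
        exact this ▸ W.smul_mem _ h
    | zero => exact h₃ n ▸ W.zero_mem
    | add m m' _ _ h h' =>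
      exact h₄ m m' n ▸ W.add_mem h h'
    | smul r m _ h =>
      have := hτ r.unop 1 m n
      rw [MulOpposite.op_one, one_smul, MulOpposite.op_unop] at this
      exact this ▸ W.smul_mem _ h
  change M ⊗[k] N at x
  induction x with
  | zero => exact W.zero_mem
  | add x y hx hy => exact W.add_mem (hx trivial) (hy trivial)
  | tmul m n => exact key m n

lemma finite_of_generates {S : Type u} [Ring S] {P : ModuleCat.{u} Sᵐᵒᵖ} {ι : Type*}
    (X : ι → ModuleCat.{u} Sᵐᵒᵖ) (f : ∀ i, X i ⟶ P)
    (hf : ∀ {Q : ModuleCat.{u} Sᵐᵒᵖ} (g h : P ⟶ Q), (∀ i, f i ≫ g = f i ≫ h) → g = h)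
    (s : Finset ι) (hs : ∀ i ∉ s, IsZero (X i)) (hX : ∀ i, Module.Finite Sᵐᵒᵖ (X i)) :
    Module.Finite Sᵐᵒᵖ P := by
  have htop : (⨆ i ∈ s, LinearMap.range (f i).hom) = ⊤ := by
    set W := ⨆ i ∈ s, LinearMap.range (f i).hom with hW
    have h0 : ModuleCat.ofHom W.mkQ = 0 := hf _ _ fun i => by
      by_cases hi : i ∈ s
      · ext x
        have : (f i).hom x ∈ W :=
          (le_iSup₂_of_le (f := fun i (_ : i ∈ s) => LinearMap.range (f i).hom) i hi le_rfl)
            ⟨x, rfl⟩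
        simpa using this
      · exact (hs i hi).eq_of_src _ _
    have h1 : W.mkQ = 0 := congrArg ModuleCat.Hom.hom h0
    rw [← Submodule.ker_mkQ W, h1, LinearMap.ker_zero]
  rw [Module.finite_def, ← htop]
  refine Submodule.fg_biSup s _ fun i _ => ?_
  have := hX i
  exact Module.Finite.iff_fg.1 inferInstance

lemma isBoundedFG_tensorComplex {K : CochainComplex (ModuleCat.{u} Rᵐᵒᵖ) ℤ}
    {L : CochainComplex (ModuleCat.{u} Aᵐᵒᵖ) ℤ} (hK : IsBoundedFG R K) (hL : IsBoundedFG A L) :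
    IsBoundedFG (R ⊗[k] A) (tensorComplex k R A K L) := by
  obtain ⟨hK₁, a, b, hK₂⟩ := hK
  obtain ⟨hL₁, a', b', hL₂⟩ := hL
  have hext (n : ℤ) {Q : ModuleCat.{u} (R ⊗[k] A)ᵐᵒᵖ} (g h : (tensorComplex k R A K L).X n ⟶ Q)
      (H : ∀ x : {x : ℤ × ℤ // x.1 + x.2 = n},
        HomologicalComplex.ιMapBifunctor K L (tensorBifunctor k R A) (ComplexShape.up ℤ)
          x.1.1 x.1.2 n x.2 ≫ g =
        HomologicalComplex.ιMapBifunctor K L (tensorBifunctor k R A) (ComplexShape.up ℤ)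
          x.1.1 x.1.2 n x.2 ≫ h) : g = h :=
    HomologicalComplex.mapBifunctor.hom_ext fun i j hij => H ⟨(i, j), hij⟩
  have hzero (i j : ℤ) (hij : i < a ∨ b < i ∨ j < a' ∨ b' < j) :
      IsZero (tensorObj k R A (K.X i) (L.X j)) := by
    have h : IsZero (K.X i) ∨ IsZero (L.X j) := by
      rcases hij with h | h | h | h
      exacts [.inl (hK₂ _ (.inl h)), .inl (hK₂ _ (.inr h)), .inr (hL₂ _ (.inl h)),
        .inr (hL₂ _ (.inr h))]
    rcases h with h | h
    · exact (((tensorBifunctor k R A).map_isZero h).obj (L.X j))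
    · exact (((tensorBifunctor k R A).obj (K.X i)).map_isZero h)
  refine ⟨fun n => ?_, a + a', b + b', fun n hn => ?_⟩
  · refine finite_of_generates _ _ (hext n)
      ((Finset.Icc a b ×ˢ Finset.Icc a' b').subtype _) (fun x hx => hzero _ _ ?_)
      fun x => finite_tensorObj k R A _ _ (hK₁ _) (hL₁ _)
    simp only [Finset.mem_subtype, Finset.mem_product, Finset.mem_Icc] at hx
    omega
  · refine (IsZero.iff_id_eq_zero _).2 (hext n _ _ fun x => (hzero _ _ ?_).eq_of_src _ _)
    have := x.2
    omega

/-- For `U` a full subcategory of `D^b(mod A)`, the objects `L ⊗ X` of `D^b(mod (R ⊗ A))` for `L` in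
`D^b(mod R)` and `X` in `U`, up to isomorphism. Every object of a bounded derived category is
isomorphic to the one given by a bounded complex, so it is enough to let `L` and `X` run over
bounded complexes of finitely generated modules. As `k` is a field, `⊗` is exact, so that the
tensor product of complexes computes the tensor product in derived categories. -/
def tensorGenerators (U : ObjectProperty (DbMod A)) : ObjectProperty (DbMod (R ⊗[k] A)) := fun Z =>
  ∃ (L : CochainComplex (ModuleCat.{u} Rᵐᵒᵖ) ℤ) (X : CochainComplex (ModuleCat.{u} Aᵐᵒᵖ) ℤ)
    (hL : IsBoundedFG R L) (hX : IsBoundedFG A X),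
    U.isoClosure (DbMod.of X hX) ∧
      Nonempty (Z ≅ DbMod.of (tensorComplex k R A L X) (isBoundedFG_tensorComplex k R A hL hX))

/-- The thick subcategory `U^R` of `D^b(mod (R ⊗ A))` generated by the objects `L ⊗ X` for `L` in
`D^b(mod R)` and `X` in `U`. -/
def thickTensor (U : ObjectProperty (DbMod A)) : ObjectProperty (DbMod (R ⊗[k] A)) :=
  (tensorGenerators k R A U).triangEnvelope

/-- A `k`-algebra `B` is separable if the multiplication map `B ⊗ B → B` is a split epimorphism of
`B`-bimodules, i.e. it has a `k`-linear section that is a morphism of `B`-bimodules. -/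
def IsSeparableAlgebra (B : Type u) [Ring B] [Algebra k B] : Prop :=
  ∃ σ : B →ₗ[k] B ⊗[k] B, (∀ x, LinearMap.mul' k B (σ x) = x) ∧
    (∀ b x, σ (b * x) = (b ⊗ₜ[k] 1) * σ x) ∧ ∀ b x, σ (x * b) = σ x * (1 ⊗ₜ[k] b)

end Tensor

end

/-! Shift invariance is automatic for thick subcategories, so the content is the vanishing of
morphisms from $\mathcal U^R$ to $\mathcal V^R$ and the existence of triangles. Filtering $L$ by its
degrees shows that $\mathcal U^R$ is already generated by the objects $M\otimes X$ with $M$ a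
finitely generated module (`thickTensor_eq_triangEnvelope`), so the exact functors $M\otimes-$
(`dbTensor`) suffice.

Orthogonality. The key statement is `hom_dbFunctor_tensor_eq_zero`: if
$\operatorname{Hom}(X,Y[n])=0$ for all $n$, then $\operatorname{Hom}(M\otimes X,M'\otimes Y)=0$. Up
to an object in very low degrees, which has no morphisms to $M'\otimes Y$ for degree reasons, $X$ is
a bounded complex $P$ of finitely generated projectives. A morphism $M\otimes P\to M'\otimes Y$ is a
fraction $M\otimes P\to W\leftarrow M'\otimes Y$, and its numerator corresponds to a map from $M$ to
the complex of $R$-modules $E=\operatorname{Hom}_A(P,W)$. Expanding $M'$ in a $k$-basis shows that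
$E$ has no cohomology in degrees at most $0$. Hence $M\to E$ factors through the acyclic complex
$\tau_{\le 0}E$, and $M\otimes P\to W$ factors through the acyclic complex $\tau_{\le 0}E\otimes P$.
No noetherian hypothesis on $R$ is available: $E$ is finitely generated in each degree because $A$
is finite-dimensional, and $\tau_{\le 0}E$ because $E$ is exact in degree $0$.

Triangles. Consider the class of extensions of objects of $\mathcal V^R$ by objects of $\mathcal
U^R$. Orthogonality makes it a triangulated subcategory, and it is closed under retracts because the
bounded derived category is idempotent complete. It contains every $M\otimes N$: apply $M\otimes-$
to the triangle of $N$. These objects generate everything (`prop_of_tensorObj`): a module $Z$ is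
filtered by the $ZJ_A^i$, and on the layers $A$ acts through the separable algebra $B=A/J_A$, so
that each layer $Z'\cong Z'\otimes_B B$ is a retract of $Z'\otimes_k B$. -/

noncomputable section

/-! ### Chain maps, fractions and triangles in the bounded derived category. -/

namespace CategoryTheory.Pretriangulated

variable {D : Type*} [Category D] [HasZeroObject D] [HasShift D ℤ] [Preadditive D]
  [∀ n : ℤ, (shiftFunctor D n).Additive] [Pretriangulated D]

lemma distinguished_of_iso₃ {X Y Z Z' : D} {f : X ⟶ Y} {g : Y ⟶ Z} {h : Z ⟶ X⟦(1 : ℤ)⟧}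
    (hT : Triangle.mk f g h ∈ distTriang D) (e : Z ≅ Z') :
    Triangle.mk f (g ≫ e.hom) (e.inv ≫ h) ∈ distTriang D :=
  isomorphic_distinguished _ hT _
    (Triangle.isoMk _ _ (Iso.refl _) (Iso.refl _) e.symm
      ((Category.comp_id f).trans (Category.id_comp f).symm)
      (((Category.assoc g e.hom e.inv).trans (by rw [e.hom_inv_id])).trans
        ((Category.comp_id g).trans (Category.id_comp g).symm))
      ((congrArg ((e.inv ≫ h) ≫ ·) (Functor.map_id _ X)).trans (Category.comp_id _)))

section

variable {X Y Z W : D} {f : X ⟶ Y} {g : Y ⟶ Z} {h : Z ⟶ X⟦(1 : ℤ)⟧}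
  (hT : Triangle.mk f g h ∈ distTriang D)

include hT

lemma comp_zero₁₂ : f ≫ g = 0 := comp_distTriang_mor_zero₁₂ _ hT

lemma exists_desc₂ (φ : Y ⟶ W) (hφ : f ≫ φ = 0) : ∃ ψ : Z ⟶ W, g ≫ ψ = φ := by
  obtain ⟨ψ, hψ⟩ := Triangle.yoneda_exact₂ _ hT φ hφ
  exact ⟨ψ, hψ.symm⟩

lemma exists_desc₃ (φ : Z ⟶ W) (hφ : g ≫ φ = 0) : ∃ ψ : X⟦(1 : ℤ)⟧ ⟶ W, h ≫ ψ = φ := by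
  obtain ⟨ψ, hψ⟩ := Triangle.yoneda_exact₃ _ hT φ hφ
  exact ⟨ψ, hψ.symm⟩

lemma exists_lift₂ (φ : W ⟶ Y) (hφ : φ ≫ g = 0) : ∃ ψ : W ⟶ X, ψ ≫ f = φ := by
  obtain ⟨ψ, hψ⟩ := Triangle.coyoneda_exact₂ _ hT φ hφ
  exact ⟨ψ, hψ.symm⟩

end

end CategoryTheory.Pretriangulated

variable {S : Type u} [Ring S]

lemma IsBoundedFG.shift {K : CochainComplex (ModuleCat.{u} Sᵐᵒᵖ) ℤ} (hK : IsBoundedFG S K)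
    (n : ℤ) : IsBoundedFG S (K⟦n⟧) := by
  obtain ⟨h₁, a, b, h₂⟩ := hK
  exact ⟨fun i => h₁ (i + n), a - n, b - n, fun i hi => h₂ (i + n) (by omega)⟩

namespace DbMod

/-- A bounded complex of finitely generated modules, as an object of `K^b(mod S)`. -/
abbrev kb (K : CochainComplex (ModuleCat.{u} Sᵐᵒᵖ) ℤ) (hK : IsBoundedFG S K) : KbMod S :=
  ⟨(HomotopyCategory.quotient _ _).obj K, K, hK, ⟨Iso.refl _⟩⟩

variable {K L M : CochainComplex (ModuleCat.{u} Sᵐᵒᵖ) ℤ} (hK : IsBoundedFG S K)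
  (hL : IsBoundedFG S L) (hM : IsBoundedFG S M)

/-- The morphism in `K^b(mod S)` given by a chain map. -/
abbrev kbMap (f : K ⟶ L) : kb K hK ⟶ kb L hL :=
  ObjectProperty.homMk ((HomotopyCategory.quotient _ _).map f)

/-- The morphism in `D^b(mod S)` given by a chain map. -/
def map (f : K ⟶ L) : of K hK ⟶ of L hL := (acyclicKbMod S).trW.Q.map (kbMap hK hL f)

lemma map_id : map hK hK (𝟙 K) = 𝟙 _ := by
  have h : kbMap hK hK (𝟙 K) = 𝟙 _ := by
    ext
    exact CategoryTheory.Functor.map_id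
      (HomotopyCategory.quotient (ModuleCat.{u} Sᵐᵒᵖ) (.up ℤ)) K
  exact (congrArg _ h).trans (CategoryTheory.Functor.map_id _ _)

lemma map_comp (f : K ⟶ L) (g : L ⟶ M) :
    map hK hM (f ≫ g) = map hK hL f ≫ map hL hM g := by
  have h : kbMap hK hM (f ≫ g) = kbMap hK hL f ≫ kbMap hL hM g := by
    ext; exact Functor.map_comp (HomotopyCategory.quotient (ModuleCat.{u} Sᵐᵒᵖ) (.up ℤ)) f g
  exact (congrArg _ h).trans (Functor.map_comp _ _ _)

lemma kbMap_zero : kbMap hK hL 0 = 0 := by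
  ext; exact Functor.map_zero (HomotopyCategory.quotient (ModuleCat.{u} Sᵐᵒᵖ) (.up ℤ)) _ _

lemma map_zero : map hK hL 0 = 0 :=
  (congrArg _ (kbMap_zero hK hL)).trans (Functor.map_zero _ _ _)

lemma kbMap_eq_of_homotopy {f g : K ⟶ L} (h : Homotopy f g) : kbMap hK hL f = kbMap hK hL g := by
  ext; exact HomotopyCategory.eq_of_homotopy _ _ h

lemma map_eq_of_homotopy {f g : K ⟶ L} (h : Homotopy f g) : map hK hL f = map hK hL g := by
  exact congrArg (acyclicKbMod S).trW.Q.map (kbMap_eq_of_homotopy hK hL h)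

lemma kbMap_surjective (φ : kb K hK ⟶ kb L hL) : ∃ f : K ⟶ L, kbMap hK hL f = φ := by
  obtain ⟨f, hf⟩ := (HomotopyCategory.quotient _ _).map_surjective φ.hom
  exact ⟨f, by ext; exact hf⟩

/-- Inverting quasi-isomorphisms inside $\mathsf K^{\mathrm b}(\mathsf{mod}\,S)$ involves no
unbounded complexes: the mapping cone of a map between bounded finitely generated complexes is again
one, so it witnesses membership inside the subcategory. -/
lemma trW_kbMap_iff (f : K ⟶ L) : (acyclicKbMod S).trW (kbMap hK hL f) ↔ QuasiIso f := by
  have h1 : QuasiIso f ↔ (HomotopyCategory.subcategoryAcyclic (ModuleCat.{u} Sᵐᵒᵖ)).trW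
      ((HomotopyCategory.quotient _ _).map f) := by
    rw [← HomotopyCategory.quasiIso_eq_trW_subcategoryAcyclic,
      HomotopyCategory.quotient_map_mem_quasiIso_iff, HomologicalComplex.mem_quasiIso_iff]
  rw [ObjectProperty.trW_inverseImage_ι_iff, h1]
  refine ⟨ObjectProperty.trW_monotone inf_le_right _, fun h => ?_⟩
  refine ⟨_, _, _, HomotopyCategory.mappingCone_triangleh_distinguished f, ⟨_,
    isBoundedFG_mappingCone S f hK hL, ⟨Iso.refl _⟩⟩, ?_⟩
  exact (ObjectProperty.trW_iff_of_distinguished _ _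
    (HomotopyCategory.mappingCone_triangleh_distinguished f)).1 h

instance isIso_map (f : K ⟶ L) [hf : QuasiIso f] : IsIso (map hK hL f) :=
  Localization.inverts _ (acyclicKbMod S).trW _ ((trW_kbMap_iff hK hL f).2 hf)

/-- An isomorphism of complexes induces an isomorphism in `D^b(mod S)`. -/
def mapIso (e : K ≅ L) : of K hK ≅ of L hL where
  hom := map hK hL e.hom
  inv := map hL hK e.inv
  hom_inv_id := by rw [← map_comp, e.hom_inv_id, map_id]
  inv_hom_id := by rw [← map_comp, e.inv_hom_id, map_id]

lemma exists_iso_kb (X : KbMod S) : ∃ (K : _) (hK : IsBoundedFG S K), Nonempty (X ≅ kb K hK) := by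
  obtain ⟨X, K, hK, ⟨e⟩⟩ := X
  exact ⟨K, hK, ⟨(boundedFG S).fullyFaithfulι.preimageIso e⟩⟩

lemma exists_iso_of (X : DbMod S) : ∃ (K : _) (hK : IsBoundedFG S K), Nonempty (X ≅ of K hK) := by
  have := Localization.essSurj (acyclicKbMod S).trW.Q (acyclicKbMod S).trW
  obtain ⟨K, hK, ⟨e⟩⟩ := exists_iso_kb ((acyclicKbMod S).trW.Q.objPreimage X)
  exact ⟨K, hK, ⟨((acyclicKbMod S).trW.Q.objObjPreimageIso X).symm ≪≫
    (acyclicKbMod S).trW.Q.mapIso e⟩⟩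

/-- Every morphism is a left fraction of chain maps. -/
lemma exists_fraction (φ : of K hK ⟶ of L hL) :
    ∃ (L' : CochainComplex (ModuleCat.{u} Sᵐᵒᵖ) ℤ) (hL' : IsBoundedFG S L') (f : K ⟶ L')
      (s : L ⟶ L'), QuasiIso s ∧ φ ≫ map hL hL' s = map hK hL' f := by
  obtain ⟨ψ, hψ⟩ := Localization.exists_leftFraction (acyclicKbMod S).trW.Q (acyclicKbMod S).trW
    (X := kb K hK) (Y := kb L hL) φ
  obtain ⟨L', hL', ⟨e⟩⟩ := exists_iso_kb ψ.Y'
  obtain ⟨f, hf⟩ := kbMap_surjective hK hL' (ψ.f ≫ e.hom)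
  obtain ⟨s, hs⟩ := kbMap_surjective hL hL' (ψ.s ≫ e.hom)
  have hs' : (acyclicKbMod S).trW (kbMap hL hL' s) := by
    rw [hs]; exact (MorphismProperty.cancel_right_of_respectsIso _ _ _).2 ψ.hs
  refine ⟨L', hL', f, s, (trW_kbMap_iff hL hL' s).1 hs', ?_⟩
  rw [map, map, hf, hs, Functor.map_comp, Functor.map_comp, hψ]
  exact (ψ.map_comp_map_s_assoc _ _ _)

lemma exists_of_map_eq_zero {f : K ⟶ L} (h : map hK hL f = 0) :
    ∃ (L' : CochainComplex (ModuleCat.{u} Sᵐᵒᵖ) ℤ) (_ : IsBoundedFG S L') (s : L ⟶ L'),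
      QuasiIso s ∧ Nonempty (Homotopy (f ≫ s) 0) := by
  rw [← map_zero hK hL] at h
  obtain ⟨Y, s, hs, hs'⟩ := (MorphismProperty.map_eq_iff_postcomp
    (acyclicKbMod S).trW.Q (acyclicKbMod S).trW _ _).1 h
  obtain ⟨L', hL', ⟨e⟩⟩ := exists_iso_kb Y
  obtain ⟨s', hs''⟩ := kbMap_surjective hL hL' (s ≫ e.hom)
  refine ⟨L', hL', s', (trW_kbMap_iff hL hL' s').1 ?_, ⟨HomotopyCategory.homotopyOfEq _ _ ?_⟩⟩
  · rw [hs'']; exact (MorphismProperty.cancel_right_of_respectsIso _ _ _).2 hs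
  · have h2 : kbMap hK hL f ≫ kbMap hL hL' s' = kbMap hK hL 0 ≫ kbMap hL hL' s' := by
      rw [hs'', ← Category.assoc, hs', Category.assoc]
    have := congrArg InducedCategory.Hom.hom h2
    rw [Functor.map_comp]
    refine this.trans ?_
    change (HomotopyCategory.quotient _ _).map 0 ≫ _ = _
    rw [Functor.map_zero, Functor.map_zero, zero_comp]

lemma exists_triangle_mappingCone (f : K ⟶ L) :
    ∃ h, Triangle.mk (map hK hL f) (map hL (isBoundedFG_mappingCone S f hK hL)
      (CochainComplex.mappingCone.inr f)) h ∈ distTriang (DbMod S) := by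
  obtain ⟨Z, g, h, hT⟩ := distinguished_cocone_triangle (kbMap hK hL f)
  let e := isoTriangleOfIso₁₂ _ _ ((boundedFG S).ι.map_distinguished _ hT)
    (HomotopyCategory.mappingCone_triangleh_distinguished f) (Iso.refl _) (Iso.refl _)
    ((Category.comp_id _).trans (Category.id_comp _).symm)
  let e' : Z ≅ kb _ (isBoundedFG_mappingCone S f hK hL) :=
    (boundedFG S).fullyFaithfulι.preimageIso (Triangle.π₃.mapIso e)
  have he' : g ≫ e'.hom = kbMap hL (isBoundedFG_mappingCone S f hK hL)
      (CochainComplex.mappingCone.inr f) := by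
    ext
    exact e.hom.comm₂.trans (Category.id_comp _)
  have h2 := (acyclicKbMod S).trW.Q.map_distinguished _
    (distinguished_of_iso₃ hT e')
  rw [he'] at h2
  exact ⟨_, h2⟩

/-- The canonical map from the mapping cone of $f$ to $M$ is a quasi-isomorphism, so $M$ may replace
the cone in its triangle. -/
lemma exists_triangle_of_shortExact {f : K ⟶ L} {g : L ⟶ M} {w : f ≫ g = 0}
    (hT : (ShortComplex.mk f g w).ShortExact) :
    ∃ h, Triangle.mk (map hK hL f) (map hL hM g) h ∈ distTriang (DbMod S) := by
  obtain ⟨h, hd⟩ := exists_triangle_mappingCone hK hL f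
  have := CochainComplex.mappingCone.quasiIso_descShortComplex hT
  have h2 := distinguished_of_iso₃ hd (asIso (map (isBoundedFG_mappingCone S f hK hL) hM
    (CochainComplex.mappingCone.descShortComplex (ShortComplex.mk f g w))))
  have hg : CochainComplex.mappingCone.inr f ≫
      CochainComplex.mappingCone.descShortComplex (ShortComplex.mk f g w) = g :=
    CochainComplex.mappingCone.inr_descShortComplex (ShortComplex.mk f g w)
  rw [asIso_hom, ← map_comp, hg] at h2
  exact ⟨_, h2⟩

/-- The shift of a complex computes the shift in `D^b(mod S)`. -/
def shiftIso (n : ℤ) : (of K hK)⟦n⟧ ≅ of (K⟦n⟧) (hK.shift n) :=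
  ((acyclicKbMod S).trW.Q.commShiftIso n).symm.app (kb K hK) ≪≫
    (acyclicKbMod S).trW.Q.mapIso ((boundedFG S).fullyFaithfulι.preimageIso
      (((boundedFG S).ι.commShiftIso n).app (kb K hK) ≪≫
        ((HomotopyCategory.quotient _ _).commShiftIso n).symm.app K))

lemma isZero_of_acyclic (h : K.Acyclic) : IsZero (of K hK) := by
  have h0 : IsBoundedFG S (0 : CochainComplex (ModuleCat.{u} Sᵐᵒᵖ) ℤ) :=
    ⟨fun n => finite_of_isZero S _ ((HomologicalComplex.eval _ _ n).map_isZero (isZero_zero _)),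
      0, 0, fun n _ => (HomologicalComplex.eval _ _ n).map_isZero (isZero_zero _)⟩
  have : QuasiIso (0 : K ⟶ 0) := by
    rw [quasiIso_iff]
    intro n
    rw [quasiIsoAt_iff_exactAt _ _ (h n)]
    exact HomologicalComplex.acyclic_of_isZero _ (isZero_zero _) n
  have h1 := isIso_map hK h0 (0 : K ⟶ 0)
  rw [map_zero] at h1
  refine (IsZero.iff_id_eq_zero _).2 ?_
  rw [← IsIso.hom_inv_id (0 : of K hK ⟶ of 0 h0), zero_comp]

end DbMod

end

/-! ### Homology, truncations and dévissage to modules. -/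

noncomputable section

section

variable {S : Type u} [Ring S]

namespace DbMod

variable {K L M : CochainComplex (ModuleCat.{u} Sᵐᵒᵖ) ℤ} (hK : IsBoundedFG S K)
  (hL : IsBoundedFG S L) (hM : IsBoundedFG S M)

variable (S) in
lemma homology_isInvertedBy (n : ℤ) : (acyclicKbMod S).trW.IsInvertedBy
    ((boundedFG S).ι ⋙ HomotopyCategory.homologyFunctor (ModuleCat.{u} Sᵐᵒᵖ) _ n) := by
  intro X Y f hf
  rw [ObjectProperty.trW_inverseImage_ι_iff] at hf
  have h2 := ObjectProperty.trW_monotone inf_le_right _ hf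
  rw [← HomotopyCategory.quasiIso_eq_trW_subcategoryAcyclic,
    HomotopyCategory.mem_quasiIso_iff] at h2
  exact h2 n

variable (S) in
/-- The homology functors on `D^b(mod S)`. -/
def homologyFunctor (n : ℤ) : DbMod S ⥤ ModuleCat.{u} Sᵐᵒᵖ :=
  Localization.lift _ (homology_isInvertedBy S n) (acyclicKbMod S).trW.Q

variable (S) in
/-- The homology functors on `D^b(mod S)` are induced by those on the homotopy category. -/
def homologyFunctorFac (n : ℤ) : (acyclicKbMod S).trW.Q ⋙ homologyFunctor S n ≅
    (boundedFG S).ι ⋙ HomotopyCategory.homologyFunctor (ModuleCat.{u} Sᵐᵒᵖ) _ n :=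
  Localization.fac _ (homology_isInvertedBy S n) (acyclicKbMod S).trW.Q

instance (n : ℤ) : (homologyFunctor S n).Additive := by
  rw [Localization.functor_additive_iff (acyclicKbMod S).trW.Q (acyclicKbMod S).trW]
  exact Functor.additive_of_iso (homologyFunctorFac S n).symm

/-- The homology of an object given by a complex. -/
def homologyOfIso (n : ℤ) : (homologyFunctor S n).obj (of K hK) ≅ K.homology n :=
  (homologyFunctorFac S n).app (kb K hK) ≪≫
    (HomotopyCategory.homologyFunctorFactors (ModuleCat.{u} Sᵐᵒᵖ) (.up ℤ) n).app K

lemma isZero_homologyFunctor_obj_iff (n : ℤ) :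
    IsZero ((homologyFunctor S n).obj (of K hK)) ↔ K.ExactAt n := by
  rw [HomologicalComplex.exactAt_iff_isZero_homology]
  exact (homologyOfIso hK n).isZero_iff

/-- The canonical truncation at a degree where the complex is exact. -/
lemma isBoundedFG_truncLE (hK : IsBoundedFG S K) (g : ℤ) (hg : K.ExactAt g) :
    IsBoundedFG S (K.truncLE g) := by
  obtain ⟨h₁, a, b, h₂⟩ := hK
  have hgt (n : ℤ) (hn : g < n) : IsZero ((K.truncLE g).X n) :=
    CochainComplex.isZero_of_isStrictlyLE _ g n hn
  -- Exactness at `g` makes the cycles in degree `g` a quotient of the preceding term. This replaces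
  -- a noetherian hypothesis on `S`.
  have hc : Module.Finite Sᵐᵒᵖ (K.cycles g) := by
    have : Epi (K.sc g).toCycles := ShortComplex.Exact.epi_toCycles hg
    have := h₁ ((ComplexShape.up ℤ).prev g)
    have h3 : Module.Finite Sᵐᵒᵖ (K.sc g).X₁ := this
    exact Module.Finite.of_surjective (K.sc g).toCycles.hom
      ((ModuleCat.epi_iff_surjective _).1 inferInstance)
  refine ⟨fun n => ?_, a, b, fun n hn => ?_⟩
  · rcases lt_trichotomy n g with h | h | h
    · have := h₁ n
      exact Module.Finite.equiv (K.truncLEXIso g n h).symm.toLinearEquiv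
    · subst h
      exact Module.Finite.equiv (K.truncLEXIsoCycles n).symm.toLinearEquiv
    · exact finite_of_isZero S _ (hgt n h)
  · have : Mono ((K.ιTruncLE g).f n) :=
      inferInstanceAs (Mono ((HomologicalComplex.ιTruncLE K _).f n))
    exact IsZero.of_mono ((K.ιTruncLE g).f n) (h₂ n hn)

include hK hL in
/-- There are no nonzero morphisms from an object in degrees at most `b` to an object whose
homology vanishes in degrees at most `b`. -/
lemma hom_eq_zero_of_exactAt (b : ℤ) (hKb : ∀ n, b < n → IsZero (K.X n))
    (hLb : ∀ n, n ≤ b → L.ExactAt n) (φ : of K hK ⟶ of L hL) : φ = 0 := by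
  obtain ⟨L', hL', f, s, hs, h⟩ := exists_fraction hK hL φ
  have hLb' (n : ℤ) (hn : n ≤ b) : L'.ExactAt n :=
    (quasiIsoAt_iff_exactAt s n (hLb n hn)).1 inferInstance
  have hT := isBoundedFG_truncLE hL' b (hLb' b le_rfl)
  have : L'.IsGE (b + 1) := by
    rw [CochainComplex.isGE_iff]
    exact fun n hn => hLb' n (by omega)
  have hac : (L'.truncLE b).Acyclic := (CochainComplex.acyclic_truncLE_iff _ b (b + 1)).2 this
  have : K.IsStrictlyLE b := by
    rw [CochainComplex.isStrictlyLE_iff]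
    exact fun n hn => hKb n hn
  -- Since `K` equals its own truncation at `b`, the numerator factors through the truncation of
  -- `L'`, which is acyclic.
  have hf : f = (inv (K.ιTruncLE b) ≫ CochainComplex.truncLEMap f b) ≫ L'.ιTruncLE b := by
    rw [Category.assoc, CochainComplex.ιTruncLE_naturality, IsIso.inv_hom_id_assoc]
  have hf0 : map hK hL' f = 0 := by
    rw [hf, map_comp hK hT hL', (isZero_of_acyclic hT hac).eq_of_tgt
      (map hK hT (inv (K.ιTruncLE b) ≫ CochainComplex.truncLEMap f b)) 0, zero_comp]
  rw [hf0] at h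
  rw [← cancel_mono (map hL hL' s), h, zero_comp]

/-- The object of `D^b(mod S)` given by a module. -/
lemma isBoundedFG_single (n : ℤ) (M : ModuleCat.{u} Sᵐᵒᵖ) [Module.Finite Sᵐᵒᵖ M] :
    IsBoundedFG S ((HomologicalComplex.single _ _ n).obj M) := by
  refine ⟨fun i => ?_, n, n, fun i hi =>
    HomologicalComplex.isZero_single_obj_X _ _ _ _ (by omega)⟩
  by_cases h : i = n
  · subst h
    exact Module.Finite.equiv
      (HomologicalComplex.singleObjXSelf (ComplexShape.up ℤ) i M).symm.toLinearEquiv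
  · exact finite_of_isZero S _ (HomologicalComplex.isZero_single_obj_X _ _ _ _ h)

end DbMod

/-- A bounded complex of finitely generated modules is built from modules placed in one degree
by degreewise split extensions. -/
theorem IsBoundedFG.induction {Φ : CochainComplex (ModuleCat.{u} Sᵐᵒᵖ) ℤ → Prop}
    (h0 : ∀ K, IsZero K → Φ K)
    (hstep : ∀ T : ShortComplex (CochainComplex (ModuleCat.{u} Sᵐᵒᵖ) ℤ), T.ShortExact →
      (∀ n, Nonempty (T.map (HomologicalComplex.eval _ _ n)).Splitting) →
      IsBoundedFG S T.X₁ → IsBoundedFG S T.X₂ → IsBoundedFG S T.X₃ → Φ T.X₁ → Φ T.X₃ → Φ T.X₂)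
    (hsingle : ∀ (n : ℤ) (M : ModuleCat.{u} Sᵐᵒᵖ), Module.Finite Sᵐᵒᵖ M →
      Φ ((HomologicalComplex.single _ _ n).obj M))
    (K : CochainComplex (ModuleCat.{u} Sᵐᵒᵖ) ℤ) (hK : IsBoundedFG S K) : Φ K := by
  obtain ⟨h₁, a, b, h₂⟩ := hK
  obtain ⟨N, hN⟩ : ∃ N : ℕ, b < a + N := ⟨(b + 1 - a).toNat, by omega⟩
  replace h₂ (n : ℤ) (hn : n < a ∨ a + N ≤ n) : IsZero (K.X n) := h₂ n (by omega)
  clear hN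
  induction N generalizing K a with
  | zero =>
    refine h0 K ?_
    rw [IsZero.iff_id_eq_zero]
    ext n : 1
    exact (h₂ n (by simp; omega)).eq_of_src _ _
  | succ N ih =>
    -- Projection onto the lowest degree `a` is a chain map because nothing maps into that degree.
    -- Its kernel is the brutal truncation to degrees above `a`.
    let π : K ⟶ (HomologicalComplex.single _ (ComplexShape.up ℤ) a).obj (K.X a) :=
      HomologicalComplex.mkHomToSingle (𝟙 _) (fun i hi =>
        (h₂ i (by simp at hi; omega)).eq_of_src _ _)
    have hπa : IsIso (π.f a) := by
      have : π.f a = (HomologicalComplex.singleObjXSelf _ a _).inv := by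
        simp [π, HomologicalComplex.mkHomToSingle_f]
      rw [this]
      infer_instance
    have hs (n : ℤ) (hn : n ≠ a) : IsZero (((HomologicalComplex.single
      (ModuleCat.{u} Sᵐᵒᵖ) (ComplexShape.up ℤ) a).obj (K.X a)).X n) :=
        HomologicalComplex.isZero_single_obj_X _ _ _ _ hn
    have hepi (n : ℤ) : Epi (π.f n) := by
      by_cases h : n = a
      · subst h; infer_instance
      · exact ⟨fun _ _ _ => (hs n h).eq_of_src _ _⟩
    have : Epi π := HomologicalComplex.epi_of_epi_f _ hepi
    let T : ShortComplex (CochainComplex (ModuleCat.{u} Sᵐᵒᵖ) ℤ) :=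
      ShortComplex.mk (kernel.ι π) π (kernel.condition π)
    have hT : T.ShortExact :=
      { exact := ShortComplex.exact_of_f_is_kernel _ (kernelIsKernel π) }
    have hT' (n : ℤ) := hT.map_of_exact (HomologicalComplex.eval _ (ComplexShape.up ℤ) n)
    have hmono (n : ℤ) : Mono ((kernel.ι π).f n) := (hT' n).mono_f
    have ha : IsZero ((kernel π).X a) := by
      have h4 : (kernel.ι π).f a ≫ π.f a = 0 := by
        rw [← HomologicalComplex.comp_f, kernel.condition]; rfl
      refine (IsZero.iff_id_eq_zero _).2 ?_
      rw [← cancel_mono ((kernel.ι π).f a), ← cancel_mono (π.f a)]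
      simp [h4]
    have hiso (n : ℤ) (hn : n ≠ a) : IsIso ((kernel.ι π).f n) :=
      (hT' n).isIso_f_iff.2 (hs n hn)
    have hfin (n : ℤ) : Module.Finite Sᵐᵒᵖ ((kernel π).X n) := by
      by_cases h : n = a
      · subst h; exact finite_of_isZero S _ ha
      · have := hiso n h
        have := h₁ n
        exact Module.Finite.equiv (asIso ((kernel.ι π).f n)).symm.toLinearEquiv
    have hz (n : ℤ) (hn : n < a + 1 ∨ a + 1 + N ≤ n) : IsZero ((kernel π).X n) := by
      by_cases h : n = a
      · subst h; exact ha
      · exact IsZero.of_mono ((kernel.ι π).f n) (h₂ n (by push_cast; omega))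
    have := h₁ a
    refine hstep T hT (fun n => ?_) ⟨hfin, a + 1, a + N, fun n hn => hz n (by omega)⟩
      ⟨h₁, a, a + N, fun n hn => h₂ n (by push_cast; omega)⟩
      (DbMod.isBoundedFG_single a (K.X a)) (ih (kernel π) hfin (a + 1) hz) (hsingle a _ this)
    -- In each degree one end of the sequence is zero: the kernel in degree `a`, the quotient in all
    -- others. This gives the splittings, thanks to which additive functors preserve exactness here.
    by_cases h : n = a
    · subst h
      have : Injective (T.map (HomologicalComplex.eval _ _ n)).X₁ := ha.injective
      exact ⟨(hT' n).splittingOfInjective⟩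
    · have : Projective (T.map (HomologicalComplex.eval _ _ n)).X₃ := (hs n h).projective
      exact ⟨(hT' n).splittingOfProjective⟩

namespace DbMod

/-- The bounded derived category is generated by modules. -/
theorem prop_of_single (P : ObjectProperty (DbMod S)) [P.IsTriangulated]
    [P.IsClosedUnderIsomorphisms]
    (h : ∀ (M : ModuleCat.{u} Sᵐᵒᵖ) [Module.Finite Sᵐᵒᵖ M], P (of _ (isBoundedFG_single 0 M)))
    (X : DbMod S) : P X := by
  obtain ⟨K, hK, ⟨e⟩⟩ := exists_iso_of X
  refine P.prop_of_iso e.symm ?_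
  refine IsBoundedFG.induction (Φ := fun K => ∀ hK : IsBoundedFG S K, P (of K hK)) ?_ ?_ ?_ K hK hK
  · intro K h hK
    exact P.prop_of_isZero (isZero_of_acyclic hK (HomologicalComplex.acyclic_of_isZero _ h))
  · intro T hT _ h₁ h₂ h₃ h₁' h₃' h₂'
    obtain ⟨δ, hδ⟩ := exists_triangle_of_shortExact h₁ h₂ h₃ hT
    exact P.ext_of_isTriangulatedClosed₂ _ hδ (h₁' h₁) (h₃' h₃)
  · intro n M hM hK
    have h1 := P.le_shift (-n) _ (h M)
    have hM' := isBoundedFG_single 0 M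
    exact P.prop_of_iso (shiftIso hM' (-n) ≪≫ mapIso (hM'.shift (-n)) hK
      (((CochainComplex.singleFunctors (ModuleCat.{u} Sᵐᵒᵖ)).shiftIso (-n) n 0 (by simp)).app M)) h1

end DbMod

end

end

/-! ### Idempotent completeness of the bounded derived category. -/

noncomputable section

namespace CategoryTheory.Pretriangulated

variable {D : Type*} [Category D] [HasZeroObject D] [HasShift D ℤ] [Preadditive D]
  [∀ n : ℤ, (shiftFunctor D n).Additive] [Pretriangulated D]

/-- For an idempotent `e` of `X`, there are objects `W` in which the image of `e` has a complement
that is a direct summand of an arbitrarily high shift of `X`. -/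
lemma exists_summand_complement_shift {X : D} (e : X ⟶ X) (he : e ≫ e = e) (j : ℕ) :
    ∃ (W : D) (i : X ⟶ W) (p : W ⟶ X) (q : W ⟶ X⟦(j : ℤ)⟧) (t : X⟦(j : ℤ)⟧ ⟶ W),
      i ≫ p = e ∧ e ≫ i = i ∧ p ≫ e = p ∧ q ≫ t = 𝟙 W - p ≫ i ∧ t ≫ p = 0 := by
  induction j with
  | zero =>
    let s : X⟦((0 : ℕ) : ℤ)⟧ ≅ X := (shiftFunctorZero D ℤ).app X
    refine ⟨X, e, e, (𝟙 X - e) ≫ s.inv, s.hom ≫ (𝟙 X - e), he, he, he, ?_, ?_⟩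
    · simp [he]
    · simp [he]
  | succ j ih =>
    obtain ⟨W, i, p, q, t, hip, hei, hpe, hqt, htp⟩ := ih
    -- Heuristically $W=eX\oplus Z$, and `t` is a split epimorphism of $X[j]$ onto $Z$. Its cone is
    -- then $eX\oplus Z'[1]$ with $Z'$ the complement of $Z$ in $X[j]$, so that the unwanted summand
    -- moves one degree further away.
    obtain ⟨C, g, h, hT⟩ := distinguished_cocone_triangle t
    have htg : t ≫ g = 0 := comp_zero₁₂ hT
    obtain ⟨p', hp'⟩ := exists_desc₂ hT p htp
    have hg : g ≫ p' ≫ e = p := by rw [← Category.assoc, hp', hpe]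
    obtain ⟨t', ht'⟩ := exists_desc₃ hT (𝟙 C - (p' ≫ e) ≫ i ≫ g) (by
      have h1 : (𝟙 W - p ≫ i) ≫ g = 0 := by rw [← hqt, Category.assoc, htg, comp_zero]
      rw [Preadditive.sub_comp, Category.id_comp, Category.assoc] at h1
      rw [Preadditive.comp_sub, Category.comp_id, ← Category.assoc g, hg, h1])
    let s : X⟦((j + 1 : ℕ) : ℤ)⟧ ≅ (X⟦(j : ℤ)⟧)⟦(1 : ℤ)⟧ :=
      (shiftFunctorAdd' D (j : ℤ) 1 ((j + 1 : ℕ) : ℤ) (by simp)).app X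
    have hip' : (i ≫ g) ≫ p' ≫ e = e := by rw [Category.assoc, hg, hip]
    have h2 : (𝟙 C - (p' ≫ e) ≫ i ≫ g) ≫ p' ≫ e = 0 := by
      rw [Preadditive.sub_comp, Category.assoc _ (i ≫ g), hip', Category.assoc, he,
        Category.id_comp, sub_self]
    refine ⟨C, i ≫ g, p' ≫ e, h ≫ s.inv,
      s.hom ≫ t' ≫ (𝟙 C - (p' ≫ e) ≫ i ≫ g), hip', ?_, ?_, ?_, ?_⟩
    · rw [← Category.assoc, hei]
    · rw [Category.assoc, he]
    · rw [Category.assoc, s.inv_hom_id_assoc, ← Category.assoc, ht', Preadditive.comp_sub,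
        Category.comp_id, ← Category.assoc _ (p' ≫ e), h2, zero_comp, sub_zero]
    · rw [Category.assoc, Category.assoc, h2, comp_zero, comp_zero]

end CategoryTheory.Pretriangulated

namespace DbMod

variable {S : Type u} [Ring S]

lemma isBoundedFG_of_epi {K L : CochainComplex (ModuleCat.{u} Sᵐᵒᵖ) ℤ} (hK : IsBoundedFG S K)
    (f : K ⟶ L) [Epi f] : IsBoundedFG S L := by
  obtain ⟨h₁, a, b, h₂⟩ := hK
  have (n : ℤ) : Epi (f.f n) := inferInstance
  refine ⟨fun n => ?_, a, b, fun n hn => IsZero.of_epi (f.f n) (h₂ n hn)⟩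
  have := h₁ n
  exact Module.Finite.of_surjective (f.f n).hom ((ModuleCat.epi_iff_surjective _).1 inferInstance)

/-- Canonical truncation stays within finitely generated modules only at a degree where the complex
is exact, whence the hypothesis at `g`. -/
lemma exists_truncation_triangle {K : CochainComplex (ModuleCat.{u} Sᵐᵒᵖ) ℤ}
    (hK : IsBoundedFG S K) (g : ℤ) (hg : K.ExactAt g) :
    ∃ (A C : CochainComplex (ModuleCat.{u} Sᵐᵒᵖ) ℤ) (hA : IsBoundedFG S A) (hC : IsBoundedFG S C)
      (φ : of A hA ⟶ of K hK) (ψ : of K hK ⟶ of C hC) (δ : of C hC ⟶ (of A hA)⟦(1 : ℤ)⟧),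
      Triangle.mk φ ψ δ ∈ distTriang (DbMod S) ∧ (∀ n, g < n → IsZero (A.X n)) ∧
        ∀ n, n ≤ g → C.ExactAt n := by
  have hT : (K.shortComplexTruncLE g).ShortExact := K.shortComplexTruncLE_shortExact g
  have hA : IsBoundedFG S (K.truncLE g) := isBoundedFG_truncLE hK _ hg
  have hC : IsBoundedFG S (K.shortComplexTruncLE g).X₃ :=
    @isBoundedFG_of_epi _ _ K _ hK (K.shortComplexTruncLE g).g hT.epi_g
  obtain ⟨δ, hδ⟩ := exists_triangle_of_shortExact hA hK hC hT
  refine ⟨_, _, hA, hC, _, _, δ, hδ,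
    fun n hn => (K.truncLE g).isZero_of_isStrictlyLE g n hn, fun n hn => ?_⟩
  have := (HomologicalComplex.shortComplexTruncLE_X₃_isSupportedOutside K
    (ComplexShape.embeddingUpIntLE g)).exactAt (g - n).toNat
  have h3 : (ComplexShape.embeddingUpIntLE g).f (g - n).toNat = n := by
    simp; omega
  rwa [h3] at this

/-- The image of `e` is a summand of some `W` whose other summand is a summand of a far shift of
`K`. The two have homology in ranges separated by a gap, and truncating `W` in the gap isolates the
image of `e`. -/
lemma exists_splitting_of {K : CochainComplex (ModuleCat.{u} Sᵐᵒᵖ) ℤ} (hK : IsBoundedFG S K)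
    (e : of K hK ⟶ of K hK) (he : e ≫ e = e) :
    ∃ (Y : DbMod S) (i : Y ⟶ of K hK) (p : of K hK ⟶ Y), i ≫ p = 𝟙 Y ∧ p ≫ i = e := by
  obtain ⟨-, a, b, h₂⟩ := id hK
  -- `K` lives in degrees `a` to `b`. This choice places `K⟦j⟧` in degrees strictly below `a - 1`,
  -- leaving `a - 1` free of homology.
  obtain ⟨j, hj⟩ : ∃ j : ℕ, b < a - 1 + j := ⟨(b + 2 - a).toNat, by omega⟩
  obtain ⟨W, i, p, q, t, hip, hei, hpe, hqt, htp⟩ := exists_summand_complement_shift e he j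
  obtain ⟨K', hK', ⟨w⟩⟩ := exists_iso_of W
  have hKa (n : ℤ) (hn : n ≤ a - 1) : K.ExactAt n :=
    ShortComplex.exact_of_isZero_X₂ _ (h₂ n (by omega))
  have hex : K'.ExactAt (a - 1) := by
    rw [← isZero_homologyFunctor_obj_iff hK', IsZero.iff_id_eq_zero]
    let H := homologyFunctor S (a - 1)
    have z₁ : IsZero (H.obj (of K hK)) :=
      (isZero_homologyFunctor_obj_iff hK _).2 (hKa _ le_rfl)
    have z₂ : IsZero (H.obj ((of K hK)⟦(j : ℤ)⟧)) :=
      ((isZero_homologyFunctor_obj_iff (hK.shift j) _).2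
        (ShortComplex.exact_of_isZero_X₂ _ (h₂ (a - 1 + (j : ℤ)) (by omega)))).of_iso
          (H.mapIso (shiftIso hK j))
    have h : 𝟙 (of K' hK') = (w.inv ≫ q) ≫ t ≫ w.hom + (w.inv ≫ p) ≫ i ≫ w.hom := by
      have : 𝟙 W = q ≫ t + p ≫ i := by rw [hqt, sub_add_cancel]
      have h3 : w.inv ≫ 𝟙 W ≫ w.hom = 𝟙 _ := by simp
      rw [← h3, this]
      simp
    change 𝟙 (H.obj _) = 0
    rw [← H.map_id, h, H.map_add, H.map_comp, H.map_comp _ (i ≫ w.hom), z₁.eq_of_tgt (H.map _) 0,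
      z₂.eq_of_tgt (H.map (w.inv ≫ q)) 0, zero_comp, zero_comp, add_zero]
  obtain ⟨A, C, hA, hC, f, g, δ, hδ, hAz, hCex⟩ := exists_truncation_triangle hK' _ hex
  have hfp : f ≫ w.inv ≫ p = 0 := hom_eq_zero_of_exactAt hA hK (a - 1) hAz hKa _
  have htg : t ≫ w.hom ≫ g = 0 := by
    have := hom_eq_zero_of_exactAt (hK.shift j) hC (a - 1)
      (fun n hn => h₂ (n + (j : ℤ)) (by omega)) hCex ((shiftIso hK j).inv ≫ t ≫ w.hom ≫ g)
    rwa [← cancel_epi (shiftIso hK j).inv, comp_zero]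
  -- The projector of `W` onto the image of `e` kills the low part `A`, so it descends to `C`; the
  -- next steps show that `σ` is a section of `g`.
  obtain ⟨σ, hσ⟩ := exists_desc₂ hδ (w.inv ≫ p ≫ i ≫ w.hom) (by
    rw [← Category.assoc w.inv, ← Category.assoc, hfp, zero_comp])
  have hg : g ≫ σ ≫ g = g := by
    have h4 : p ≫ i = 𝟙 W - q ≫ t := by rw [hqt]; abel
    rw [← Category.assoc, hσ, ← Category.assoc p, h4]
    simp [htg]
  -- The defect `σ ≫ g - 𝟙` factors through `A⟦1⟧`, which has no nonzero morphisms to `C` for degree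
  -- reasons.
  obtain ⟨τ, hτ⟩ := exists_desc₃ hδ (σ ≫ g - 𝟙 _) (by
    rw [Preadditive.comp_sub, hg, Category.comp_id, sub_self])
  have hτ0 : τ = 0 := by
    have := hom_eq_zero_of_exactAt (hA.shift 1) hC (a - 1)
      (fun n hn => hAz (n + 1) (by omega)) hCex ((shiftIso hA 1).inv ≫ τ)
    rw [← cancel_epi (shiftIso hA 1).inv, this, comp_zero]
  have hσg : σ ≫ g = 𝟙 _ := by
    rw [hτ0, comp_zero] at hτ
    exact (sub_eq_zero.1 hτ.symm)
  refine ⟨of C hC, σ ≫ w.inv ≫ p, i ≫ w.hom ≫ g, ?_, ?_⟩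
  · calc (σ ≫ w.inv ≫ p) ≫ i ≫ w.hom ≫ g
        = σ ≫ (w.inv ≫ p ≫ i ≫ w.hom) ≫ g := by simp
      _ = (σ ≫ g) ≫ σ ≫ g := by rw [← hσ]; simp
      _ = 𝟙 _ := by rw [hσg, Category.id_comp]
  · calc (i ≫ w.hom ≫ g) ≫ σ ≫ w.inv ≫ p
        = i ≫ w.hom ≫ (g ≫ σ) ≫ w.inv ≫ p := by simp
      _ = (i ≫ p) ≫ i ≫ p := by rw [hσ]; simp
      _ = e := by rw [hip, he]

/-- The bounded derived category of finitely generated modules is idempotent complete. -/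
instance : IsIdempotentComplete (DbMod S) where
  idempotents_split X e he := by
    obtain ⟨K, hK, ⟨w⟩⟩ := exists_iso_of X
    obtain ⟨Y, i, p, hip, hpi⟩ := exists_splitting_of hK (w.inv ≫ e ≫ w.hom) (by
      simp [reassoc_of% he])
    refine ⟨Y, i ≫ w.inv, w.hom ≫ p, by simp [hip], ?_⟩
    rw [Category.assoc, ← Category.assoc p, hpi]
    simp

end DbMod

end

/-! ### Exact functors on bounded derived categories. -/

noncomputable section

section

variable {S S' : Type u} [Ring S] [Ring S'] (F : ModuleCat.{u} Sᵐᵒᵖ ⥤ ModuleCat.{u} S'ᵐᵒᵖ)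

/-- An exact functor between module categories that preserves finite generation. -/
class IsExactFG : Prop where
  additive : F.Additive
  preservesHomology : F.PreservesHomology
  finite (M : ModuleCat.{u} Sᵐᵒᵖ) : Module.Finite Sᵐᵒᵖ M → Module.Finite S'ᵐᵒᵖ (F.obj M)

attribute [instance] IsExactFG.additive IsExactFG.preservesHomology

variable [IsExactFG F]

/-- The functor induced on complexes. -/
abbrev mapCpx (K : CochainComplex (ModuleCat.{u} Sᵐᵒᵖ) ℤ) :
    CochainComplex (ModuleCat.{u} S'ᵐᵒᵖ) ℤ :=
  (F.mapHomologicalComplex (ComplexShape.up ℤ)).obj K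

lemma isBoundedFG_mapCpx {K : CochainComplex (ModuleCat.{u} Sᵐᵒᵖ) ℤ} (hK : IsBoundedFG S K) :
    IsBoundedFG S' (mapCpx F K) := by
  obtain ⟨h₁, a, b, h₂⟩ := hK
  exact ⟨fun n => IsExactFG.finite _ (h₁ n), a, b, fun n hn => F.map_isZero (h₂ n hn)⟩

lemma mapCpx_exactAt {K : CochainComplex (ModuleCat.{u} Sᵐᵒᵖ) ℤ} (n : ℤ) (h : K.ExactAt n) :
    (mapCpx F K).ExactAt n :=
  ShortComplex.Exact.map h F

/-- The functor induced on `K^b(mod S)`. -/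
def kbFunctor : KbMod S ⥤ KbMod S' :=
  (boundedFG S').lift ((boundedFG S).ι ⋙ F.mapHomotopyCategory (ComplexShape.up ℤ)) (by
    rintro ⟨X, K, hK, ⟨e⟩⟩
    exact ⟨_, isBoundedFG_mapCpx F hK, ⟨(F.mapHomotopyCategory _).mapIso e ≪≫
      (F.mapHomotopyCategoryFactors _).app K⟩⟩)

instance : (kbFunctor F).CommShift ℤ := by unfold kbFunctor; infer_instance
instance : (kbFunctor F).IsTriangulated := by unfold kbFunctor; infer_instance

lemma kbFunctor_isInvertedBy :
    (acyclicKbMod S).trW.IsInvertedBy (kbFunctor F ⋙ (acyclicKbMod S').trW.Q) := by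
  intro X Y f hf
  obtain ⟨K, hK, ⟨e₁⟩⟩ := DbMod.exists_iso_kb X
  obtain ⟨L, hL, ⟨e₂⟩⟩ := DbMod.exists_iso_kb Y
  obtain ⟨φ, hφ⟩ := DbMod.kbMap_surjective hK hL (e₁.inv ≫ f ≫ e₂.hom)
  have hφ' : (acyclicKbMod S).trW (DbMod.kbMap hK hL φ) := by
    rw [hφ]
    exact (MorphismProperty.cancel_left_of_respectsIso _ _ _).2
      ((MorphismProperty.cancel_right_of_respectsIso _ _ _).2 hf)
  rw [DbMod.trW_kbMap_iff] at hφ'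
  have h2 := DbMod.isIso_map (isBoundedFG_mapCpx F hK) (isBoundedFG_mapCpx F hL)
    ((F.mapHomologicalComplex (ComplexShape.up ℤ)).map φ)
  have h3 : IsIso ((kbFunctor F ⋙ (acyclicKbMod S').trW.Q).map (DbMod.kbMap hK hL φ)) := h2
  rw [hφ, Functor.map_comp, Functor.map_comp] at h3
  rwa [isIso_comp_left_iff, isIso_comp_right_iff] at h3

/-- The functor induced on bounded derived categories. -/
def dbFunctor : DbMod S ⥤ DbMod S' :=
  Localization.lift _ (kbFunctor_isInvertedBy F) (acyclicKbMod S).trW.Q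

/-- The functor on bounded derived categories is induced by the one on homotopy categories. -/
def dbFunctorFac : (acyclicKbMod S).trW.Q ⋙ dbFunctor F ≅
    kbFunctor F ⋙ (acyclicKbMod S').trW.Q :=
  Localization.fac _ (kbFunctor_isInvertedBy F) (acyclicKbMod S).trW.Q

instance : Localization.Lifting (acyclicKbMod S).trW.Q (acyclicKbMod S).trW
    (kbFunctor F ⋙ (acyclicKbMod S').trW.Q) (dbFunctor F) := ⟨dbFunctorFac F⟩

instance : (dbFunctor F).CommShift ℤ :=
  Functor.commShiftOfLocalization (acyclicKbMod S).trW.Q (acyclicKbMod S).trW ℤ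
    (kbFunctor F ⋙ (acyclicKbMod S').trW.Q) (dbFunctor F)

instance : NatTrans.CommShift (dbFunctorFac F).hom ℤ :=
  inferInstanceAs (NatTrans.CommShift (Localization.Lifting.iso
    (acyclicKbMod S).trW.Q (acyclicKbMod S).trW
      (kbFunctor F ⋙ (acyclicKbMod S').trW.Q) (dbFunctor F)).hom ℤ)

instance : (dbFunctor F).IsTriangulated :=
  have := Localization.essSurj_mapArrow (acyclicKbMod S).trW.Q (acyclicKbMod S).trW
  Functor.isTriangulated_of_precomp_iso (dbFunctorFac F)

/-- The value of the functor on an object given by a complex. -/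
def dbFunctorObjIso {K : CochainComplex (ModuleCat.{u} Sᵐᵒᵖ) ℤ} (hK : IsBoundedFG S K) :
    (dbFunctor F).obj (DbMod.of K hK) ≅ DbMod.of (mapCpx F K) (isBoundedFG_mapCpx F hK) :=
  (dbFunctorFac F).app (DbMod.kb K hK)

end

end

/-! ### Orthogonality and extension products. -/

noncomputable section

namespace CategoryTheory.ObjectProperty

variable {D : Type*} [Category D] [HasZeroObject D] [HasShift D ℤ] [Preadditive D]
  [∀ n : ℤ, (shiftFunctor D n).Additive] [Pretriangulated D]

instance (P : ObjectProperty D) : P.rightOrthogonal.IsStableUnderRetracts where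
  of_retract r hY X f hX := by
    rw [← Category.comp_id f, ← r.retract, ← Category.assoc, hY (f ≫ r.i) hX, zero_comp]

instance (P : ObjectProperty D) : P.leftOrthogonal.IsStableUnderRetracts where
  of_retract r hY X f hX := by
    rw [← Category.id_comp f, ← r.retract, Category.assoc, hY (r.r ≫ f) hX, comp_zero]

/-- Left and right orthogonals of shift-stable classes are thick, so vanishing passes from
generators to the envelope, one variable at a time. -/
lemma hom_triangEnvelope_eq_zero [IsTriangulated D] (P Q : ObjectProperty D)
    [P.IsStableUnderShift ℤ] [Q.IsStableUnderShift ℤ]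
    (h : ∀ X Y, P X → Q Y → ∀ f : X ⟶ Y, f = 0) (X Y : D) (hX : P.triangEnvelope X)
    (hY : Q.triangEnvelope Y) (f : X ⟶ Y) : f = 0 := by
  have h1 : P.triangEnvelope ≤ Q.leftOrthogonal :=
    P.triangEnvelope_le_iff.2 fun X hX Y f hY => h X Y hX hY f
  have h2 : Q.triangEnvelope ≤ P.triangEnvelope.rightOrthogonal :=
    Q.triangEnvelope_le_iff.2 fun Y hY X f hX => h1 X hX f hY
  exact h2 Y hY f hX

variable (U V : ObjectProperty D)
  (h : ∀ X Y, U X → V Y → ∀ f : X ⟶ Y, f = 0)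

-- An extension of an object of `U` by an object of `V` has its connecting morphism in
-- $\operatorname{Hom}(U,V)=0$. It is therefore a direct sum, and the two summands can be read in
-- the other order.
include h in
lemma extensionProduct_le_of_hom_eq_zero [V.IsStableUnderShift ℤ] :
    extensionProduct V U ≤ extensionProduct U V := by
  rintro X ⟨Y, Z, f, g, δ, hT, hY, hZ⟩
  have hδ : δ = 0 := h _ _ hZ (V.le_shift (1 : ℤ) _ hY) δ
  obtain ⟨e, -, -⟩ := exists_iso_binaryBiproduct_of_distTriang _ hT hδ
  refine (extensionProduct U V).prop_of_iso
    (show Z ⊞ Y ≅ X from biprod.braiding _ _ ≪≫ e.symm) ?_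
  exact ⟨_, _, _, _, _, binaryBiproductTriangle_distinguished Z Y, hZ, hY⟩

-- Associativity and the exchange $V*U\subseteq U*V$ give $(U*V)*(U*V)=U*(V*U)*V\subseteq
-- (U*U)*(V*V)\subseteq U*V$.
include h in
lemma extensionProduct_isTriangulated [IsTriangulated D] [U.IsTriangulated] [V.IsTriangulated]
    [U.IsClosedUnderIsomorphisms] [V.IsClosedUnderIsomorphisms] :
    (extensionProduct U V).IsTriangulated where
  exists_zero := ⟨0, isZero_zero D, le_extensionProduct_left (P := U) (Q := V) _
    (U.prop_of_isZero (isZero_zero D))⟩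
  toIsTriangulatedClosed₂ := .mk' fun T hT h₁ h₃ => by
    have h1 : extensionProduct (extensionProduct U V) (extensionProduct U V) T.obj₂ :=
      ⟨_, _, _, _, _, hT, h₁, h₃⟩
    rw [extensionProduct_assoc] at h1
    have h2 := monotone_extensionProduct_right U ((extensionProduct_assoc V U V).ge.trans
      (monotone_extensionProduct_left V (extensionProduct_le_of_hom_eq_zero U V h))) _ h1
    rw [extensionProduct_assoc, ← extensionProduct_assoc U U] at h2
    exact monotone_extensionProduct_left _ (extensionProduct_le_of_isTriangulatedClosed₂ le_rfl
      le_rfl) _ (monotone_extensionProduct_right _ (extensionProduct_le_of_isTriangulatedClosed₂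
        le_rfl le_rfl) _ h2)

-- The idempotent on the middle term of the triangle induces one on the `U`-part. Splitting it gives
-- the `U`-part of the retract, and the cone of the resulting map turns out to be a retract of the
-- `V`-part.
include h in
lemma extensionProduct_isStableUnderRetracts [IsIdempotentComplete D] [V.IsStableUnderShift ℤ]
    [U.IsStableUnderRetracts] [V.IsStableUnderRetracts] :
    (extensionProduct U V).IsStableUnderRetracts where
  of_retract {X Z} ρ hZ := by
    obtain ⟨U', V', f, g, δ, hT, hU', hV'⟩ := hZ
    -- As $\operatorname{Hom}(U',V'[-1])=0$, endomorphisms of `U'` are determined by their composite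
    -- with `f`; this makes the lift `a` idempotent.
    have inj (φ : U' ⟶ U') (hφ : φ ≫ f = 0) : φ = 0 := by
      obtain ⟨ψ, hψ⟩ := exists_lift₂ (inv_rot_of_distTriang _ hT) φ hφ
      rw [← hψ]
      exact (congrArg (· ≫ _) (h _ _ hU' (V.le_shift (-1 : ℤ) _ hV') ψ)).trans zero_comp
    obtain ⟨a, ha⟩ := exists_lift₂ hT (f ≫ ρ.r ≫ ρ.i) (h _ _ hU' hV' _)
    have ha2 : a ≫ a = a := by
      rw [← sub_eq_zero]
      refine inj _ ?_
      rw [Preadditive.sub_comp, Category.assoc, ha, ← Category.assoc, ha]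
      simp
    obtain ⟨U'', j, r, hjr, hrj⟩ := IsIdempotentComplete.idempotents_split U' a ha2
    obtain ⟨C, c, d, hC⟩ := distinguished_cocone_triangle (j ≫ f ≫ ρ.r)
    have h1 : (j ≫ f ≫ ρ.r) ≫ ρ.i = j ≫ f := by
      rw [Category.assoc, Category.assoc, ← ha, ← hrj, ← Category.assoc, ← Category.assoc, hjr,
        Category.id_comp]
    have h2 : f ≫ ρ.r = r ≫ j ≫ f ≫ ρ.r := by
      rw [← Category.assoc, hrj, ← Category.assoc a, ha, Category.assoc, Category.assoc,
        ρ.retract, Category.comp_id]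
    obtain ⟨s, hs₁, hs₂⟩ := complete_distinguished_triangle_morphism _ _ hC hT j ρ.i h1
    obtain ⟨t, ht₁, ht₂⟩ := complete_distinguished_triangle_morphism _ _ hT hC r ρ.r h2
    change C ⟶ V' at s
    change V' ⟶ C at t
    -- The maps `s` and `t` are not canonical, so `s ≫ t` need not be the identity. It is
    -- invertible, being the third component of an endomorphism of a triangle whose other components
    -- are identities, and `t` is corrected by its inverse.
    have hst : IsIso (s ≫ t) :=
      isIso₃_of_isIso₁₂
        (Triangle.homMk (Triangle.mk (j ≫ f ≫ ρ.r) c d) (Triangle.mk f g δ) j ρ.i s h1 hs₁ hs₂ ≫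
          Triangle.homMk (Triangle.mk f g δ) (Triangle.mk (j ≫ f ≫ ρ.r) c d) r ρ.r t h2 ht₁ ht₂)
        hC hC (by
          change IsIso (j ≫ r); rw [hjr]; infer_instance) (by
          change IsIso (ρ.i ≫ ρ.r); rw [ρ.retract]; infer_instance)
    exact ⟨_, _, _, _, _, hC, U.prop_of_retract ⟨j, r, hjr⟩ hU',
      V.prop_of_retract (Y := V') ⟨s, t ≫ inv (s ≫ t), by
        rw [← Category.assoc]; exact IsIso.hom_inv_id (s ≫ t)⟩ hV'⟩

end CategoryTheory.ObjectProperty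

end

/-! ### Total complexes of a biadditive functor. -/

noncomputable section

open HomologicalComplex

section

variable {S₁ S₂ S : Type u} [Ring S₁] [Ring S₂] [Ring S]
  (F : ModuleCat.{u} S₁ ⥤ ModuleCat.{u} S₂ ⥤ ModuleCat.{u} S) [F.Additive]
  [∀ M, (F.obj M).Additive]

/-- The degree `n` part of the tensor product of families of maps in each degree. -/
def bimap {K K' : CochainComplex (ModuleCat.{u} S₁) ℤ} {L L' : CochainComplex (ModuleCat.{u} S₂) ℤ}
    (a : ∀ i, K.X i ⟶ K'.X i) (b : ∀ j, L.X j ⟶ L'.X j) (n : ℤ) :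
    (mapBifunctor K L F (ComplexShape.up ℤ)).X n ⟶
      (mapBifunctor K' L' F (ComplexShape.up ℤ)).X n :=
  mapBifunctorDesc fun i j h => (F.map (a i)).app _ ≫ (F.obj _).map (b j) ≫
    ιMapBifunctor K' L' F (ComplexShape.up ℤ) i j n h

lemma ι_bimap {K K' : CochainComplex (ModuleCat.{u} S₁) ℤ}
    {L L' : CochainComplex (ModuleCat.{u} S₂) ℤ}
    (a : ∀ i, K.X i ⟶ K'.X i) (b : ∀ j, L.X j ⟶ L'.X j) (n i j : ℤ)
    (h : ComplexShape.π (ComplexShape.up ℤ) (ComplexShape.up ℤ) (ComplexShape.up ℤ) (i, j) = n) :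
    ιMapBifunctor K L F (ComplexShape.up ℤ) i j n h ≫ bimap F a b n =
      (F.map (a i)).app _ ≫ (F.obj _).map (b j) ≫
        ιMapBifunctor K' L' F (ComplexShape.up ℤ) i j n h :=
  ι_mapBifunctorDesc _ _ _ _

variable {K K' K'' : CochainComplex (ModuleCat.{u} S₁) ℤ}
  {L L' L'' : CochainComplex (ModuleCat.{u} S₂) ℤ}

lemma bimap_id (n : ℤ) : bimap F (fun i => 𝟙 (K.X i)) (fun j => 𝟙 (L.X j)) n = 𝟙 _ := by
  refine mapBifunctor.hom_ext fun i j h => ?_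
  rw [ι_bimap, CategoryTheory.Functor.map_id, CategoryTheory.Functor.map_id]
  simp

lemma bimap_comp (a : ∀ i, K.X i ⟶ K'.X i) (b : ∀ j, L.X j ⟶ L'.X j)
    (a' : ∀ i, K'.X i ⟶ K''.X i) (b' : ∀ j, L'.X j ⟶ L''.X j) (n : ℤ) :
    bimap F a b n ≫ bimap F a' b' n = bimap F (fun i => a i ≫ a' i) (fun j => b j ≫ b' j) n := by
  refine mapBifunctor.hom_ext fun i j h => ?_
  rw [ι_bimap, reassoc_of% (ι_bimap F)]
  simp [ι_bimap]

lemma bimap_add_left (a a' : ∀ i, K.X i ⟶ K'.X i) (b : ∀ j, L.X j ⟶ L'.X j) (n : ℤ) :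
    bimap F (fun i => a i + a' i) b n = bimap F a b n + bimap F a' b n := by
  refine mapBifunctor.hom_ext fun i j h => ?_
  rw [Preadditive.comp_add, ι_bimap, ι_bimap, ι_bimap, Functor.map_add (F := F)]
  simp

lemma bimap_add_right (a : ∀ i, K.X i ⟶ K'.X i) (b b' : ∀ j, L.X j ⟶ L'.X j) (n : ℤ) :
    bimap F a (fun j => b j + b' j) n = bimap F a b n + bimap F a b' n := by
  refine mapBifunctor.hom_ext fun i j h => ?_
  rw [Preadditive.comp_add, ι_bimap, ι_bimap, ι_bimap, Functor.map_add (F := F.obj _)]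
  simp

lemma mapBifunctorMap_f_eq_bimap (f : K ⟶ K') (g : L ⟶ L') (n : ℤ) :
    (mapBifunctorMap f g F (ComplexShape.up ℤ)).f n = bimap F f.f g.f n := by
  refine mapBifunctor.hom_ext fun i j h => ?_
  rw [ι_bimap, ι_mapBifunctorMap]

variable (K L)

/-- Degreewise splittings need not commute with differentials. `bimap` accepts arbitrary families of
maps, so it transports them to the total complex without exactness of `F`. -/
lemma exists_shortExact_mapBifunctor_left
    (T : ShortComplex (CochainComplex (ModuleCat.{u} S₁) ℤ))
    (hT : ∀ n, Nonempty (T.map (HomologicalComplex.eval _ _ n)).Splitting) :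
    ∃ w, (ShortComplex.mk (mapBifunctorMap T.f (𝟙 L) F (ComplexShape.up ℤ))
      (mapBifunctorMap T.g (𝟙 L) F (ComplexShape.up ℤ)) w).ShortExact := by
  have w : mapBifunctorMap T.f (𝟙 L) F (ComplexShape.up ℤ) ≫
      mapBifunctorMap T.g (𝟙 L) F (ComplexShape.up ℤ) = 0 := by
    ext n : 1
    refine (congrArg₂ (· ≫ ·) (mapBifunctorMap_f_eq_bimap F T.f (𝟙 L) n)
      (mapBifunctorMap_f_eq_bimap F T.g (𝟙 L) n)).trans ((bimap_comp F _ _ _ _ n).trans ?_)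
    refine mapBifunctor.hom_ext fun i j h => ?_
    simp [ι_bimap, ← comp_f, T.zero]
  obtain ⟨r, s, h1, h2, h3⟩ : ∃ (r : ∀ n, T.X₂.X n ⟶ T.X₁.X n) (s : ∀ n, T.X₃.X n ⟶ T.X₂.X n),
      (∀ n, T.f.f n ≫ r n = 𝟙 _) ∧ (∀ n, s n ≫ T.g.f n = 𝟙 _) ∧
        ∀ n, r n ≫ T.f.f n + T.g.f n ≫ s n = 𝟙 _ :=
    ⟨fun n => (hT n).some.r, fun n => (hT n).some.s, fun n => (hT n).some.f_r,
      fun n => (hT n).some.s_g, fun n => (hT n).some.id⟩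
  refine ⟨w, shortExact_of_degreewise_shortExact _ fun n => ShortComplex.Splitting.shortExact ?_⟩
  exact
    { r := bimap F r (fun j => 𝟙 (L.X j)) n
      s := bimap F s (fun j => 𝟙 (L.X j)) n
      f_r := by
        refine (congrArg (· ≫ _) (mapBifunctorMap_f_eq_bimap F T.f (𝟙 L) n)).trans ?_
        refine (bimap_comp F _ _ _ _ n).trans ?_
        simp only [h1, id_f, Category.comp_id]
        exact bimap_id F n
      s_g := by
        refine (congrArg (_ ≫ ·) (mapBifunctorMap_f_eq_bimap F T.g (𝟙 L) n)).trans ?_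
        refine (bimap_comp F _ _ _ _ n).trans ?_
        simp only [h2, id_f, Category.comp_id]
        exact bimap_id F n
      id := by
        refine (congrArg₂ (· + ·)
          ((congrArg (_ ≫ ·) (mapBifunctorMap_f_eq_bimap F T.f (𝟙 L) n)).trans
            (bimap_comp F _ _ _ _ n))
          ((congrArg (· ≫ _) (mapBifunctorMap_f_eq_bimap F T.g (𝟙 L) n)).trans
            (bimap_comp F _ _ _ _ n))).trans ?_
        simp only [id_f, Category.comp_id]
        refine (bimap_add_left F _ _ _ n).symm.trans ?_
        simp only [h3]
        exact bimap_id F n }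

lemma exists_shortExact_mapBifunctor_right
    (T : ShortComplex (CochainComplex (ModuleCat.{u} S₂) ℤ))
    (hT : ∀ n, Nonempty (T.map (HomologicalComplex.eval _ _ n)).Splitting) :
    ∃ w, (ShortComplex.mk (mapBifunctorMap (𝟙 K) T.f F (ComplexShape.up ℤ))
      (mapBifunctorMap (𝟙 K) T.g F (ComplexShape.up ℤ)) w).ShortExact := by
  have w : mapBifunctorMap (𝟙 K) T.f F (ComplexShape.up ℤ) ≫
      mapBifunctorMap (𝟙 K) T.g F (ComplexShape.up ℤ) = 0 := by
    ext n : 1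
    refine (congrArg₂ (· ≫ ·) (mapBifunctorMap_f_eq_bimap F (𝟙 K) T.f n)
      (mapBifunctorMap_f_eq_bimap F (𝟙 K) T.g n)).trans ((bimap_comp F _ _ _ _ n).trans ?_)
    refine mapBifunctor.hom_ext fun i j h => ?_
    simp [ι_bimap, ← comp_f, T.zero]
  obtain ⟨r, s, h1, h2, h3⟩ : ∃ (r : ∀ n, T.X₂.X n ⟶ T.X₁.X n) (s : ∀ n, T.X₃.X n ⟶ T.X₂.X n),
      (∀ n, T.f.f n ≫ r n = 𝟙 _) ∧ (∀ n, s n ≫ T.g.f n = 𝟙 _) ∧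
        ∀ n, r n ≫ T.f.f n + T.g.f n ≫ s n = 𝟙 _ :=
    ⟨fun n => (hT n).some.r, fun n => (hT n).some.s, fun n => (hT n).some.f_r,
      fun n => (hT n).some.s_g, fun n => (hT n).some.id⟩
  refine ⟨w, shortExact_of_degreewise_shortExact _ fun n => ShortComplex.Splitting.shortExact ?_⟩
  exact
    { r := bimap F (fun j => 𝟙 (K.X j)) r n
      s := bimap F (fun j => 𝟙 (K.X j)) s n
      f_r := by
        refine (congrArg (· ≫ _) (mapBifunctorMap_f_eq_bimap F (𝟙 K) T.f n)).trans ?_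
        refine (bimap_comp F _ _ _ _ n).trans ?_
        simp only [h1, id_f, Category.comp_id]
        exact bimap_id F n
      s_g := by
        refine (congrArg (_ ≫ ·) (mapBifunctorMap_f_eq_bimap F (𝟙 K) T.g n)).trans ?_
        refine (bimap_comp F _ _ _ _ n).trans ?_
        simp only [h2, id_f, Category.comp_id]
        exact bimap_id F n
      id := by
        refine (congrArg₂ (· + ·)
          ((congrArg (_ ≫ ·) (mapBifunctorMap_f_eq_bimap F (𝟙 K) T.f n)).trans
            (bimap_comp F _ _ _ _ n))
          ((congrArg (· ≫ _) (mapBifunctorMap_f_eq_bimap F (𝟙 K) T.g n)).trans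
            (bimap_comp F _ _ _ _ n))).trans ?_
        simp only [id_f, Category.comp_id]
        refine (bimap_add_right F _ _ _ n).symm.trans ?_
        simp only [h3]
        exact bimap_id F n }

variable {L}

/-- A morphism of a module `M` to the cocycles of degree zero of `K` induces a map from `F M L`
to the total complex of `F K L`. -/
def insertLeft {M : ModuleCat.{u} S₁} (φ : M ⟶ K.X 0) (hφ : φ ≫ K.d 0 1 = 0) :
    ((F.obj M).mapHomologicalComplex (ComplexShape.up ℤ)).obj L ⟶
      mapBifunctor K L F (ComplexShape.up ℤ) where
  f n := (F.map φ).app (L.X n) ≫ ιMapBifunctor K L F (ComplexShape.up ℤ) 0 n n (zero_add n)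
  comm' i j hij := by
    simp only [ComplexShape.up_Rel] at hij
    subst hij
    have h1 : mapBifunctor.d₁ K L F (ComplexShape.up ℤ) 0 i (i + 1) =
        (F.map (K.d 0 1)).app (L.X i) ≫ ιMapBifunctor K L F (ComplexShape.up ℤ) 1 i (i + 1)
          (add_comm _ _) := by
      rw [mapBifunctor.d₁_eq _ _ _ _ (show (ComplexShape.up ℤ).Rel 0 1 from rfl) _ _
        (add_comm _ _)]
      exact one_smul _ _
    have h2 : mapBifunctor.d₂ K L F (ComplexShape.up ℤ) 0 i (i + 1) =
        (F.obj (K.X 0)).map (L.d i (i + 1)) ≫ ιMapBifunctor K L F (ComplexShape.up ℤ) 0 (i + 1)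
          (i + 1) (zero_add _) := by
      rw [mapBifunctor.d₂_eq _ _ _ _ _ (show (ComplexShape.up ℤ).Rel i (i + 1) from rfl) _
        (zero_add _)]
      exact one_smul _ _
    have h3 : ((F.map φ).app (L.X i) ≫ ιMapBifunctor K L F (ComplexShape.up ℤ) 0 i i (zero_add i)) ≫
        (mapBifunctor K L F (ComplexShape.up ℤ)).d i (i + 1) =
      (F.obj M).map (L.d i (i + 1)) ≫ (F.map φ).app (L.X (i + 1)) ≫
        ιMapBifunctor K L F (ComplexShape.up ℤ) 0 (i + 1) (i + 1) (zero_add _) := by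
      rw [Category.assoc, mapBifunctor.d_eq, Preadditive.comp_add, mapBifunctor.ι_D₁,
        mapBifunctor.ι_D₂, h1, h2, Preadditive.comp_add, ← Category.assoc, ← NatTrans.comp_app,
        ← Functor.map_comp, hφ, Functor.map_zero]
      simp
    exact h3

variable {K} in
lemma insertLeft_comp_mapBifunctorMap {M : ModuleCat.{u} S₁} (φ : M ⟶ K.X 0)
    (hφ : φ ≫ K.d 0 1 = 0) (f : K ⟶ K') (hφ' : (φ ≫ f.f 0) ≫ K'.d 0 1 = 0) :
    insertLeft F (L := L) K φ hφ ≫ mapBifunctorMap f (𝟙 L) F (ComplexShape.up ℤ) =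
      insertLeft F K' (φ ≫ f.f 0) hφ' := by
  ext n : 1
  refine (Category.assoc _ _ _).trans ((congrArg (_ ≫ ·)
    (ι_mapBifunctorMap f (𝟙 L) F (ComplexShape.up ℤ) 0 n n (zero_add n))).trans ?_)
  have h : (F.map φ).app (L.X n) ≫ (F.map (f.f 0)).app (L.X n) ≫ (F.obj (K'.X 0)).map (𝟙 (L.X n)) ≫
      ιMapBifunctor K' L F (ComplexShape.up ℤ) 0 n n (zero_add n) =
      (F.map (φ ≫ f.f 0)).app (L.X n) ≫ ιMapBifunctor K' L F (ComplexShape.up ℤ) 0 n n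
        (zero_add n) := by
    simp
  exact h

/-- A morphism of a module `M` to the cocycles of degree zero of `L` induces a map from `F K M`
to the total complex of `F K L`. -/
def insertRight {M : ModuleCat.{u} S₂} (φ : M ⟶ L.X 0) (hφ : φ ≫ L.d 0 1 = 0) :
    ((F.flip.obj M).mapHomologicalComplex (ComplexShape.up ℤ)).obj K ⟶
      mapBifunctor K L F (ComplexShape.up ℤ) where
  f n := (F.obj (K.X n)).map φ ≫ ιMapBifunctor K L F (ComplexShape.up ℤ) n 0 n (add_zero n)
  comm' i j hij := by
    simp only [ComplexShape.up_Rel] at hij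
    subst hij
    have h1 : mapBifunctor.d₁ K L F (ComplexShape.up ℤ) i 0 (i + 1) =
        (F.map (K.d i (i + 1))).app (L.X 0) ≫ ιMapBifunctor K L F (ComplexShape.up ℤ) (i + 1) 0
          (i + 1) (add_zero _) := by
      rw [mapBifunctor.d₁_eq _ _ _ _ (show (ComplexShape.up ℤ).Rel i (i + 1) from rfl) _ _
        (add_zero _)]
      exact one_smul _ _
    have h2 : mapBifunctor.d₂ K L F (ComplexShape.up ℤ) i 0 (i + 1) =
        i.negOnePow • ((F.obj (K.X i)).map (L.d 0 1) ≫ ιMapBifunctor K L F (ComplexShape.up ℤ) i 1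
          (i + 1) rfl) := by
      rw [mapBifunctor.d₂_eq _ _ _ _ _ (show (ComplexShape.up ℤ).Rel 0 1 from rfl) (i + 1)
        (show i + 1 = i + 1 from rfl)]
      rfl
    have h3 : ((F.obj (K.X i)).map φ ≫ ιMapBifunctor K L F (ComplexShape.up ℤ) i 0 i (add_zero i)) ≫
        (mapBifunctor K L F (ComplexShape.up ℤ)).d i (i + 1) =
      (F.map (K.d i (i + 1))).app M ≫ (F.obj (K.X (i + 1))).map φ ≫
        ιMapBifunctor K L F (ComplexShape.up ℤ) (i + 1) 0 (i + 1) (add_zero _) := by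
      rw [Category.assoc, mapBifunctor.d_eq, Preadditive.comp_add, mapBifunctor.ι_D₁,
        mapBifunctor.ι_D₂, h1, h2, Preadditive.comp_add, Linear.comp_units_smul, ← Category.assoc,
        ← Category.assoc ((F.obj (K.X i)).map φ) ((F.obj (K.X i)).map (L.d 0 1)),
        ← Functor.map_comp, hφ, Functor.map_zero]
      simp
    exact h3

/-- Constructor for morphisms of complexes from a total complex. -/
def mapBifunctorDescHom {Q : CochainComplex (ModuleCat.{u} S) ℤ}
    (e : ∀ i j n : ℤ, i + j = n → ((F.obj (K.X i)).obj (L.X j) ⟶ Q.X n))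
    (he : ∀ (i j n : ℤ) (h : i + j = n), e i j n h ≫ Q.d n (n + 1) =
      (F.map (K.d i (i + 1))).app (L.X j) ≫ e (i + 1) j (n + 1) (by omega) +
        i.negOnePow • ((F.obj (K.X i)).map (L.d j (j + 1)) ≫ e i (j + 1) (n + 1) (by omega))) :
    mapBifunctor K L F (ComplexShape.up ℤ) ⟶ Q where
  f n := mapBifunctorDesc fun i j h => e i j n h
  comm' n m hnm := by
    simp only [ComplexShape.up_Rel] at hnm
    subst hnm
    refine mapBifunctor.hom_ext fun i j h => ?_
    have h : i + j = n := h
    have h1 : mapBifunctor.d₁ K L F (ComplexShape.up ℤ) i j (n + 1) =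
        (F.map (K.d i (i + 1))).app (L.X j) ≫ ιMapBifunctor K L F (ComplexShape.up ℤ) (i + 1) j
          (n + 1) (show i + 1 + j = n + 1 by omega) := by
      rw [mapBifunctor.d₁_eq _ _ _ _ (show (ComplexShape.up ℤ).Rel i (i + 1) from rfl) _ _
        (show i + 1 + j = n + 1 by omega)]
      exact one_smul _ _
    have h2 : mapBifunctor.d₂ K L F (ComplexShape.up ℤ) i j (n + 1) =
        i.negOnePow • ((F.obj (K.X i)).map (L.d j (j + 1)) ≫ ιMapBifunctor K L F
          (ComplexShape.up ℤ) i (j + 1) (n + 1) (show i + (j + 1) = n + 1 by omega)) := by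
      rw [mapBifunctor.d₂_eq _ _ _ _ _ (show (ComplexShape.up ℤ).Rel j (j + 1) from rfl) (n + 1)
        (show i + (j + 1) = n + 1 by omega)]
      rfl
    rw [ι_mapBifunctorDesc_assoc, he i j n h, mapBifunctor.d_eq, Preadditive.add_comp,
      Preadditive.comp_add, ← Category.assoc, mapBifunctor.ι_D₁, ← Category.assoc,
      mapBifunctor.ι_D₂, h1, h2, Category.assoc, ι_mapBifunctorDesc, Linear.units_smul_comp,
      Category.assoc, ι_mapBifunctorDesc]

lemma ι_mapBifunctorDescHom_f {Q : CochainComplex (ModuleCat.{u} S) ℤ}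
    (e : ∀ i j n : ℤ, i + j = n → ((F.obj (K.X i)).obj (L.X j) ⟶ Q.X n))
    (he : ∀ (i j n : ℤ) (h : i + j = n), e i j n h ≫ Q.d n (n + 1) =
      (F.map (K.d i (i + 1))).app (L.X j) ≫ e (i + 1) j (n + 1) (by omega) +
        i.negOnePow • ((F.obj (K.X i)).map (L.d j (j + 1)) ≫ e i (j + 1) (n + 1) (by omega)))
    (i j n : ℤ) (h : i + j = n) :
    ιMapBifunctor K L F (ComplexShape.up ℤ) i j n h ≫ (mapBifunctorDescHom F K e he).f n =
      e i j n h :=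
  ι_mapBifunctorDesc (K₁ := K) (K₂ := L) (F := F) (c := ComplexShape.up ℤ)
    (fun i j h => e i j n h) i j h

variable (L)

-- With `K` concentrated in degree `0`, the total complex has a single nonzero summand in each
-- degree.
variable {K} in
lemma isIso_ι_left (hK : ∀ i, i ≠ 0 → IsZero (K.X i)) (n : ℤ) :
    IsIso (ιMapBifunctor K L F (ComplexShape.up ℤ) 0 n n (zero_add n)) := by
  refine ⟨mapBifunctorDesc fun i j h => if hi : i = 0 then eqToHom (by
    subst hi; obtain rfl : j = n := (zero_add j).symm.trans h; rfl) else 0, ?_, ?_⟩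
  · rw [ι_mapBifunctorDesc]; simp
  · refine mapBifunctor.hom_ext fun i j h => ?_
    by_cases hi : i = 0
    · subst hi
      obtain rfl : j = n := (zero_add j).symm.trans h
      rw [ι_mapBifunctorDesc_assoc]; simp
    · exact ((F.map_isZero (hK i hi)).obj (L.X j)).eq_of_src _ _

variable {L} in
lemma isIso_ι_right (hL : ∀ i, i ≠ 0 → IsZero (L.X i)) (n : ℤ) :
    IsIso (ιMapBifunctor K L F (ComplexShape.up ℤ) n 0 n (add_zero n)) := by
  refine ⟨mapBifunctorDesc fun j i h => if hi : i = 0 then eqToHom (by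
    subst hi; obtain rfl : j = n := (add_zero j).symm.trans h; rfl) else 0, ?_, ?_⟩
  · rw [ι_mapBifunctorDesc]; simp
  · refine mapBifunctor.hom_ext fun j i h => ?_
    by_cases hi : i = 0
    · subst hi
      obtain rfl : j = n := (add_zero j).symm.trans h
      rw [ι_mapBifunctorDesc_assoc]; simp
    · exact ((F.obj (K.X j)).map_isZero (hL i hi)).eq_of_src _ _

/-- The total complex of `F K L` for `K` a module placed in degree zero. -/
def insertLeftSingleIso (M : ModuleCat.{u} S₁) :
    ((F.obj M).mapHomologicalComplex (ComplexShape.up ℤ)).obj L ≅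
      mapBifunctor ((single _ (ComplexShape.up ℤ) 0).obj M) L F (ComplexShape.up ℤ) :=
  have : IsIso (insertLeft F (L := L) ((single _ (ComplexShape.up ℤ) 0).obj M)
      (singleObjXSelf (ComplexShape.up ℤ) 0 M).inv (by simp)) := by
    have h n : IsIso ((insertLeft F (L := L) ((single _ (ComplexShape.up ℤ) 0).obj M)
      (singleObjXSelf (ComplexShape.up ℤ) 0 M).inv (by simp)).f n) := by
      have := isIso_ι_left F (K := (single _ (ComplexShape.up ℤ) 0).obj M) L
        (fun i hi => isZero_single_obj_X _ _ _ _ hi) n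
      exact inferInstanceAs (IsIso ((F.map (singleObjXSelf (ComplexShape.up ℤ) 0 M).inv).app (L.X n) ≫
        ιMapBifunctor ((single _ (ComplexShape.up ℤ) 0).obj M) L F
          (ComplexShape.up ℤ) 0 n n (zero_add n)))
    exact Hom.isIso_of_components _
  asIso (insertLeft F (L := L) ((single _ (ComplexShape.up ℤ) 0).obj M)
      (singleObjXSelf (ComplexShape.up ℤ) 0 M).inv _)

/-- The total complex of `F K L` for `L` a module placed in degree zero. -/
def insertRightSingleIso (M : ModuleCat.{u} S₂) :
    ((F.flip.obj M).mapHomologicalComplex (ComplexShape.up ℤ)).obj K ≅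
      mapBifunctor K ((single _ (ComplexShape.up ℤ) 0).obj M) F (ComplexShape.up ℤ) :=
  have : IsIso (insertRight F K (L := (single _ (ComplexShape.up ℤ) 0).obj M)
      (singleObjXSelf (ComplexShape.up ℤ) 0 M).inv (by simp)) := by
    have h n : IsIso ((insertRight F K (L := (single _ (ComplexShape.up ℤ) 0).obj M)
      (singleObjXSelf (ComplexShape.up ℤ) 0 M).inv (by simp)).f n) := by
      have := isIso_ι_right F K (L := (single _ (ComplexShape.up ℤ) 0).obj M)
        (fun i hi => isZero_single_obj_X _ _ _ _ hi) n
      exact inferInstanceAs (IsIso ((F.obj (K.X n)).map (singleObjXSelf (ComplexShape.up ℤ) 0 M).inv ≫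
        ιMapBifunctor K ((single _ (ComplexShape.up ℤ) 0).obj M) F
          (ComplexShape.up ℤ) n 0 n (add_zero n)))
    exact Hom.isIso_of_components _
  asIso (insertRight F K (L := (single _ (ComplexShape.up ℤ) 0).obj M)
      (singleObjXSelf (ComplexShape.up ℤ) 0 M).inv _)

end

end

/-! ### Exactness of the tensor product over `k` and dévissage in one factor. -/

noncomputable section

open scoped ModuleCat

section

variable (k : Type u) [Field k] (R : Type u) [Ring R] [Algebra k R]
  (A : Type u) [Ring A] [Algebra k A]

instance (N : ModuleCat.{u} Aᵐᵒᵖ) : ((tensorBifunctor k R A).flip.obj N).Additive where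
  map_add := tensorObj_hom_ext k R A fun _ _ => TensorProduct.add_tmul _ _ _

lemma isExactFG_tensorBifunctor_obj (M : ModuleCat.{u} Rᵐᵒᵖ) (hM : Module.Finite Rᵐᵒᵖ M) :
    IsExactFG ((tensorBifunctor k R A).obj M) where
  additive := inferInstance
  preservesHomology := by
    refine (((tensorBifunctor k R A).obj M).exact_tfae.out 1 2).1 fun T hT => ?_
    rw [ShortComplex.ShortExact.moduleCat_exact_iff_function_exact] at hT ⊢
    exact Module.Flat.lTensor_exact M (f := T.f.hom.restrictScalars k)
      (g := T.g.hom.restrictScalars k) hT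
  finite N hN := finite_tensorObj k R A M N hM hN

lemma isExactFG_tensorBifunctor_flip_obj (N : ModuleCat.{u} Aᵐᵒᵖ) (hN : Module.Finite Aᵐᵒᵖ N) :
    IsExactFG ((tensorBifunctor k R A).flip.obj N) where
  additive := inferInstance
  preservesHomology := by
    refine (((tensorBifunctor k R A).flip.obj N).exact_tfae.out 1 2).1 fun T hT => ?_
    rw [ShortComplex.ShortExact.moduleCat_exact_iff_function_exact] at hT ⊢
    exact Module.Flat.rTensor_exact N (f := T.f.hom.restrictScalars k)
      (g := T.g.hom.restrictScalars k) hT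
  finite M hM := finite_tensorObj k R A M N hM hN

variable {k R A}

/-- The tensor product of an acyclic bounded complex with a bounded complex is acyclic. -/
lemma acyclic_tensorComplex {B : CochainComplex (ModuleCat.{u} Rᵐᵒᵖ) ℤ} (hB : B.Acyclic)
    {P : CochainComplex (ModuleCat.{u} Aᵐᵒᵖ) ℤ} (hP : IsBoundedFG A P) :
    (tensorComplex k R A B P).Acyclic := by
  refine IsBoundedFG.induction (Φ := fun P => (tensorComplex k R A B P).Acyclic) ?_ ?_ ?_ P hP
  · intro K hK
    refine HomologicalComplex.acyclic_of_isZero _ ?_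
    rw [IsZero.iff_id_eq_zero]
    ext n : 1
    refine HomologicalComplex.mapBifunctor.hom_ext fun i j h => ?_
    exact (((tensorBifunctor k R A).obj _).map_isZero
      ((HomologicalComplex.eval _ _ j).map_isZero hK)).eq_of_src _ _
  · intro T hT h _ _ _ h1 h3
    obtain ⟨w, hw⟩ := exists_shortExact_mapBifunctor_right (tensorBifunctor k R A) B T h
    intro n
    rw [HomologicalComplex.exactAt_iff_isZero_homology]
    exact (hw.homology_exact₂ n).isZero_of_both_zeros
      ((h1 n).isZero_homology.eq_of_src _ _) ((h3 n).isZero_homology.eq_of_tgt _ _)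
  · intro n M hM
    have := isExactFG_tensorBifunctor_flip_obj k R A M hM
    -- For a module in degree `0` the tensor complex is $B\otimes M$ term by term, acyclic by
    -- flatness over a field. Other degrees follow by shifting.
    have h0 : (tensorComplex k R A B ((HomologicalComplex.single _ _ 0).obj M)).Acyclic := fun i =>
      (mapCpx_exactAt ((tensorBifunctor k R A).flip.obj M) i (hB i)).of_iso
        (insertRightSingleIso (tensorBifunctor k R A) B M)
    have e : (tensorComplex k R A B ((HomologicalComplex.single _ _ 0).obj M))⟦-n⟧ ≅
        tensorComplex k R A B ((HomologicalComplex.single _ _ n).obj M) :=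
      (CochainComplex.mapBifunctorShift₂Iso B _ (tensorBifunctor k R A) (-n)).symm ≪≫
        ((tensorBifunctor k R A).map₂CochainComplex.obj B).mapIso
          (((CochainComplex.singleFunctors _).shiftIso (-n) n 0 (by simp)).app M)
    intro i
    refine HomologicalComplex.ExactAt.of_iso ?_ e
    rw [HomologicalComplex.exactAt_iff_isZero_homology]
    exact (h0 _).isZero_homology.of_iso ((CochainComplex.ShiftSequence.shiftIso _ (-n) i _ rfl).app _)

/-- An object `L ⊗ X` is built from the objects `M ⊗ X` for modules `M`. -/
lemma prop_of_tensorComplex (P : ObjectProperty (DbMod (R ⊗[k] A))) [P.IsTriangulated]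
    [P.IsClosedUnderIsomorphisms] {X : CochainComplex (ModuleCat.{u} Aᵐᵒᵖ) ℤ}
    (hX : IsBoundedFG A X)
    (h : ∀ (M : ModuleCat.{u} Rᵐᵒᵖ) (hM : Module.Finite Rᵐᵒᵖ M),
      P (have := isExactFG_tensorBifunctor_obj k R A M hM
        DbMod.of _ (isBoundedFG_mapCpx ((tensorBifunctor k R A).obj M) hX)))
    {L : CochainComplex (ModuleCat.{u} Rᵐᵒᵖ) ℤ} (hL : IsBoundedFG R L) :
    P (DbMod.of _ (isBoundedFG_tensorComplex k R A hL hX)) := by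
  refine IsBoundedFG.induction (Φ := fun L => ∀ hL : IsBoundedFG R L,
    P (DbMod.of _ (isBoundedFG_tensorComplex k R A hL hX))) ?_ ?_ ?_ L hL hL
  · intro K hK _
    refine P.prop_of_isZero (DbMod.isZero_of_acyclic _ (HomologicalComplex.acyclic_of_isZero _ ?_))
    rw [IsZero.iff_id_eq_zero]
    ext n : 1
    refine HomologicalComplex.mapBifunctor.hom_ext fun i j h => ?_
    exact (((tensorBifunctor k R A).map_isZero
      ((HomologicalComplex.eval _ _ i).map_isZero hK)).obj _).eq_of_src _ _
  · intro T hT h h1 h2 h3 h1' h3' _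
    obtain ⟨w, hw⟩ := exists_shortExact_mapBifunctor_left (tensorBifunctor k R A) X T h
    obtain ⟨δ, hδ⟩ := DbMod.exists_triangle_of_shortExact (isBoundedFG_tensorComplex k R A h1 hX)
      (isBoundedFG_tensorComplex k R A h2 hX) (isBoundedFG_tensorComplex k R A h3 hX) hw
    exact P.ext_of_isTriangulatedClosed₂ _ hδ (h1' h1) (h3' h3)
  · intro n M hM hn
    have h0 : P (DbMod.of _ (isBoundedFG_tensorComplex k R A (DbMod.isBoundedFG_single 0 M) hX)) :=
      P.prop_of_iso (DbMod.mapIso _ _ (insertLeftSingleIso (tensorBifunctor k R A) X M)) (h M hM)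
    have hM' := DbMod.isBoundedFG_single 0 M
    have e : (tensorComplex k R A ((HomologicalComplex.single _ _ 0).obj M) X)⟦-n⟧ ≅
        tensorComplex k R A ((HomologicalComplex.single _ _ n).obj M) X :=
      (CochainComplex.mapBifunctorShift₁Iso _ X (tensorBifunctor k R A) (-n)).symm  ≪≫
        ((tensorBifunctor k R A).map₂CochainComplex.flip.obj X).mapIso
          (((CochainComplex.singleFunctors _).shiftIso (-n) n 0 (by simp)).app M)
    refine P.prop_of_iso (DbMod.shiftIso _ (-n) ≪≫ DbMod.mapIso _ _ e) (P.le_shift (-n) _ h0)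

end

end

/-! ### The complex $\operatorname{Hom}_A(P,W)$ of $R$-modules and its evaluation map. -/

noncomputable section

open scoped ModuleCat
open CochainComplex CochainComplex.HomComplex

section

variable (k : Type u) [Field k] (R : Type u) [Ring R] [Algebra k R]
  (A : Type u) [Ring A] [Algebra k A]

/-- The homomorphism `Rᵐᵒᵖ → (R ⊗ A)ᵐᵒᵖ`. -/
def inclLeftOp : Rᵐᵒᵖ →+* (R ⊗[k] A)ᵐᵒᵖ :=
  RingHom.op (Algebra.TensorProduct.includeLeft : R →ₐ[k] R ⊗[k] A).toRingHom

/-- The homomorphism `Aᵐᵒᵖ → (R ⊗ A)ᵐᵒᵖ`. -/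
def inclRightOp : Aᵐᵒᵖ →+* (R ⊗[k] A)ᵐᵒᵖ :=
  RingHom.op (Algebra.TensorProduct.includeRight : A →ₐ[k] R ⊗[k] A).toRingHom

lemma inclLeftOp_mul_inclRightOp (r : R) (a : A) :
    inclLeftOp k R A (.op r) * inclRightOp k R A (.op a) = .op (r ⊗ₜ[k] a) := by
  change MulOpposite.op ((1 ⊗ₜ[k] a) * (r ⊗ₜ[k] 1)) = _
  simp

lemma inclRightOp_mul_inclLeftOp (r : R) (a : A) :
    inclRightOp k R A (.op a) * inclLeftOp k R A (.op r) = .op (r ⊗ₜ[k] a) := by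
  change MulOpposite.op ((r ⊗ₜ[k] 1) * (1 ⊗ₜ[k] a)) = _
  simp

/-- The restriction of right `R ⊗ A`-modules to right `A`-modules. -/
abbrev resRight : ModuleCat.{u} (R ⊗[k] A)ᵐᵒᵖ ⥤ ModuleCat.{u} Aᵐᵒᵖ :=
  ModuleCat.restrictScalars (inclRightOp k R A)

/-- The action of an element of `R` on the restriction of an `R ⊗ A`-module to `A`. -/
def leftAct (r : Rᵐᵒᵖ) : resRight k R A ⟶ resRight k R A where
  app W := ModuleCat.ofHom (X := (resRight k R A).obj W) (Y := (resRight k R A).obj W)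
    { toFun := fun w => (inclLeftOp k R A r • (show W from w) : W)
      map_add' := fun w w' => smul_add (inclLeftOp k R A r) (show W from w) (show W from w')
      map_smul' := fun a w => by
        change inclLeftOp k R A r • (inclRightOp k R A a • (show W from w)) =
          inclRightOp k R A a • inclLeftOp k R A r • (show W from w)
        rw [smul_smul, smul_smul]
        congr 1
        exact (inclLeftOp_mul_inclRightOp k R A r.unop a.unop).trans
          (inclRightOp_mul_inclLeftOp k R A r.unop a.unop).symm }
  naturality W W' f := by
    ext w
    exact (map_smul f.hom (inclLeftOp k R A r) (show W from w)).symm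

lemma leftAct_one : leftAct k R A 1 = 𝟙 _ := by
  ext W w
  exact (congrArg (· • (show W from w)) (map_one (inclLeftOp k R A))).trans
    (one_smul _ (show W from w))

lemma leftAct_mul (r s : Rᵐᵒᵖ) : leftAct k R A (r * s) = leftAct k R A s ≫ leftAct k R A r := by
  ext W w
  exact (congrArg (· • (show W from w)) (map_mul (inclLeftOp k R A) r s)).trans
    (mul_smul _ _ (show W from w))

lemma leftAct_add (r s : Rᵐᵒᵖ) : leftAct k R A (r + s) = leftAct k R A r + leftAct k R A s := by
  ext W w
  exact (congrArg (· • (show W from w)) (map_add (inclLeftOp k R A) r s)).trans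
    (add_smul _ _ (show W from w))

lemma leftAct_zero : leftAct k R A 0 = 0 := by
  ext W w
  exact (congrArg (· • (show W from w)) (map_zero (inclLeftOp k R A))).trans
    (zero_smul _ (show W from w))

/-- The action of an element of `R` on the restriction of a complex of `R ⊗ A`-modules to `A`. -/
def leftActCpx (r : Rᵐᵒᵖ) (W : CochainComplex (ModuleCat.{u} (R ⊗[k] A)ᵐᵒᵖ) ℤ) :
    ((resRight k R A).mapHomologicalComplex (ComplexShape.up ℤ)).obj W ⟶
      ((resRight k R A).mapHomologicalComplex (ComplexShape.up ℤ)).obj W :=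
  (NatTrans.mapHomologicalComplex (leftAct k R A r) _).app W

variable {k R A}
variable (P : CochainComplex (ModuleCat.{u} Aᵐᵒᵖ) ℤ)
  (W : CochainComplex (ModuleCat.{u} (R ⊗[k] A)ᵐᵒᵖ) ℤ)

/-- The cochains of degree `n` from `P` to `W`, as a right `R`-module. -/
def ActCochain (n : ℤ) : Type u :=
  Cochain P (((resRight k R A).mapHomologicalComplex (ComplexShape.up ℤ)).obj W) n

instance (n : ℤ) : AddCommGroup (ActCochain P W n) :=
  inferInstanceAs (AddCommGroup (Cochain _ _ _))

instance (n : ℤ) : SMul Rᵐᵒᵖ (ActCochain P W n) where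
  smul r z := Cochain.comp z (Cochain.ofHom (leftActCpx k R A r W)) (add_zero n)

variable {P W} in
lemma ActCochain.smul_v (n : ℤ) (r : Rᵐᵒᵖ) (z : ActCochain P W n) (p q : ℤ) (h : p + n = q) :
    Cochain.v (r • z) p q h = Cochain.v z p q h ≫ (leftAct k R A r).app (W.X q) :=
  (Cochain.comp_zero_cochain_v _ _ _ _ _).trans (congrArg (_ ≫ ·) (Cochain.ofHom_v _ _))

variable {P W} in
lemma ActCochain.ext {n : ℤ} {z z' : ActCochain P W n}
    (h : ∀ p q (hpq : p + n = q), Cochain.v z p q hpq = Cochain.v z' p q hpq) : z = z' :=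
  Cochain.ext _ _ h

variable {P W} in
lemma ActCochain.add_v {n : ℤ} (z z' : ActCochain P W n) (p q : ℤ) (hpq : p + n = q) :
    Cochain.v (z + z') p q hpq = Cochain.v z p q hpq + Cochain.v z' p q hpq := rfl

instance (n : ℤ) : Module Rᵐᵒᵖ (ActCochain P W n) where
  one_smul z := Cochain.ext _ _ fun p q h => by
    rw [ActCochain.smul_v, leftAct_one]; exact Category.comp_id _
  mul_smul r s z := Cochain.ext _ _ fun p q h => by
    rw [ActCochain.smul_v, leftAct_mul, ActCochain.smul_v, ActCochain.smul_v]
    exact (Category.assoc _ _ _).symm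
  smul_zero r := Cochain.ext _ _ fun p q h => by
    rw [ActCochain.smul_v]; exact zero_comp
  smul_add r z z' := Cochain.ext _ _ fun p q h => by
    rw [ActCochain.smul_v]
    exact (Preadditive.add_comp _ _ _ _ _ _).trans (congrArg₂ (· + ·)
      (ActCochain.smul_v _ _ _ _ _ _).symm (ActCochain.smul_v _ _ _ _ _ _).symm)
  add_smul r s z := Cochain.ext _ _ fun p q h => by
    rw [ActCochain.smul_v, leftAct_add]
    exact (Preadditive.comp_add _ _ _ _ _ _).trans (congrArg₂ (· + ·)
      (ActCochain.smul_v _ _ _ _ _ _).symm (ActCochain.smul_v _ _ _ _ _ _).symm)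
  zero_smul z := Cochain.ext _ _ fun p q h => by
    rw [ActCochain.smul_v, leftAct_zero]; exact comp_zero

/-- The complex of right `R`-modules of cochains from `P` to `W`. -/
def actHomComplex : CochainComplex (ModuleCat.{u} Rᵐᵒᵖ) ℤ where
  X n := ModuleCat.of Rᵐᵒᵖ (ActCochain P W n)
  d n m := ModuleCat.ofHom
    { toFun := fun z : ActCochain P W n => (δ n m z : ActCochain P W m)
      map_add' := fun z z' => δ_add _ _ _ _
      map_smul' := fun r z => δ_comp_ofHom z (leftActCpx k R A r W) m }
  shape n m h := by
    ext z
    exact δ_shape _ _ h z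
  d_comp_d' n m l _ _ := by
    ext z
    exact δ_δ _ _ _ z

lemma actHomComplex_exactAt (n : ℤ)
    (h : ∀ z : Cocycle P (((resRight k R A).mapHomologicalComplex (ComplexShape.up ℤ)).obj W) n,
      z ∈ coboundaries _ _ _) : (actHomComplex P W).ExactAt n := by
  rw [HomologicalComplex.exactAt_iff' _ (n - 1) n (n + 1) (by simp) (by simp),
    ShortComplex.moduleCat_exact_iff]
  intro z hz
  obtain ⟨m, hm, y, hy⟩ := h (Cocycle.mk z (n + 1) rfl hz)
  obtain rfl : m = n - 1 := by omega
  exact ⟨y, hy⟩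

/-- A biadditive balanced map gives a morphism from the tensor product. -/
def tensorDesc {M : ModuleCat.{u} Rᵐᵒᵖ} {N : ModuleCat.{u} Aᵐᵒᵖ}
    {Q : ModuleCat.{u} (R ⊗[k] A)ᵐᵒᵖ} (b : M →+ N →+ Q)
    (h₁ : ∀ (r : R) m n, b (MulOpposite.op r • m) n = inclLeftOp k R A (.op r) • b m n)
    (h₂ : ∀ (a : A) m n, b m (MulOpposite.op a • n) = inclRightOp k R A (.op a) • b m n) :
    tensorObj k R A M N ⟶ Q :=
  letI : Module (R ⊗[k] A)ᵐᵒᵖ (M ⊗[k] N) :=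
    Module.compHom _ (tensorAction k R A M N).toRingHom
  have hb (c : k) (m : M) (n : N) : b (c • m) n = b m (c • n) := by
    have h3 : inclLeftOp k R A (.op (algebraMap k R c)) =
        inclRightOp k R A (.op (algebraMap k A c)) :=
      congrArg MulOpposite.op ((Algebra.TensorProduct.includeLeft : R →ₐ[k] R ⊗[k] A).commutes c
        |>.trans ((Algebra.TensorProduct.includeRight : A →ₐ[k] R ⊗[k] A).commutes c).symm)
    exact (h₁ (algebraMap k R c) m n).trans ((congrArg (· • b m n) h3).trans
      (h₂ (algebraMap k A c) m n).symm)
  let φ : M ⊗[k] N →+ Q := TensorProduct.liftAddHom b hb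
  ModuleCat.ofHom (X := M ⊗[k] N) (Y := Q)
    { toFun := φ
      map_add' := φ.map_add
      map_smul' := by
        intro x y
        change φ (tensorAction k R A M N x y) = x • φ y
        obtain ⟨x, rfl⟩ := MulOpposite.op_surjective x
        induction x with
        | zero => simp
        | add x₁ x₂ h₁ h₂ => simp [h₁, h₂, add_smul]
        | tmul r a =>
          induction y with
          | zero => simp
          | add y₁ y₂ h₁ h₂ => simp [h₁, h₂]
          | tmul m n =>
            rw [tensorAction_apply]
            change b (MulOpposite.op r • m) (MulOpposite.op a • n) =
              MulOpposite.op (r ⊗ₜ[k] a) • b m n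
            rw [h₁, h₂, smul_smul, inclLeftOp_mul_inclRightOp] }

/-- The evaluation of cochains. -/
def actEvalX (i j n : ℤ) (h : j + i = n) :
    tensorObj k R A ((actHomComplex P W).X i) (P.X j) ⟶ W.X n :=
  tensorDesc (AddMonoidHom.mk' (fun z : ActCochain P W i =>
      (ModuleCat.Hom.hom (Cochain.v z j n h)).toAddMonoidHom) fun _ _ => rfl)
    (fun r z x => congrArg (fun f => ModuleCat.Hom.hom f x)
      (ActCochain.smul_v i (MulOpposite.op r) (show ActCochain P W i from z) j n h))
    (fun a z x => map_smul (ModuleCat.Hom.hom (Cochain.v (show ActCochain P W i from z) j n h))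
      (MulOpposite.op a) x)

/-- The evaluation of cochains. -/
def actEval : tensorComplex k R A (actHomComplex P W) P ⟶ W :=
  mapBifunctorDescHom (tensorBifunctor k R A) _
    (fun i j n h => actEvalX P W i j n ((add_comm j i).trans h)) (fun i j n h => by
      refine tensorObj_hom_ext k R A fun (z : ActCochain P W i) x => ?_
      -- The cochain differential is $\delta z=z\,d+(-1)^{i+1}d\,z$ in diagrammatic order. Solving
      -- for $z\,d$ gives exactly the sign $(-1)^i$ of the tensor differential.
      have hδ : Cochain.v z j n (by omega) ≫ (((resRight k R A).mapHomologicalComplex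
            (ComplexShape.up ℤ)).obj W).d n (n + 1) =
          Cochain.v (δ i (i + 1) z) j (n + 1) (by omega) +
            i.negOnePow • (P.d j (j + 1) ≫ Cochain.v z (j + 1) (n + 1) (by omega)) := by
        rw [δ_v i (i + 1) rfl z j (n + 1) (by omega) n (j + 1) (by omega) rfl,
          Int.negOnePow_succ, add_assoc, Units.neg_smul, neg_add_cancel, add_zero]
      have hx := congrArg (fun f => ModuleCat.Hom.hom f x) hδ
      rcases Int.even_or_odd i with hi | hi
      · rw [Int.negOnePow_even i hi, one_smul] at hx ⊢
        exact hx
      · rw [Int.negOnePow_odd i hi, Units.neg_smul, one_smul] at hx ⊢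
        exact hx)

variable {P W}

/-- The chain map `x ↦ g (m ⊗ x)`. -/
def curryMap {M : ModuleCat.{u} Rᵐᵒᵖ}
    (g : (((tensorBifunctor k R A).obj M).mapHomologicalComplex (ComplexShape.up ℤ)).obj P ⟶ W)
    (m : M) : P ⟶ ((resRight k R A).mapHomologicalComplex (ComplexShape.up ℤ)).obj W where
  f p := ModuleCat.ofHom (Y := (resRight k R A).obj (W.X p))
    { toFun := fun x => (g.f p).hom (show tensorObj k R A M (P.X p) from m ⊗ₜ[k] x)
      map_add' := fun x y => (congrArg (g.f p).hom (TensorProduct.tmul_add m x y)).trans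
        (map_add (g.f p).hom _ _)
      map_smul' := fun a x => by
        refine Eq.trans ?_ (map_smul (g.f p).hom (inclRightOp k R A a)
          (show tensorObj k R A M (P.X p) from m ⊗ₜ[k] x))
        refine congrArg (g.f p).hom ?_
        refine Eq.trans ?_ (tensorAction_apply k R A M (P.X p) 1 a.unop m x).symm
        exact congrArg (fun y => y ⊗ₜ[k] (a • x)) (one_smul Rᵐᵒᵖ m).symm }
  comm' p q h := by
    ext x
    exact congrArg (fun f => ModuleCat.Hom.hom f
      (show tensorObj k R A M (P.X p) from m ⊗ₜ[k] x)) (g.comm p q)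

/-- The map `m ↦ (x ↦ g (m ⊗ x))`. -/
def curryHom {M : ModuleCat.{u} Rᵐᵒᵖ}
    (g : (((tensorBifunctor k R A).obj M).mapHomologicalComplex (ComplexShape.up ℤ)).obj P ⟶ W) :
    M ⟶ (actHomComplex P W).X 0 :=
  ModuleCat.ofHom (X := M) (Y := ActCochain P W 0)
    { toFun := fun m => (Cochain.ofHom (curryMap g m) : ActCochain P W 0)
      map_add' := fun m m' => Cochain.ext₀ _ _ fun p => by
        rw [Cochain.ofHom_v]
        refine Eq.trans ?_ (congrArg₂ (· + ·) (Cochain.ofHom_v (curryMap g m) p).symm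
          (Cochain.ofHom_v (curryMap g m') p).symm)
        ext x
        exact (congrArg (g.f p).hom (TensorProduct.add_tmul m m' x)).trans
          (map_add (g.f p).hom _ _)
      map_smul' := fun r m => Cochain.ext₀ _ _ fun p => by
        refine (Cochain.ofHom_v _ _).trans (Eq.trans ?_ (ActCochain.smul_v 0 r _ p p _).symm)
        refine Eq.trans ?_ (congrArg (· ≫ (leftAct k R A r).app (W.X p))
          (Cochain.ofHom_v (curryMap g m) p).symm)
        ext x
        refine Eq.trans ?_ (map_smul (g.f p).hom (inclLeftOp k R A r)
          (show tensorObj k R A M (P.X p) from m ⊗ₜ[k] x))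
        refine congrArg (g.f p).hom ?_
        refine Eq.trans ?_ (tensorAction_apply k R A M (P.X p) r.unop 1 m x).symm
        exact congrArg (fun y => (r • m) ⊗ₜ[k] y) (one_smul Aᵐᵒᵖ x).symm }

lemma curryHom_comp_d {M : ModuleCat.{u} Rᵐᵒᵖ}
    (g : (((tensorBifunctor k R A).obj M).mapHomologicalComplex (ComplexShape.up ℤ)).obj P ⟶ W) :
    curryHom g ≫ (actHomComplex P W).d 0 1 = 0 := by
  ext m
  exact δ_ofHom (p := 1) (curryMap g m)

/-- This is the half of the tensor-Hom adjunction that is used: evaluation recovers a map from its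
curried form. -/
lemma insertLeft_curryHom_comp_actEval {M : ModuleCat.{u} Rᵐᵒᵖ}
    (g : (((tensorBifunctor k R A).obj M).mapHomologicalComplex (ComplexShape.up ℤ)).obj P ⟶ W) :
    insertLeft (tensorBifunctor k R A) _ (curryHom g) (curryHom_comp_d g) ≫ actEval P W = g := by
  ext n : 1
  refine (Category.assoc _ _ _).trans ((congrArg (_ ≫ ·) (ι_mapBifunctorDescHom_f
    (tensorBifunctor k R A) _ _ _ 0 n n (zero_add n))).trans ?_)
  refine tensorObj_hom_ext k R A fun m x => ?_
  exact congrArg (fun f => ModuleCat.Hom.hom f x) (Cochain.ofHom_v (curryMap g m) n)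

/-- A map from `M` into the degree zero cocycles is a chain map from `M` in degree `0`, to which the
functor $\tau_{\le 0}$ applies. -/
lemma exists_lift_truncLE {S : Type u} [Ring S] {E : CochainComplex (ModuleCat.{u} S) ℤ}
    {M : ModuleCat.{u} S} (ψ : M ⟶ E.X 0) (hψ : ψ ≫ E.d 0 1 = 0) :
    ∃ φ : M ⟶ (E.truncLE 0).X 0, φ ≫ (E.truncLE 0).d 0 1 = 0 ∧ φ ≫ (E.ιTruncLE 0).f 0 = ψ := by
  let K : CochainComplex (ModuleCat.{u} S) ℤ := (HomologicalComplex.single _ _ 0).obj M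
  have hK : K.IsStrictlyLE 0 := by
    rw [CochainComplex.isStrictlyLE_iff]
    exact fun n hn => HomologicalComplex.isZero_single_obj_X _ _ _ _ (by omega)
  let χ : K ⟶ E := HomologicalComplex.mkHomFromSingle ψ (fun i hi => by
    obtain rfl : i = 1 := by simp at hi; omega
    exact hψ)
  refine ⟨(HomologicalComplex.singleObjXSelf (ComplexShape.up ℤ) 0 M).inv ≫
    (inv (K.ιTruncLE 0) ≫ CochainComplex.truncLEMap χ 0).f 0,
    (CochainComplex.isZero_of_isStrictlyLE _ 0 1 (by omega)).eq_of_tgt _ _, ?_⟩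
  rw [Category.assoc, ← HomologicalComplex.comp_f, Category.assoc,
    CochainComplex.ιTruncLE_naturality, IsIso.inv_hom_id_assoc]
  simp [χ, HomologicalComplex.mkHomFromSingle_f]

/-- Morphisms from `M ⊗ P` to `W` in the derived category vanish when the complex of cochains from
`P` to `W` is exact in nonpositive degrees. -/
lemma map_eq_zero_of_actHomComplex_exactAt {M : ModuleCat.{u} Rᵐᵒᵖ} [Module.Finite Rᵐᵒᵖ M]
    [IsExactFG ((tensorBifunctor k R A).obj M)]
    (hP : IsBoundedFG A P) (hW : IsBoundedFG (R ⊗[k] A) W)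
    (hE : IsBoundedFG R (actHomComplex P W)) (h : ∀ n, n ≤ 0 → (actHomComplex P W).ExactAt n)
    (g : mapCpx ((tensorBifunctor k R A).obj M) P ⟶ W) :
    DbMod.map (isBoundedFG_mapCpx _ hP) hW g = 0 := by
  let E := actHomComplex P W
  have hB := DbMod.isBoundedFG_truncLE hE 0 (h 0 le_rfl)
  have : E.IsGE 1 := by
    rw [CochainComplex.isGE_iff]
    exact fun n hn => h n (by omega)
  have hac : (E.truncLE 0).Acyclic := (CochainComplex.acyclic_truncLE_iff _ 0 1).2 this
  obtain ⟨φ, hφ, hφ'⟩ := exists_lift_truncLE (curryHom g) (curryHom_comp_d g)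
  have hφd : (φ ≫ (E.ιTruncLE 0).f 0) ≫ E.d 0 1 = 0 := by rw [hφ']; exact curryHom_comp_d g
  have h2 : insertLeft (tensorBifunctor k R A) (L := P) E _ hφd =
      insertLeft (tensorBifunctor k R A) (L := P) E (curryHom g) (curryHom_comp_d g) := by
    congr 1
  -- The adjunction factors `g` through $E\otimes P$, and the lift `φ` moves the factorization to
  -- $\tau_{\le 0}E\otimes P$, which is acyclic.
  obtain ⟨u, v, h1⟩ : ∃ (u : mapCpx ((tensorBifunctor k R A).obj M) P ⟶
      tensorComplex k R A (E.truncLE 0) P) (v : tensorComplex k R A (E.truncLE 0) P ⟶ W),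
      u ≫ v = g :=
    ⟨insertLeft (tensorBifunctor k R A) _ φ hφ,
      HomologicalComplex.mapBifunctorMap (E.ιTruncLE 0) (𝟙 P) (tensorBifunctor k R A) _ ≫
        actEval P W, (Category.assoc _ _ _).symm.trans ((congrArg (· ≫ actEval P W)
          ((insertLeft_comp_mapBifunctorMap _ _ _ _ hφd).trans h2)).trans
            (insertLeft_curryHom_comp_actEval g))⟩
  have hBP := isBoundedFG_tensorComplex k R A hB hP
  rw [← h1, DbMod.map_comp _ hBP,
    (DbMod.isZero_of_acyclic hBP (acyclic_tensorComplex hac hP)).eq_of_tgt (DbMod.map _ hBP u) 0,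
    zero_comp]

end

end

/-! ### Finite generation of $\operatorname{Hom}_A(P,W)$ over $R$. -/

noncomputable section

open scoped ModuleCat
open CochainComplex CochainComplex.HomComplex

section

variable {k : Type u} [Field k] {R : Type u} [Ring R] [Algebra k R]
  {A : Type u} [Ring A] [Algebra k A]

/-- Products of module generators with a finite spanning set of `A` over `k` generate over `R`,
since scalars of `k` can be moved from `A` to `R`. -/
lemma finite_resLeft [Module.Finite k A] (W : ModuleCat.{u} (R ⊗[k] A)ᵐᵒᵖ)
    (hW : Module.Finite (R ⊗[k] A)ᵐᵒᵖ W) :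
    Module.Finite Rᵐᵒᵖ ((ModuleCat.restrictScalars (inclLeftOp k R A)).obj W) := by
  obtain ⟨t, ht⟩ := ‹Module.Finite k A›.fg_top
  obtain ⟨s, hs⟩ := hW.fg_top
  let X := (ModuleCat.restrictScalars (inclLeftOp k R A)).obj W
  let G : Set X := Set.image2 (fun a (w : W) => (inclRightOp k R A (.op a) • w : W)) (t : Set A) s
  let N := Submodule.span Rᵐᵒᵖ G
  have h1 (a : A) (w : W) (hw : w ∈ s) : (inclRightOp k R A (.op a) • w : W) ∈ N := by
    have ha : a ∈ Submodule.span k (t : Set A) := ht ▸ Submodule.mem_top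
    induction ha using Submodule.span_induction with
    | mem a ha => exact Submodule.subset_span ⟨a, ha, w, hw, rfl⟩
    | zero =>
      rw [MulOpposite.op_zero, map_zero, zero_smul]
      exact N.zero_mem
    | add a b _ _ ha hb =>
      rw [MulOpposite.op_add, map_add, add_smul]
      exact N.add_mem ha hb
    | smul c a _ ha =>
      have : inclRightOp k R A (.op (c • a)) =
          inclLeftOp k R A (.op (algebraMap k R c)) * inclRightOp k R A (.op a) := by
        rw [inclLeftOp_mul_inclRightOp]
        refine congrArg MulOpposite.op ?_
        change (1 : R) ⊗ₜ[k] (c • a) = _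
        rw [Algebra.algebraMap_eq_smul_one, TensorProduct.smul_tmul]
      rw [this, mul_smul]
      exact N.smul_mem _ ha
  have h2 (x : R ⊗[k] A) (w : W) (hw : w ∈ s) : (MulOpposite.op x • w : W) ∈ N := by
    induction x with
    | zero =>
      rw [MulOpposite.op_zero, zero_smul]
      exact N.zero_mem
    | add x y hx hy =>
      rw [MulOpposite.op_add, add_smul]
      exact N.add_mem hx hy
    | tmul r a =>
      rw [← inclLeftOp_mul_inclRightOp, mul_smul]
      exact N.smul_mem (MulOpposite.op r) (h1 a w hw)
  have hG : G.Finite := Set.Finite.image2 _ t.finite_toSet s.finite_toSet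
  refine ⟨⟨hG.toFinset, ?_⟩⟩
  rw [Set.Finite.coe_toFinset]
  refine eq_top_iff.2 fun (w : W) _ => ?_
  have hw : w ∈ Submodule.span _ (s : Set W) := hs ▸ Submodule.mem_top
  obtain ⟨f, -, hf⟩ := Submodule.mem_span_finset.1 hw
  rw [← hf]
  exact N.sum_mem fun w hw => h2 (f w).unop w hw

/-- The morphism `x ↦ ∑ j, w j * c j x`. -/
def homOfFamily {Q : ModuleCat.{u} Aᵐᵒᵖ} {m : ℕ} (c : Fin m → (Q →ₗ[Aᵐᵒᵖ] Aᵐᵒᵖ))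
    {W : ModuleCat.{u} (R ⊗[k] A)ᵐᵒᵖ} (w : Fin m → W) :
    Q ⟶ (resRight k R A).obj W :=
  ModuleCat.ofHom (Y := (resRight k R A).obj W)
    { toFun := fun x => (∑ j, (inclRightOp k R A (c j x)) • w j : W)
      map_add' := fun x y => by
        simp only [map_add, add_smul, Finset.sum_add_distrib]
        rfl
      map_smul' := fun a x => by
        refine Eq.trans ?_ (Finset.smul_sum (r := inclRightOp k R A a)).symm
        simp only [map_smul, smul_eq_mul, map_mul, mul_smul]
        rfl }

lemma homOfFamily_apply {Q : ModuleCat.{u} Aᵐᵒᵖ} {m : ℕ} (c : Fin m → (Q →ₗ[Aᵐᵒᵖ] Aᵐᵒᵖ))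
    {W : ModuleCat.{u} (R ⊗[k] A)ᵐᵒᵖ} (w : Fin m → W) (x : Q) :
    (homOfFamily c w).hom x = (∑ j, (inclRightOp k R A (c j x)) • w j : W) := rfl

lemma homOfFamily_add {Q : ModuleCat.{u} Aᵐᵒᵖ} {m : ℕ} (c : Fin m → (Q →ₗ[Aᵐᵒᵖ] Aᵐᵒᵖ))
    {W : ModuleCat.{u} (R ⊗[k] A)ᵐᵒᵖ} (w w' : Fin m → W) :
    homOfFamily c (w + w') = homOfFamily c w + homOfFamily c w' := by
  ext x
  refine (homOfFamily_apply c _ x).trans ?_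
  simp only [Pi.add_apply, smul_add, Finset.sum_add_distrib]
  rfl

lemma homOfFamily_smul {Q : ModuleCat.{u} Aᵐᵒᵖ} {m : ℕ} (c : Fin m → (Q →ₗ[Aᵐᵒᵖ] Aᵐᵒᵖ))
    {W : ModuleCat.{u} (R ⊗[k] A)ᵐᵒᵖ} (r : Rᵐᵒᵖ) (w : Fin m → W) :
    homOfFamily c (fun j => inclLeftOp k R A r • w j) =
      homOfFamily c w ≫ (leftAct k R A r).app W := by
  ext x
  refine (homOfFamily_apply c _ x).trans ?_
  have h : inclLeftOp k R A r • (∑ j, (inclRightOp k R A (c j x)) • w j : W) =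
      ∑ j, inclRightOp k R A (c j x) • inclLeftOp k R A r • w j := by
    rw [Finset.smul_sum]
    refine Finset.sum_congr rfl fun j _ => ?_
    rw [smul_smul, smul_smul]
    exact congrArg (· • _) ((inclLeftOp_mul_inclRightOp k R A r.unop (c j x).unop).trans
      (inclRightOp_mul_inclLeftOp k R A r.unop (c j x).unop).symm)
  exact h.symm

lemma exists_dual_basis (Q : ModuleCat.{u} Aᵐᵒᵖ) [Module.Finite Aᵐᵒᵖ Q] [Projective Q] :
    ∃ (m : ℕ) (x : Fin m → Q) (c : Fin m → (Q →ₗ[Aᵐᵒᵖ] Aᵐᵒᵖ)), ∀ y, ∑ j, c j y • x j = y := by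
  have : Module.Projective Aᵐᵒᵖ Q := (IsProjective.iff_projective Q).2 inferInstance
  obtain ⟨m, f, hf⟩ := Module.Finite.exists_fin' Aᵐᵒᵖ Q
  obtain ⟨s, hs⟩ := Module.projective_lifting_property f LinearMap.id hf
  refine ⟨m, fun j => f (Pi.single j 1), fun j => (LinearMap.proj j).comp s, fun y => ?_⟩
  refine Eq.trans ?_ (LinearMap.congr_fun hs y)
  rw [LinearMap.comp_apply]
  conv_rhs => rw [pi_eq_sum_univ' (s y)]
  simp

variable {P : CochainComplex (ModuleCat.{u} Aᵐᵒᵖ) ℤ}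
  {W : CochainComplex (ModuleCat.{u} (R ⊗[k] A)ᵐᵒᵖ) ℤ}

/-- Dual bases of the projectives $P^p$ present the cochains of each degree as a quotient of a
finite product of copies of terms of `W`, each finitely generated over `R`. -/
lemma isBoundedFG_actHomComplex [Module.Finite k A] (hP : IsBoundedFG A P)
    (hP' : ∀ n, Projective (P.X n)) (hW : IsBoundedFG (R ⊗[k] A) W) :
    IsBoundedFG R (actHomComplex P W) := by
  obtain ⟨h₁, a, b, h₂⟩ := hP
  obtain ⟨h₁', a', b', h₂'⟩ := hW
  refine ⟨fun n => ?_, a' - b, b' - a, fun n hn => ?_⟩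
  · choose m x c hc using fun n => exists_dual_basis (P.X n)
    let s := Finset.Icc a b
    -- The target degree is determined by the source degree, so only finitely many triplets meet the
    -- support of `P`.
    let I := {T : Triplet n // T.p ∈ s}
    have : Finite I := by
      refine Finite.of_injective (fun T : I => (⟨T.1.p, T.2⟩ : s)) ?_
      rintro ⟨⟨p, q, h⟩, hT⟩ ⟨⟨p', q', h'⟩, hT'⟩ hpp
      obtain rfl : p = p' := congrArg Subtype.val hpp
      obtain rfl : q = q' := h.symm.trans h'
      rfl
    let D := ∀ T : I, Fin (m T.1.p) → (ModuleCat.restrictScalars (inclLeftOp k R A)).obj (W.X T.1.q)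
    have (q : ℤ) := finite_resLeft (W.X q) (h₁' q)
    let fam (w : D) (T : Triplet n) : P.X T.p ⟶ (resRight k R A).obj (W.X T.q) :=
      if h : T.p ∈ s then homOfFamily (W := W.X T.q) (c T.p) (w ⟨T, h⟩) else 0
    have fam_pos (w : D) (T : Triplet n) (h : T.p ∈ s) :
      fam w T = homOfFamily (W := W.X T.q) (c T.p) (w ⟨T, h⟩) := dif_pos h
    have fam_neg (w : D) (T : Triplet n) (h : T.p ∉ s) : fam w T = 0 := dif_neg h
    let Φ : D →ₗ[Rᵐᵒᵖ] ActCochain P W n :=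
      { toFun := fun w => (fam w : ActCochain P W n)
        map_add' := fun w w' => by
          refine ActCochain.ext fun p q hpq => ?_
          refine Eq.trans ?_ (ActCochain.add_v _ _ p q hpq).symm
          by_cases h : p ∈ s
          · exact (fam_pos (w + w') ⟨p, q, hpq⟩ h).trans ((homOfFamily_add _ _ _).trans
              (congrArg₂ (· + ·) (fam_pos w ⟨p, q, hpq⟩ h) (fam_pos w' ⟨p, q, hpq⟩ h)).symm)
          · exact (fam_neg (w + w') ⟨p, q, hpq⟩ h).trans ((add_zero _).symm.trans
              (congrArg₂ (· + ·) (fam_neg w ⟨p, q, hpq⟩ h) (fam_neg w' ⟨p, q, hpq⟩ h)).symm)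
        map_smul' := fun r w => by
          refine ActCochain.ext fun p q hpq => ?_
          refine Eq.trans ?_ (ActCochain.smul_v n r _ p q hpq).symm
          by_cases h : p ∈ s
          · exact (fam_pos (r • w) ⟨p, q, hpq⟩ h).trans
              ((homOfFamily_smul (c p) r (w ⟨⟨p, q, hpq⟩, h⟩)).trans
              (congrArg (· ≫ _) (fam_pos w ⟨p, q, hpq⟩ h).symm))
          · exact (fam_neg (r • w) ⟨p, q, hpq⟩ h).trans (zero_comp.symm.trans
              (congrArg (· ≫ _) (fam_neg w ⟨p, q, hpq⟩ h).symm)) }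
    refine Module.Finite.of_surjective Φ fun z => ?_
    let w : D := fun T j => (ModuleCat.Hom.hom (Cochain.v z T.1.p T.1.q T.1.hpq)) (x T.1.p j)
    refine ⟨w, ActCochain.ext fun p q hpq => ?_⟩
    by_cases h : p ∈ s
    · refine (fam_pos w ⟨p, q, hpq⟩ h).trans ?_
      ext y
      have h3 := congrArg (ModuleCat.Hom.hom (Cochain.v z p q hpq)) (hc p y)
      rw [map_sum] at h3
      refine (homOfFamily_apply _ _ y).trans (Eq.trans (Finset.sum_congr rfl fun j _ => ?_) h3)
      exact (map_smul (ModuleCat.Hom.hom (Cochain.v z p q hpq)) (c p j y) (x p j)).symm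
    · exact (h₂ p (by simp only [s, Finset.mem_Icc] at h; omega)).eq_of_src _ _
  · have : Subsingleton (ActCochain P W n) := by
      refine ⟨fun z z' => Cochain.ext _ _ fun p q hpq => ?_⟩
      by_cases hp : p < a ∨ b < p
      · exact (h₂ p hp).eq_of_src _ _
      · exact ((resRight k R A).map_isZero (h₂' q (by omega))).eq_of_tgt _ _
    exact ModuleCat.isZero_of_subsingleton (ModuleCat.of Rᵐᵒᵖ (ActCochain P W n))

end

end

/-! ### Cocycles from a projective complex to $M\otimes Y$. -/

noncomputable section

open scoped ModuleCat
open CochainComplex CochainComplex.HomComplex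

section

variable {C : Type*} [Category C] [Abelian C]

/-- Morphisms from a K-projective complex in the homotopy category are unchanged by composition
with a quasi-isomorphism. -/
lemma quotient_map_comp_bijective_of_quasiIso (P : CochainComplex C ℤ) [P.IsKProjective]
    {Y W : CochainComplex C ℤ} (s : Y ⟶ W) [hs : QuasiIso s] :
    Function.Bijective (fun φ : (HomotopyCategory.quotient C (ComplexShape.up ℤ)).obj P ⟶
      (HomotopyCategory.quotient C (ComplexShape.up ℤ)).obj Y =>
        φ ≫ (HomotopyCategory.quotient C (ComplexShape.up ℤ)).map s) := by
  have hs' : (HomotopyCategory.subcategoryAcyclic C).trW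
      ((HomotopyCategory.quotient _ _).map s) := by
    rwa [← HomotopyCategory.quasiIso_eq_trW_subcategoryAcyclic,
      HomotopyCategory.quotient_map_mem_quasiIso_iff, HomologicalComplex.mem_quasiIso_iff]
  have hP := IsKProjective.leftOrthogonal P
  rw [← ObjectProperty.isColocal_trW] at hP
  exact hP _ hs'

/-- Cohomology classes in degree `n` are homotopy classes of maps into the `n`-th shift, and a
quasi-isomorphism of targets induces a bijection on these when `P` is K-projective. -/
lemma mem_coboundaries_of_quasiIso (P : CochainComplex C ℤ) [P.IsKProjective]
    {Y W : CochainComplex C ℤ} (s : Y ⟶ W) [QuasiIso s] (n : ℤ)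
    (h : ∀ z : Cocycle P Y n, z ∈ coboundaries _ _ _) (z : Cocycle P W n) :
    z ∈ coboundaries _ _ _ := by
  rw [← CohomologyClass.toHom_mk_eq_zero_iff]
  have : QuasiIso (s⟦n⟧') := inferInstance
  obtain ⟨φ, hφ⟩ := (quotient_map_comp_bijective_of_quasiIso P (s⟦n⟧')).2
    (CohomologyClass.toHom (CohomologyClass.mk z))
  obtain ⟨x, rfl⟩ := (CohomologyClass.toHom_bijective P Y n).2 φ
  obtain ⟨x, rfl⟩ := x.mk_surjective
  rw [← hφ, (CohomologyClass.toHom_mk_eq_zero_iff x).2 (h x)]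
  exact zero_comp

lemma CochainComplex.HomComplex.Cocycle.sum_v {C : Type*} [Category C] [Preadditive C]
    {P Y : CochainComplex C ℤ} {n : ℤ} {ι : Type*} (s : Finset ι) (z : ι → Cocycle P Y n)
    (p q : ℤ) (hpq : p + n = q) :
    Cochain.v (∑ i ∈ s, z i : Cocycle P Y n).1 p q hpq = ∑ i ∈ s, Cochain.v (z i).1 p q hpq :=
  map_sum (AddMonoidHom.mk' (fun x : Cocycle P Y n => Cochain.v x.1 p q hpq) fun _ _ => rfl) z s

lemma CochainComplex.HomComplex.Cocycle.postcomp_postcomp_v {C : Type*} [Category C]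
    [Preadditive C] {P Y Y' Y'' : CochainComplex C ℤ} {n : ℤ} (z : Cocycle P Y n) (f : Y ⟶ Y')
    (g : Y' ⟶ Y'') (p q : ℤ) (hpq : p + n = q) :
    Cochain.v ((z.postcomp f).postcomp g).1 p q hpq =
      Cochain.v z.1 p q hpq ≫ f.f q ≫ g.f q := by
  simp [Cocycle.postcomp]

lemma postcomp_mem_coboundaries {C : Type*} [Category C] [Preadditive C]
    {P Y W : CochainComplex C ℤ} (s : Y ⟶ W) {n : ℤ}
    {z : Cocycle P Y n} (h : z ∈ coboundaries _ _ _) : z.postcomp s ∈ coboundaries _ _ _ := by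
  obtain ⟨m, hm, y, hy⟩ := h
  exact ⟨m, hm, y.comp (Cochain.ofHom s) (add_zero m), (δ_comp_ofHom y s n).trans
    (congrArg (fun z => Cochain.comp z (Cochain.ofHom s) (add_zero n)) hy)⟩

end

section

variable {k : Type u} [Field k] {R : Type u} [Ring R] [Algebra k R]
  {A : Type u} [Ring A] [Algebra k A]

/-- The map `m ⊗ n ↦ φ m • n`. -/
def contract {M : ModuleCat.{u} Rᵐᵒᵖ} (φ : M →ₗ[k] k) (N : ModuleCat.{u} Aᵐᵒᵖ) :
    (resRight k R A).obj (tensorObj k R A M N) ⟶ N :=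
  let ψ : M ⊗[k] N →ₗ[k] N := (TensorProduct.lid k N).toLinearMap ∘ₗ (φ.rTensor N)
  ModuleCat.ofHom (X := (resRight k R A).obj (tensorObj k R A M N))
    { toFun := fun t => ψ t
      map_add' := fun t t' => map_add ψ t t'
      map_smul' := fun a t => by
        change ψ (tensorAction k R A M N (MulOpposite.op (1 ⊗ₜ[k] a.unop)) t) = a • ψ t
        change M ⊗[k] N at t
        induction t with
        | zero => simp
        | add x y hx hy => rw [map_add, map_add, hx, hy, map_add, smul_add]
        | tmul m n =>
          rw [tensorAction_apply]
          have h : φ (MulOpposite.op (1 : R) • m) = φ m := congrArg φ (one_smul Rᵐᵒᵖ m)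
          change φ (MulOpposite.op (1 : R) • m) • (a • n) = a • (φ m • n)
          rw [h]
          exact smul_comm _ _ _ }

lemma contract_naturality {M : ModuleCat.{u} Rᵐᵒᵖ} (φ : M →ₗ[k] k) {N N' : ModuleCat.{u} Aᵐᵒᵖ}
    (g : N ⟶ N') : (resRight k R A).map (tensorMap k R A (𝟙 M) g) ≫ contract φ N' =
      contract φ N ≫ g := by
  ext t
  change M ⊗[k] N at t
  induction t with
  | zero => exact (map_zero (ModuleCat.Hom.hom ((resRight k R A).map (tensorMap k R A (𝟙 M) g) ≫
      contract φ N'))).trans (map_zero (ModuleCat.Hom.hom (contract φ N ≫ g))).symm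
  | add x y hx hy => exact (map_add (ModuleCat.Hom.hom ((resRight k R A).map
      (tensorMap k R A (𝟙 M) g) ≫ contract φ N')) _ _).trans ((congrArg₂ _ hx hy).trans
        (map_add (ModuleCat.Hom.hom (contract φ N ≫ g)) _ _).symm)
  | tmul m n => exact (map_smul (g.hom.restrictScalars k) (φ m) n).symm

/-- The map `n ↦ m ⊗ n`. -/
def insertElt {M : ModuleCat.{u} Rᵐᵒᵖ} (m : M) (N : ModuleCat.{u} Aᵐᵒᵖ) :
    N ⟶ (resRight k R A).obj (tensorObj k R A M N) :=
  ModuleCat.ofHom (Y := (resRight k R A).obj (tensorObj k R A M N))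
    { toFun := fun n => (show tensorObj k R A M N from m ⊗ₜ[k] n)
      map_add' := fun n n' => TensorProduct.tmul_add m n n'
      map_smul' := fun a n => by
        refine Eq.trans ?_ (tensorAction_apply k R A M N 1 a.unop m n).symm
        exact congrArg (fun y => y ⊗ₜ[k] (a • n)) (one_smul Rᵐᵒᵖ m).symm }

variable {P Y : CochainComplex (ModuleCat.{u} Aᵐᵒᵖ) ℤ}

/-- The chain map `m ⊗ n ↦ φ m • n`. -/
def contractCpx {M : ModuleCat.{u} Rᵐᵒᵖ} (φ : M →ₗ[k] k) (Y : CochainComplex (ModuleCat.{u} Aᵐᵒᵖ) ℤ) :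
    ((resRight k R A).mapHomologicalComplex (ComplexShape.up ℤ)).obj
      ((((tensorBifunctor k R A).obj M).mapHomologicalComplex (ComplexShape.up ℤ)).obj Y) ⟶ Y where
  f n := contract φ (Y.X n)
  comm' i j _ := (contract_naturality φ (Y.d i j)).symm

/-- The chain map `n ↦ m ⊗ n`. -/
def insertEltCpx {M : ModuleCat.{u} Rᵐᵒᵖ} (m : M) (Y : CochainComplex (ModuleCat.{u} Aᵐᵒᵖ) ℤ) :
    Y ⟶ ((resRight k R A).mapHomologicalComplex (ComplexShape.up ℤ)).obj
      ((((tensorBifunctor k R A).obj M).mapHomologicalComplex (ComplexShape.up ℤ)).obj Y) where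
  f n := insertElt m (Y.X n)
  comm' _ _ _ := rfl

/-- A finitely generated source meets only finitely many of the summands $b_\beta\otimes N$ of
$M\otimes N$. Any larger finite set also works, so that one set can serve several degrees. -/
lemma exists_contract_insertElt {M : ModuleCat.{u} Rᵐᵒᵖ} {ι : Type*} (b : Module.Basis ι k M)
    {Q N : ModuleCat.{u} Aᵐᵒᵖ} [Module.Finite Aᵐᵒᵖ Q]
    (f : Q ⟶ (resRight k R A).obj (tensorObj k R A M N)) :
    ∃ s : Finset ι, ∀ s', s ⊆ s' →
      f = ∑ β ∈ s', f ≫ contract (b.coord β) N ≫ insertElt (b β) N := by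
  classical
  let e : M ⊗[k] N ≃ₗ[k] ι →₀ N := TensorProduct.equivFinsuppOfBasisLeft b
  have he (t : M ⊗[k] N) (β : ι) : e t β = (contract (b.coord β) N).hom t :=
    TensorProduct.equivFinsuppOfBasisLeft_apply b t β
  obtain ⟨G, hG⟩ := ‹Module.Finite Aᵐᵒᵖ Q›.fg_top
  refine ⟨G.biUnion fun x => (e (f.hom x)).support, fun s' hs' => ?_⟩
  have h0 (β : ι) (hβ : β ∉ s') : f ≫ contract (b.coord β) N = 0 := by
    refine ModuleCat.hom_ext (LinearMap.ext_on_range (v := ((↑) : G → Q)) ?_ fun x => ?_)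
    · rw [Subtype.range_coe]; exact hG
    · refine (he (f.hom x) β).symm.trans (Finsupp.notMem_support_iff.1 fun h => hβ (hs' ?_))
      exact Finset.mem_biUnion.2 ⟨x, x.2, h⟩
  ext x
  have h1 : (f.hom x : M ⊗[k] N) = ∑ β ∈ s', (b β) ⊗ₜ[k] (e (f.hom x) β) := by
    conv_lhs => rw [← e.symm_apply_apply (f.hom x)]
    refine (TensorProduct.equivFinsuppOfBasisLeft_symm_apply b _).trans ?_
    refine Finset.sum_subset (fun β hβ => ?_) fun β _ hβ => ?_
    · by_contra h
      refine Finsupp.mem_support_iff.1 hβ ((he _ _).trans ?_)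
      exact congrArg (fun g => ModuleCat.Hom.hom g x) (h0 β h)
    · exact (congrArg (fun n => b β ⊗ₜ[k] n) (Finsupp.notMem_support_iff.1 hβ)).trans
        (TensorProduct.tmul_zero _ _)
  refine h1.trans ?_
  rw [ModuleCat.hom_sum, LinearMap.sum_apply]
  refine Finset.sum_congr rfl fun β _ => ?_
  exact congrArg (fun n => b β ⊗ₜ[k] n) (he (f.hom x) β)

/-- This stands in for $\operatorname{Hom}_A(P,M\otimes Y)\cong M\otimes\operatorname{Hom}_A(P,Y)$:
a cocycle is a finite sum of cocycles that factor through `Y`, one for each basis vector involved.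
-/
lemma mem_coboundaries_tensor (M : ModuleCat.{u} Rᵐᵒᵖ) (hP : IsBoundedFG A P) (n : ℤ)
    (h : ∀ z : Cocycle P Y n, z ∈ coboundaries _ _ _)
    (z : Cocycle P (((resRight k R A).mapHomologicalComplex (ComplexShape.up ℤ)).obj
      ((((tensorBifunctor k R A).obj M).mapHomologicalComplex (ComplexShape.up ℤ)).obj Y)) n) :
    z ∈ coboundaries _ _ _ := by
  classical
  obtain ⟨h₁, a, b, h₂⟩ := hP
  let e := Module.Basis.ofVectorSpace k M
  choose s hs using fun p => exists_contract_insertElt (R := R) (A := A) (M := M) e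
    (N := Y.X (p + n)) (Cochain.v z.1 p (p + n) rfl)
  let S := (Finset.Icc a b).biUnion s
  have hz : z = ∑ β ∈ S, (z.postcomp (contractCpx (e.coord β) Y)).postcomp (insertEltCpx (e β) Y) := by
    apply Cocycle.ext
    refine Cochain.ext _ _ fun p q hpq => ?_
    subst hpq
    by_cases hp : p ∈ Finset.Icc a b
    · refine (hs p S (Finset.subset_biUnion_of_mem s hp)).trans ?_
      refine Eq.trans ?_ (Cocycle.sum_v S (fun β => (z.postcomp (contractCpx (e.coord β) Y)).postcomp
        (insertEltCpx (e β) Y)) p (p + n) rfl).symm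
      refine Finset.sum_congr rfl fun β _ => ?_
      exact (Cocycle.postcomp_postcomp_v z (contractCpx (e.coord β) Y) (insertEltCpx (e β) Y) p _
        rfl).symm
    · exact (h₂ p (by simp only [Finset.mem_Icc] at hp; omega)).eq_of_src _ _
  rw [hz]
  exact AddSubgroup.sum_mem _ fun β _ => postcomp_mem_coboundaries _ (h _)

end

end

/-! ### Perfect complexes and approximation by them. -/

noncomputable section

open scoped ModuleCat

section

variable {S : Type u} [Ring S]

/-- The objects of `D^b(mod S)` given by bounded complexes of projective modules. -/
def DbMod.isPerfect : ObjectProperty (DbMod S) := fun X =>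
  ∃ (P : CochainComplex (ModuleCat.{u} Sᵐᵒᵖ) ℤ) (hP : IsBoundedFG S P),
    (∀ n, Projective (P.X n)) ∧ Nonempty (X ≅ DbMod.of P hP)

/-- The objects of `D^b(mod S)` given by bounded complexes that vanish in degrees above `b`. -/
def DbMod.isLE (b : ℤ) : ObjectProperty (DbMod S) := fun X =>
  ∃ (K : CochainComplex (ModuleCat.{u} Sᵐᵒᵖ) ℤ) (hK : IsBoundedFG S K),
    (∀ n, b < n → IsZero (K.X n)) ∧ Nonempty (X ≅ DbMod.of K hK)

namespace DbMod

variable {P K : CochainComplex (ModuleCat.{u} Sᵐᵒᵖ) ℤ} (hP : IsBoundedFG S P)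
  (hK : IsBoundedFG S K)

include hP in
lemma isKProjective (h : ∀ n, Projective (P.X n)) : P.IsKProjective := by
  obtain ⟨-, a, b, hb⟩ := hP
  have : P.IsStrictlyLE b := by
    rw [CochainComplex.isStrictlyLE_iff]
    exact fun n hn => hb n (.inr hn)
  exact CochainComplex.isKProjective_of_projective P b

lemma exists_map_eq_of_isKProjective [P.IsKProjective] (φ : of P hP ⟶ of K hK) :
    ∃ f : P ⟶ K, map hP hK f = φ := by
  obtain ⟨L, hL, f, s, hs, h⟩ := exists_fraction hP hK φ
  obtain ⟨g, hg⟩ := (quotient_map_comp_bijective_of_quasiIso P s).2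
    ((HomotopyCategory.quotient _ _).map f)
  obtain ⟨g, rfl⟩ := (HomotopyCategory.quotient _ _).map_surjective g
  refine ⟨g, ?_⟩
  rw [← cancel_mono (map hK hL s), h, ← map_comp]
  refine map_eq_of_homotopy _ _ (HomotopyCategory.homotopyOfEq _ _ ?_)
  rw [Functor.map_comp]
  exact hg

lemma nonempty_homotopy_of_isKProjective [P.IsKProjective] {f : P ⟶ K} (h : map hP hK f = 0) :
    Nonempty (Homotopy f 0) := by
  obtain ⟨L, hL, s, hs, ⟨H⟩⟩ := exists_of_map_eq_zero hP hK h
  refine ⟨HomotopyCategory.homotopyOfEq _ _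
    ((quotient_map_comp_bijective_of_quasiIso P s).1 ?_)⟩
  have := HomotopyCategory.eq_of_homotopy _ _ H
  rw [Functor.map_comp] at this
  refine this.trans ?_
  change _ = _ ≫ _
  rw [Functor.map_zero, Functor.map_zero, zero_comp]

include hK in
lemma isBoundedFG_of_mono [IsNoetherianRing Sᵐᵒᵖ] (f : P ⟶ K) [Mono f] : IsBoundedFG S P := by
  obtain ⟨h₁, a, b, h₂⟩ := hK
  have (n : ℤ) : Mono (f.f n) := inferInstance
  refine ⟨fun n => ?_, a, b, fun n hn => IsZero.of_mono (f.f n) (h₂ n hn)⟩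
  have := h₁ n
  exact Module.Finite.of_injective (f.f n).hom ((ModuleCat.mono_iff_injective _).1 inferInstance)

instance : (isPerfect (S := S)).IsClosedUnderIsomorphisms where
  of_iso := by
    rintro X Y e ⟨P, hP, h, ⟨i⟩⟩
    exact ⟨P, hP, h, ⟨e.symm ≪≫ i⟩⟩

instance : (isPerfect (S := S)).ContainsZero where
  exists_zero := by
    have h (n : ℤ) : IsZero ((0 : CochainComplex (ModuleCat.{u} Sᵐᵒᵖ) ℤ).X n) :=
      (HomologicalComplex.eval _ _ n).map_isZero (isZero_zero _)
    have h0 : IsBoundedFG S (0 : CochainComplex (ModuleCat.{u} Sᵐᵒᵖ) ℤ) :=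
      ⟨fun n => finite_of_isZero S _ (h n), 0, 0, fun n _ => h n⟩
    exact ⟨of _ h0, isZero_of_acyclic _
      (HomologicalComplex.acyclic_of_isZero _ (isZero_zero _)), 0, h0, fun n => (h n).projective,
      ⟨Iso.refl _⟩⟩

lemma projective_mappingCone {P K : CochainComplex (ModuleCat.{u} Sᵐᵒᵖ) ℤ} (f : P ⟶ K)
    (hP : ∀ n, Projective (P.X n)) (hK : ∀ n, Projective (K.X n)) (n : ℤ) :
    Projective ((CochainComplex.mappingCone f).X n) :=
  Projective.of_iso (HomologicalComplex.homotopyCofiber.XIsoBiprod f n (n + 1) rfl).symm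
    inferInstance

instance : (isPerfect (S := S)).IsTriangulatedClosed₂ := .mk' (by
  rintro T hT ⟨P, hP, hP', ⟨e₁⟩⟩ ⟨Q, hQ, hQ', ⟨e₃⟩⟩
  have := isKProjective hQ hQ'
  -- The connecting morphism of the triangle starts at a K-projective complex, so it is a chain map.
  -- Its mapping cone has projective terms and represents the middle object shifted by one.
  obtain ⟨f, hf⟩ := exists_map_eq_of_isKProjective hQ (hP.shift 1)
    (e₃.inv ≫ T.mor₃ ≫ (shiftFunctor _ (1 : ℤ)).map e₁.hom ≫ (shiftIso hP 1).hom)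
  obtain ⟨h, hd⟩ := exists_triangle_mappingCone hQ (hP.shift 1) f
  have hC := isBoundedFG_mappingCone S f hQ (hP.shift 1)
  let e : T.obj₂⟦(1 : ℤ)⟧ ≅ of _ hC := Triangle.π₃.mapIso (isoTriangleOfIso₁₂ T.rotate.rotate _
    (rot_of_distTriang _ (rot_of_distTriang _ hT)) hd e₃
    ((shiftFunctor _ (1 : ℤ)).mapIso e₁ ≪≫ shiftIso hP 1) (by
      change T.mor₃ ≫ (shiftFunctor _ (1 : ℤ)).map e₁.hom ≫ (shiftIso hP 1).hom =
        e₃.hom ≫ map hQ (hP.shift 1) f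
      rw [hf, Iso.hom_inv_id_assoc]))
  refine ⟨_, hC.shift (-1), fun n => projective_mappingCone f hQ' (fun i => hP' (i + 1)) _,
    ⟨(shiftEquiv (DbMod S) (1 : ℤ)).unitIso.app T.obj₂ ≪≫
      (shiftFunctor _ (-1 : ℤ)).mapIso e ≪≫ shiftIso hC (-1)⟩⟩)

end DbMod

end

section

variable (k : Type u) [Field k] (A : Type u) [Ring A] [Algebra k A]

/-- The functor `N ↦ A ⊗ N`, free over `A`. -/
def freeCover : ModuleCat.{u} Aᵐᵒᵖ ⥤ ModuleCat.{u} Aᵐᵒᵖ where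
  obj N := ModuleCat.of Aᵐᵒᵖ (Aᵐᵒᵖ ⊗[k] N)
  map f := ModuleCat.ofHom (TensorProduct.AlgebraTensorModule.map LinearMap.id
    (f.hom.restrictScalars k))
  map_id _ := ModuleCat.hom_ext (TensorProduct.AlgebraTensorModule.ext fun _ _ => rfl)
  map_comp _ _ := ModuleCat.hom_ext (TensorProduct.AlgebraTensorModule.ext fun _ _ => rfl)

instance : (freeCover k A).Additive where
  map_add := ModuleCat.hom_ext (TensorProduct.AlgebraTensorModule.ext fun a _ =>
    TensorProduct.tmul_add a _ _)

/-- The surjection `A ⊗ N → N`. -/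
def freeCoverπ : freeCover k A ⟶ 𝟭 _ where
  app N := ModuleCat.ofHom (X := Aᵐᵒᵖ ⊗[k] N) (Y := N)
    (TensorProduct.AlgebraTensorModule.lift (LinearMap.toSpanSingleton Aᵐᵒᵖ (N →ₗ[k] N)
      LinearMap.id))
  naturality _ _ f := ModuleCat.hom_ext (TensorProduct.AlgebraTensorModule.ext fun a n =>
    (map_smul f.hom a n).symm)

instance (N : ModuleCat.{u} Aᵐᵒᵖ) : Epi ((freeCoverπ k A).app N) := by
  rw [ModuleCat.epi_iff_surjective]
  exact fun n => ⟨(1 : Aᵐᵒᵖ) ⊗ₜ[k] n, one_smul Aᵐᵒᵖ n⟩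

instance (N : ModuleCat.{u} Aᵐᵒᵖ) : Projective ((freeCover k A).obj N) :=
  inferInstanceAs (Projective (ModuleCat.of Aᵐᵒᵖ (Aᵐᵒᵖ ⊗[k] N)))

variable {A}

lemma finite_of_algebra [Module.Finite k A] (N : ModuleCat.{u} Aᵐᵒᵖ) [Module.Finite Aᵐᵒᵖ N] :
    Module.Finite k N :=
  have : Module.Finite k Aᵐᵒᵖ := Module.Finite.equiv (MulOpposite.opLinearEquiv k)
  Module.Finite.trans Aᵐᵒᵖ N

lemma isBoundedFG_freeCover [Module.Finite k A] {K : CochainComplex (ModuleCat.{u} Aᵐᵒᵖ) ℤ}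
    (hK : IsBoundedFG A K) :
    IsBoundedFG A (((freeCover k A).mapHomologicalComplex (ComplexShape.up ℤ)).obj K) := by
  obtain ⟨h₁, a, b, h₂⟩ := hK
  refine ⟨fun n => ?_, a, b, fun n hn => (freeCover k A).map_isZero (h₂ n hn)⟩
  have := h₁ n
  have := finite_of_algebra k (K.X n)
  exact inferInstanceAs (Module.Finite Aᵐᵒᵖ (Aᵐᵒᵖ ⊗[k] (K.X n)))

include k in
/-- Every object is an extension of an object in low degrees by a perfect one. -/
theorem DbMod.exists_perfect_approximation [Module.Finite k A] (N : ℕ) (b : ℤ) :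
    DbMod.isLE (S := A) b ≤ ObjectProperty.extensionProduct DbMod.isPerfect (DbMod.isLE (b - N)) := by
  induction N generalizing b with
  | zero =>
    rw [Nat.cast_zero, sub_zero]
    exact fun X hX => ObjectProperty.le_extensionProduct_right
      (P := DbMod.isPerfect (S := A)) (Q := DbMod.isLE b) X hX
  | succ N ih =>
    rintro X ⟨K, hK, hb, ⟨e⟩⟩
    let G := ((freeCover k A).mapHomologicalComplex (ComplexShape.up ℤ)).obj K
    have hG : IsBoundedFG A G := isBoundedFG_freeCover k hK
    let π : G ⟶ K := (NatTrans.mapHomologicalComplex (freeCoverπ k A) (ComplexShape.up ℤ)).app K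
    have hπ (n : ℤ) : Epi (π.f n) := inferInstanceAs (Epi ((freeCoverπ k A).app (K.X n)))
    have : Epi π := HomologicalComplex.epi_of_epi_f _ hπ
    have : Module.Finite k Aᵐᵒᵖ := Module.Finite.equiv (MulOpposite.opLinearEquiv k)
    have : IsNoetherianRing Aᵐᵒᵖ := IsNoetherianRing.of_finite k Aᵐᵒᵖ
    have hΩ : IsBoundedFG A (kernel π) := DbMod.isBoundedFG_of_mono hG (kernel.ι π)
    have hT : (ShortComplex.mk (kernel.ι π) π (kernel.condition π)).ShortExact :=
      { exact := ShortComplex.exact_of_f_is_kernel _ (kernelIsKernel π) }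
    have hΩ' (i : ℤ) (hi : b < i) : IsZero ((kernel π).X i) :=
      have : Mono ((kernel.ι π).f i) := (HomologicalComplex.eval _ _ i).map_mono (kernel.ι π)
      IsZero.of_mono ((kernel.ι π).f i) ((freeCover k A).map_isZero (hb i hi))
    obtain ⟨δ, hδ⟩ := DbMod.exists_triangle_of_shortExact hΩ hG hK hT
    have h1 : DbMod.isLE (S := A) (b - 1) ((DbMod.of _ hΩ)⟦(1 : ℤ)⟧) :=
      ⟨_, hΩ.shift 1, fun n hn => hΩ' (n + 1) (by omega), ⟨DbMod.shiftIso hΩ 1⟩⟩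
    have h2 : ObjectProperty.extensionProduct DbMod.isPerfect
        (ObjectProperty.extensionProduct DbMod.isPerfect (DbMod.isLE (b - (N + 1 : ℕ)))) X := by
      -- Rotating the triangle of $0\to\Omega\to G\to K\to 0$ exhibits $K$ as an extension of
      -- $\Omega[1]$, bounded above by `b - 1`, by the perfect complex $G$.
      refine ObjectProperty.prop_of_iso _ e.symm ⟨_, _, _, _, _, rot_of_distTriang _ hδ, ?_, ?_⟩
      · exact ⟨G, hG, fun n => inferInstanceAs (Projective ((freeCover k A).obj (K.X n))),
          ⟨Iso.refl _⟩⟩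
      · have := ih (b - 1) _ h1
        rwa [show b - 1 - N = b - (N + 1 : ℕ) by push_cast; ring] at this
    rw [← ObjectProperty.extensionProduct_assoc] at h2
    exact ObjectProperty.monotone_extensionProduct_left _
      (ObjectProperty.extensionProduct_le_of_isTriangulatedClosed₂ le_rfl le_rfl) _ h2

end

end

/-! ### Vanishing of morphisms between tensor products. -/

noncomputable section

open scoped ModuleCat
open CochainComplex CochainComplex.HomComplex

section

variable {S : Type u} [Ring S]

lemma DbMod.mem_coboundaries_of_hom_eq_zero {P Y : CochainComplex (ModuleCat.{u} Sᵐᵒᵖ) ℤ}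
    [P.IsKProjective] (hP : IsBoundedFG S P) (hY : IsBoundedFG S Y) (n : ℤ)
    (h : ∀ φ : of P hP ⟶ (of Y hY)⟦n⟧, φ = 0) (z : Cocycle P Y n) : z ∈ coboundaries _ _ _ := by
  rw [← CohomologyClass.toHom_mk_eq_zero_iff, CohomologyClass.toHom_mk,
    HomotopyCategory.quotient_map_eq_zero_iff]
  refine nonempty_homotopy_of_isKProjective hP (hY.shift n) ?_
  rw [← cancel_mono (shiftIso hY n).inv, h (_ ≫ _), zero_comp]

end

section

variable {k : Type u} [Field k] {R : Type u} [Ring R] [Algebra k R]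
  {A : Type u} [Ring A] [Algebra k A] [Module.Finite k A]
  {M M' : ModuleCat.{u} Rᵐᵒᵖ} [Module.Finite Rᵐᵒᵖ M]
  [IsExactFG ((tensorBifunctor k R A).obj M)] [IsExactFG ((tensorBifunctor k R A).obj M')]

/-- Only nonpositive shifts enter, because only $\tau_{\le 0}$ of the Hom complex must be acyclic.
This matters: a perfect approximation inherits the vanishing of morphisms only in that range. -/
lemma hom_tensor_eq_zero_of_projective {P Y : CochainComplex (ModuleCat.{u} Aᵐᵒᵖ) ℤ}
    (hP : IsBoundedFG A P) (hP' : ∀ n, Projective (P.X n)) (hY : IsBoundedFG A Y)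
    (h : ∀ n : ℤ, n ≤ 0 → ∀ φ : DbMod.of P hP ⟶ (DbMod.of Y hY)⟦n⟧, φ = 0)
    (φ : DbMod.of _ (isBoundedFG_mapCpx ((tensorBifunctor k R A).obj M) hP) ⟶
      DbMod.of _ (isBoundedFG_mapCpx ((tensorBifunctor k R A).obj M') hY)) : φ = 0 := by
  have := DbMod.isKProjective hP hP'
  obtain ⟨W, hW, f, s, hs, hφ⟩ := DbMod.exists_fraction _ _ φ
  have : (resRight k R A).PreservesHomology := Functor.preservesHomology_of_map_exact _ fun T hT => by
    rw [ShortComplex.moduleCat_exact_iff] at hT ⊢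
    exact hT
  have : QuasiIso (((resRight k R A).mapHomologicalComplex (ComplexShape.up ℤ)).map s) :=
    inferInstance
  rw [← cancel_mono (DbMod.map (isBoundedFG_mapCpx _ hY) hW s), hφ, zero_comp]
  refine map_eq_zero_of_actHomComplex_exactAt hP hW (isBoundedFG_actHomComplex hP hP' hW)
    (fun n hn => actHomComplex_exactAt P W n ?_) f
  exact mem_coboundaries_of_quasiIso P
    (((resRight k R A).mapHomologicalComplex (ComplexShape.up ℤ)).map s) n
    (mem_coboundaries_tensor M' hP n (DbMod.mem_coboundaries_of_hom_eq_zero hP hY n (h n hn)))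

/-- The functors `M ⊗ -` preserve the vanishing of all morphisms up to shift. -/
theorem hom_dbFunctor_tensor_eq_zero (X Y : DbMod A)
    (h : ∀ (n : ℤ) (φ : X ⟶ Y⟦n⟧), φ = 0)
    (φ : (dbFunctor ((tensorBifunctor k R A).obj M)).obj X ⟶
      (dbFunctor ((tensorBifunctor k R A).obj M')).obj Y) : φ = 0 := by
  obtain ⟨L, hL, ⟨e'⟩⟩ := DbMod.exists_iso_of Y
  obtain ⟨K, hK, ⟨e⟩⟩ := DbMod.exists_iso_of X
  obtain ⟨b, hb⟩ : ∃ b, ∀ n, b < n → IsZero (K.X n) := by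
    obtain ⟨-, a, b, hb⟩ := hK
    exact ⟨b, fun n hn => hb n (.inr hn)⟩
  obtain ⟨a, ha⟩ : ∃ a, ∀ n, n ≤ a → IsZero (L.X n) := by
    obtain ⟨-, a, b, ha⟩ := hL
    exact ⟨a - 1, fun n hn => ha n (.inl (by omega))⟩
  obtain ⟨P, Z, f, g, δ, hT, ⟨P', hP, hP', ⟨eP⟩⟩, ⟨Z', hZ, hZ', ⟨eZ⟩⟩⟩ :=
    DbMod.exists_perfect_approximation k (b - a + 1).toNat b X ⟨K, hK, hb, ⟨e⟩⟩
  have hZ'' (n : ℤ) (hn : a ≤ n) : IsZero (Z'.X n) := hZ' n (by omega)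
  let F := dbFunctor ((tensorBifunctor k R A).obj M)
  let F' := dbFunctor ((tensorBifunctor k R A).obj M')
  -- `Z` lives in degrees at most `a - 1` and `L` in degrees above `a`. The spare degree allows `n =
  -- 1`, which the connecting morphism in `hPY` requires.
  have hZL (n : ℤ) (hn : n ≤ 1) (ψ : Z ⟶ Y⟦n⟧) : ψ = 0 := by
    have h0 := DbMod.hom_eq_zero_of_exactAt hZ (hL.shift n) (a - 1)
      (fun i hi => hZ'' i (by omega))
      (fun i hi => HomologicalComplex.ExactAt.of_isZero (ha (i + n) (by omega)))
      (eZ.inv ≫ ψ ≫ (CategoryTheory.shiftFunctor _ n).map e'.hom ≫ (DbMod.shiftIso hL n).hom)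
    rwa [Preadditive.IsIso.comp_left_eq_zero, Preadditive.IsIso.comp_right_eq_zero] at h0
  -- The obstruction to extending `ψ` along `P ⟶ X` is a morphism from `Z` to `Y⟦n + 1⟧`, which
  -- vanishes; the extension vanishes by hypothesis.
  have hPY (n : ℤ) (hn : n ≤ 0) (ψ : P ⟶ Y⟦n⟧) : ψ = 0 := by
    have h1 : δ ≫ (CategoryTheory.shiftFunctor _ (1 : ℤ)).map ψ = 0 := by
      rw [← cancel_mono ((CategoryTheory.shiftFunctorAdd' _ n 1 (n + 1) rfl).inv.app Y), zero_comp]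
      exact hZL (n + 1) (by omega) _
    obtain ⟨χ, hχ⟩ := exists_desc₃ (rot_of_distTriang _ hT) _ h1
    obtain ⟨χ, rfl⟩ := (CategoryTheory.shiftFunctor (DbMod A) (1 : ℤ)).map_surjective χ
    apply (CategoryTheory.shiftFunctor (DbMod A) (1 : ℤ)).map_injective
    exact hχ.symm.trans ((congrArg (_ ≫ ·) ((congrArg _ (h n χ)).trans
      (Functor.map_zero _ _ _))).trans (comp_zero.trans (Functor.map_zero _ _ _).symm))
  have hFZ (ψ : F.obj Z ⟶ F'.obj Y) : ψ = 0 := by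
    have h0 := DbMod.hom_eq_zero_of_exactAt (isBoundedFG_mapCpx _ hZ) (isBoundedFG_mapCpx _ hL)
      (a - 1) (fun i hi => Functor.map_isZero _ (hZ'' i (by omega)))
      (fun i hi => HomologicalComplex.ExactAt.of_isZero (Functor.map_isZero _ (ha i (by omega))))
      ((F.mapIso eZ ≪≫ dbFunctorObjIso _ hZ).inv ≫ ψ ≫ (F'.mapIso e' ≪≫ dbFunctorObjIso _ hL).hom)
    rwa [Preadditive.IsIso.comp_left_eq_zero, Preadditive.IsIso.comp_right_eq_zero] at h0
  have hFP (ψ : F.obj P ⟶ F'.obj Y) : ψ = 0 := by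
    have h0 := hom_tensor_eq_zero_of_projective hP hP' hL (fun n hn χ => by
      have h1 := hPY n hn (eP.hom ≫ χ ≫ (CategoryTheory.shiftFunctor _ n).map e'.inv)
      rwa [Preadditive.IsIso.comp_left_eq_zero, Preadditive.IsIso.comp_right_eq_zero] at h1)
      ((F.mapIso eP ≪≫ dbFunctorObjIso _ hP).inv ≫ ψ ≫ (F'.mapIso e' ≪≫ dbFunctorObjIso _ hL).hom)
    rwa [Preadditive.IsIso.comp_left_eq_zero, Preadditive.IsIso.comp_right_eq_zero] at h0
  obtain ⟨ψ, rfl⟩ := exists_desc₂ (F.map_distinguished _ hT) φ (hFP _)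
  rw [hFZ ψ]
  exact comp_zero

end

end

/-! ### Separability and retracts of tensor product modules. -/

noncomputable section

open scoped ModuleCat

section

variable {k : Type u} [Field k] {R : Type u} [Ring R] [Algebra k R]
  {A : Type u} [Ring A] [Algebra k A]

/-- The restriction of right `R ⊗ A`-modules to right `R`-modules. -/
abbrev resLeft (k : Type u) [Field k] (R : Type u) [Ring R] [Algebra k R]
    (A : Type u) [Ring A] [Algebra k A] :
    ModuleCat.{u} (R ⊗[k] A)ᵐᵒᵖ ⥤ ModuleCat.{u} Rᵐᵒᵖ :=
  ModuleCat.restrictScalars (inclLeftOp k R A)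

/-- The actions of `R` and `A` on a right `R ⊗ A`-module commute. -/
lemma inclRightOp_smul_inclLeftOp_smul (Z : ModuleCat.{u} (R ⊗[k] A)ᵐᵒᵖ) (r : R) (a : A) (z : Z) :
    inclRightOp k R A (.op a) • inclLeftOp k R A (.op r) • z =
      inclLeftOp k R A (.op r) • inclRightOp k R A (.op a) • z := by
  rw [smul_smul, smul_smul, inclRightOp_mul_inclLeftOp, inclLeftOp_mul_inclRightOp]

lemma inclRightOp_smul_smul (Z : ModuleCat.{u} (R ⊗[k] A)ᵐᵒᵖ) (a b : A) (z : Z) :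
    inclRightOp k R A (.op a) • inclRightOp k R A (.op b) • z =
      inclRightOp k R A (.op (b * a)) • z := by
  rw [smul_smul, ← map_mul, MulOpposite.op_mul]

lemma inclRightOp_op_smul (c : k) (a : A) : inclRightOp k R A (.op (c • a)) =
    inclLeftOp k R A (algebraMap k Rᵐᵒᵖ c) * inclRightOp k R A (.op a) := by
  refine Eq.trans ?_ (inclLeftOp_mul_inclRightOp k R A (algebraMap k R c) a).symm
  refine congrArg MulOpposite.op ?_
  change (1 : R) ⊗ₜ[k] (c • a) = _
  rw [Algebra.algebraMap_eq_smul_one, TensorProduct.smul_tmul]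

section

variable (Z : ModuleCat.{u} (R ⊗[k] A)ᵐᵒᵖ) (J : Ideal Aᵐᵒᵖ)

/-- A right ideal of `A` as a right module. -/
def idealModule (J : Ideal Aᵐᵒᵖ) : ModuleCat.{u} Aᵐᵒᵖ := ModuleCat.of Aᵐᵒᵖ J

/-- The map `z ⊗ j ↦ z j` for `j` in a right ideal of `A`. -/
def idealAct : tensorObj k R A ((resLeft k R A).obj Z) (idealModule J) ⟶ Z :=
  tensorDesc (AddMonoidHom.mk' (fun z : Z => AddMonoidHom.mk'
      (fun j : J => inclRightOp k R A j.1 • z) fun j j' => by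
        rw [← add_smul, ← map_add]; rfl)
      fun z z' => AddMonoidHom.ext fun j => smul_add _ z z')
    (fun r z j => inclRightOp_smul_inclLeftOp_smul Z r j.1.unop z)
    (fun a z j => (congrArg (· • (show Z from z)) (map_mul (inclRightOp k R A) (.op a) j.1)).trans
      (mul_smul _ _ _))

lemma idealAct_tmul (z : Z) (j : J) :
    (idealAct Z J).hom (show tensorObj k R A ((resLeft k R A).obj Z) (idealModule J) from
      (show (resLeft k R A).obj Z from z) ⊗ₜ[k]
        (show idealModule J from j)) = inclRightOp k R A j.1 • z := rfl

end

section

variable {B : Type u} [Ring B] [Algebra k B] (π : A →ₐ[k] B)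

/-- `B` as a right module over `A`. -/
def quotModule : ModuleCat.{u} Aᵐᵒᵖ :=
  (ModuleCat.restrictScalars (RingHom.op π.toRingHom)).obj (ModuleCat.of Bᵐᵒᵖ Bᵐᵒᵖ)

lemma finite_quotModule (hπ : Function.Surjective π) : Module.Finite Aᵐᵒᵖ (quotModule π) := by
  let f : Aᵐᵒᵖ →ₗ[Aᵐᵒᵖ] quotModule π :=
    { toFun := RingHom.op π.toRingHom
      map_add' := map_add _
      map_smul' := map_mul (RingHom.op π.toRingHom) }
  refine Module.Finite.of_surjective f fun b => ?_
  obtain ⟨a, ha⟩ := hπ (MulOpposite.unop (show Bᵐᵒᵖ from b))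
  exact ⟨.op a, congrArg MulOpposite.op ha⟩

variable (Z : ModuleCat.{u} (R ⊗[k] A)ᵐᵒᵖ)
  (g : B →ₗ[k] A) (hg : ∀ b, π (g b) = b)

/-- The map `b ↦ z b` for a right `R ⊗ A`-module on which `A` acts through `B`. -/
def quotAct (z : Z) : B →ₗ[k] (resLeft k R A).obj Z where
  toFun b := (inclRightOp k R A (.op (g b)) • z : Z)
  map_add' b b' := by
    rw [map_add, MulOpposite.op_add, map_add, add_smul]; rfl
  map_smul' c b := by
    rw [map_smul, inclRightOp_op_smul, mul_smul]
    rfl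

/-- The identification of `B` with the right module `B`. -/
def toQuotModule : B →ₗ[k] quotModule π where
  toFun b := (MulOpposite.op b : Bᵐᵒᵖ)
  map_add' _ _ := rfl
  map_smul' c b := by
    change MulOpposite.op (c • b) = MulOpposite.op (π (algebraMap k A c)) * MulOpposite.op b
    rw [← MulOpposite.op_mul, AlgHom.commutes, ← Algebra.commutes, Algebra.smul_def]

variable (hZ : ∀ a, π a = 0 → ∀ z : Z, inclRightOp k R A (.op a) • z = 0)

-- The linear section `g` is not multiplicative, but the action of `g b` on `Z` depends only on `b`,
-- as the kernel of `π` kills `Z`.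
include hg hZ in
lemma inclRightOp_section_smul {a : A} {b : B} (h : π a = b) (z : Z) :
    inclRightOp k R A (.op (g b)) • z = inclRightOp k R A (.op a) • z := by
  rw [← sub_eq_zero, ← sub_smul, ← map_sub, ← MulOpposite.op_sub]
  exact hZ _ (by rw [map_sub, hg, h, sub_self]) z

/-- The map `z ⊗ b ↦ z b`. -/
def quotEval : tensorObj k R A ((resLeft k R A).obj Z) (quotModule π) ⟶ Z :=
  tensorDesc (AddMonoidHom.mk' (fun z : Z =>
      (AddMonoidHom.comp (quotAct (R := R) Z g z).toAddMonoidHom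
        (MulOpposite.opAddEquiv (α := B)).symm.toAddMonoidHom :))
      fun z z' => AddMonoidHom.ext fun b => smul_add _ z z')
    (fun r z b => inclRightOp_smul_inclLeftOp_smul Z r _ z)
    (fun a z b => (inclRightOp_section_smul π Z g hg hZ (a := g (MulOpposite.unop (show Bᵐᵒᵖ from b)) * a)
      (by rw [map_mul, hg]; rfl) (show Z from z)).trans (inclRightOp_smul_smul Z a _ _).symm)

lemma quotEval_tmul (z : Z) (b : B) :
    (quotEval π Z g hg hZ).hom (show tensorObj k R A ((resLeft k R A).obj Z) (quotModule π) from
      (show (resLeft k R A).obj Z from z) ⊗ₜ[k] toQuotModule π b) =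
        inclRightOp k R A (.op (g b)) • z := rfl

include hg hZ in
lemma map_quotAct_mul (z : Z) (r : R) (a : A) (t : B ⊗[k] B) :
    TensorProduct.map (quotAct Z g (MulOpposite.op (r ⊗ₜ[k] a) • z)) (toQuotModule π) t =
      TensorProduct.map (Algebra.lsmul k k _ (MulOpposite.op r) ∘ₗ quotAct Z g z) (toQuotModule π)
        ((π a ⊗ₜ[k] 1) * t) := by
  induction t with
  | zero => simp
  | add x y hx hy => rw [mul_add, map_add, map_add, hx, hy]
  | tmul b b' =>
    rw [Algebra.TensorProduct.tmul_mul_tmul, one_mul, TensorProduct.map_tmul,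
      TensorProduct.map_tmul]
    refine congrArg (· ⊗ₜ[k] _) ?_
    change inclRightOp k R A (.op (g b)) • (MulOpposite.op (r ⊗ₜ[k] a) • z) =
      inclLeftOp k R A (.op r) • (inclRightOp k R A (.op (g (π a * b))) • z)
    rw [inclRightOp_section_smul π Z g hg hZ (a := a * g b) (b := π a * b)
        (by rw [map_mul, hg]),
      ← inclLeftOp_mul_inclRightOp, mul_smul, inclRightOp_smul_inclLeftOp_smul,
      inclRightOp_smul_smul]

lemma tensorAction_map_quotAct (z : Z) (r : R) (a : A) (t : B ⊗[k] B) :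
    TensorProduct.map (Algebra.lsmul k k _ (MulOpposite.op r) ∘ₗ quotAct Z g z) (toQuotModule π)
        (t * (1 ⊗ₜ[k] π a)) = tensorAction k R A ((resLeft k R A).obj Z) (quotModule π)
          (MulOpposite.op (r ⊗ₜ[k] a)) (TensorProduct.map (quotAct Z g z) (toQuotModule π) t) := by
  induction t with
  | zero => simp
  | add x y hx hy => rw [add_mul, map_add, map_add, map_add, hx, hy]
  | tmul b b' =>
    rw [Algebra.TensorProduct.tmul_mul_tmul, mul_one, TensorProduct.map_tmul,
      TensorProduct.map_tmul, tensorAction_apply]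
    rfl

variable (σ : B →ₗ[k] B ⊗[k] B) (hσ₁ : ∀ b x, σ (b * x) = (b ⊗ₜ[k] 1) * σ x)
  (hσ₂ : ∀ b x, σ (x * b) = σ x * (1 ⊗ₜ[k] b))

include hg hZ in
lemma quotEval_map (z : Z) (t : B ⊗[k] B) :
    (quotEval π Z g hg hZ).hom (show tensorObj k R A ((resLeft k R A).obj Z) (quotModule π) from
      TensorProduct.map (quotAct Z g z) (toQuotModule π) t) =
      quotAct Z g z (LinearMap.mul' k B t) := by
  induction t with
  | zero =>
    rw [map_zero, map_zero, map_zero]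
    exact map_zero (quotEval π Z g hg hZ).hom
  | add x y hx hy =>
    rw [map_add, map_add, map_add, ← hx, ← hy]
    exact map_add (quotEval π Z g hg hZ).hom _ _
  | tmul b b' =>
    refine (quotEval_tmul π Z g hg hZ (inclRightOp k R A (.op (g b)) • z) b').trans ?_
    rw [inclRightOp_smul_smul]
    exact (inclRightOp_section_smul π Z g hg hZ (by rw [map_mul, hg, hg]; rfl) z).symm

-- The separability element $e=\sigma(1)$ satisfies $(b\otimes 1)e=\sigma(b)=e(1\otimes b)$; this
-- moves the action of `A` from the first tensor factor to the second.
include hg hZ hσ₁ hσ₂ in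
lemma map_quotAct_smul (z : Z) (r : R) (a : A) :
    TensorProduct.map (quotAct Z g (MulOpposite.op (r ⊗ₜ[k] a) • z)) (toQuotModule π) (σ 1) =
      tensorAction k R A ((resLeft k R A).obj Z) (quotModule π)
        (MulOpposite.op (r ⊗ₜ[k] a))
          (TensorProduct.map (quotAct Z g z) (toQuotModule π) (σ 1)) := by
  rw [map_quotAct_mul π Z g hg hZ, ← hσ₁, mul_one, ← one_mul (π a), hσ₂,
    tensorAction_map_quotAct]

lemma quotAct_add (z z' : Z) : quotAct (R := R) Z g (z + z') = quotAct Z g z + quotAct Z g z' :=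
  LinearMap.ext fun _ => smul_add _ z z'

/-- The map `z ↦ ∑ z bᵢ ⊗ bᵢ'` for a separability element `∑ bᵢ ⊗ bᵢ'`. -/
def quotCoeval : Z ⟶ tensorObj k R A ((resLeft k R A).obj Z) (quotModule π) :=
  letI : Module (R ⊗[k] A)ᵐᵒᵖ ((resLeft k R A).obj Z ⊗[k] quotModule π) :=
    Module.compHom _ (tensorAction k R A _ _).toRingHom
  have hadd (z z' : Z) : TensorProduct.map (quotAct (R := R) Z g (z + z')) (toQuotModule π) (σ 1) =
      TensorProduct.map (quotAct Z g z) (toQuotModule π) (σ 1) +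
        TensorProduct.map (quotAct Z g z') (toQuotModule π) (σ 1) := by
    rw [quotAct_add, TensorProduct.map_add_left, LinearMap.add_apply]
  ModuleCat.ofHom (X := Z) (Y := (resLeft k R A).obj Z ⊗[k] quotModule π)
    { toFun := fun z => TensorProduct.map (quotAct (R := R) Z g z) (toQuotModule π) (σ 1)
      map_add' := hadd
      map_smul' := fun x z => by
        change _ = tensorAction k R A _ _ x _
        obtain ⟨x, rfl⟩ := MulOpposite.op_surjective x
        induction x with
        | zero =>
          have : quotAct (R := R) Z g 0 = 0 := LinearMap.ext fun b =>
            smul_zero (A := Z) (inclRightOp k R A (.op (g b)))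
          rw [MulOpposite.op_zero, zero_smul, this, TensorProduct.map_zero_left, map_zero]
          rfl
        | add x y hx hy =>
          rw [MulOpposite.op_add, add_smul, hadd, hx, hy, map_add]
          rfl
        | tmul r a => exact map_quotAct_smul π Z g hg hZ σ hσ₁ hσ₂ z r a }

lemma quotCoeval_comp_quotEval (hσ : LinearMap.mul' k B (σ 1) = 1) :
    quotCoeval π Z g hg hZ σ hσ₁ hσ₂ ≫ quotEval π Z g hg hZ = 𝟙 Z := by
  ext z
  refine (quotEval_map π Z g hg hZ z (σ 1)).trans ?_
  rw [hσ]
  refine (inclRightOp_section_smul π Z g hg hZ (map_one π) z).trans ?_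
  rw [MulOpposite.op_one, map_one, one_smul]
  rfl

end

/-- A right `R ⊗ A`-module on which `A` acts through a separable quotient `B` is a retract
of a module `M ⊗ B`. -/
lemma nonempty_retract_of_isSeparableAlgebra {B : Type u} [Ring B] [Algebra k B] (π : A →ₐ[k] B)
    (hπ : Function.Surjective π) (hB : IsSeparableAlgebra k B) (Z : ModuleCat.{u} (R ⊗[k] A)ᵐᵒᵖ)
    (hZ : ∀ a, π a = 0 → ∀ z : Z, inclRightOp k R A (.op a) • z = 0) :
    Nonempty (Retract Z (tensorObj k R A ((resLeft k R A).obj Z) (quotModule π))) := by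
  obtain ⟨g, hg⟩ := π.toLinearMap.exists_rightInverse_of_surjective (LinearMap.range_eq_top.2 hπ)
  obtain ⟨σ, hσ, hσ₁, hσ₂⟩ := hB
  exact ⟨⟨_, _, quotCoeval_comp_quotEval π Z g (LinearMap.congr_fun hg) hZ σ hσ₁ hσ₂ (hσ 1)⟩⟩

end

end

/-! ### Generation by tensor products of modules. -/

noncomputable section

open scoped ModuleCat

section

variable {S : Type u} [Ring S] (P : ObjectProperty (DbMod S))

namespace DbMod

lemma prop_single_of_retract [P.IsStableUnderRetracts] {M N : ModuleCat.{u} Sᵐᵒᵖ}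
    [Module.Finite Sᵐᵒᵖ M] [Module.Finite Sᵐᵒᵖ N] (r : Retract M N)
    (h : P (of _ (isBoundedFG_single 0 N))) : P (of _ (isBoundedFG_single 0 M)) :=
  P.prop_of_retract
    { i := map (isBoundedFG_single 0 M) (isBoundedFG_single 0 N)
        ((HomologicalComplex.single _ _ 0).map r.i)
      r := map (isBoundedFG_single 0 N) (isBoundedFG_single 0 M)
        ((HomologicalComplex.single _ _ 0).map r.r)
      retract := by
        rw [← map_comp, ← Functor.map_comp, r.retract, CategoryTheory.Functor.map_id, map_id] } h

lemma prop_single_of_shortExact [P.IsTriangulatedClosed₂] [P.IsClosedUnderIsomorphisms]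
    {M N Q : ModuleCat.{u} Sᵐᵒᵖ} [Module.Finite Sᵐᵒᵖ M] [Module.Finite Sᵐᵒᵖ N]
    [Module.Finite Sᵐᵒᵖ Q] {f : M ⟶ N} {g : N ⟶ Q} {w : f ≫ g = 0}
    (hT : (ShortComplex.mk f g w).ShortExact)
    (h₁ : P (of _ (isBoundedFG_single 0 M))) (h₃ : P (of _ (isBoundedFG_single 0 Q))) :
    P (of _ (isBoundedFG_single 0 N)) := by
  obtain ⟨δ, hδ⟩ := exists_triangle_of_shortExact (isBoundedFG_single 0 M)
    (isBoundedFG_single 0 N) (isBoundedFG_single 0 Q)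
    (hT.map_of_exact (HomologicalComplex.single _ (ComplexShape.up ℤ) 0))
  exact P.ext_of_isTriangulatedClosed₂ _ hδ h₁ h₃

end DbMod

end

section

variable {k : Type u} [Field k] {R : Type u} [Ring R] [Algebra k R]
  {A : Type u} [Ring A] [Algebra k A]

lemma idealAct_range_smul_eq_zero (Z : ModuleCat.{u} (R ⊗[k] A)ᵐᵒᵖ) (J : Ideal Aᵐᵒᵖ) (a : A)
    (h : ∀ j ∈ J, ∀ z : Z, inclRightOp k R A (.op a) • inclRightOp k R A j • z = 0)
    (z : Z) (hz : z ∈ LinearMap.range (idealAct Z J).hom) :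
    inclRightOp k R A (.op a) • z = 0 := by
  obtain ⟨t, rfl⟩ := hz
  change (resLeft k R A).obj Z ⊗[k] idealModule J at t
  induction t with
  | zero => exact (congrArg _ (map_zero (idealAct Z J).hom)).trans (smul_zero _)
  | add x y hx hy =>
    refine (congrArg _ (map_add (idealAct Z J).hom _ _)).trans ((smul_add _ _ _).trans ?_)
    rw [hx, hy, add_zero]
  | tmul z j => exact h j.1 j.2 z

/-- The bounded derived category of right `R ⊗ A`-modules is generated by the modules `M ⊗ N`. -/
theorem prop_of_tensorObj [Module.Finite k A] (hA : IsSeparableAlgebra k (A ⧸ Ring.jacobson A))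
    (P : ObjectProperty (DbMod (R ⊗[k] A))) [P.IsTriangulated] [P.IsStableUnderRetracts]
    [P.IsClosedUnderIsomorphisms]
    (h : ∀ (M : ModuleCat.{u} Rᵐᵒᵖ) (N : ModuleCat.{u} Aᵐᵒᵖ) (hM : Module.Finite Rᵐᵒᵖ M)
      (hN : Module.Finite Aᵐᵒᵖ N), P (have := finite_tensorObj k R A M N hM hN
        DbMod.of _ (DbMod.isBoundedFG_single 0 (tensorObj k R A M N))))
    (X : DbMod (R ⊗[k] A)) : P X := by
  refine DbMod.prop_of_single P (fun Z hZ => ?_) X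
  let π : A →ₐ[k] A ⧸ Ring.jacobson A := Ideal.Quotient.mkₐ k (Ring.jacobson A)
  have hπ : Function.Surjective π := Ideal.Quotient.mkₐ_surjective k _
  let J : Ideal Aᵐᵒᵖ := RingHom.ker (RingHom.op π.toRingHom)
  have hJ (j : Aᵐᵒᵖ) (hj : j ∈ J) : j.unop ∈ Ring.jacobson A :=
    Ideal.Quotient.eq_zero_iff_mem.1 (congrArg MulOpposite.unop hj)
  have : Module.Finite k Aᵐᵒᵖ := Module.Finite.equiv (MulOpposite.opLinearEquiv k)
  have : IsNoetherianRing Aᵐᵒᵖ := IsNoetherianRing.of_finite k Aᵐᵒᵖ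
  have : IsArtinianRing A := IsArtinianRing.of_finite k A
  -- The induction is on the power of the radical that annihilates `Z`, finite at the start because
  -- the radical of an artinian ring is nilpotent.
  obtain ⟨n, hn⟩ := IsSemiprimaryRing.isNilpotent (R := A)
  have hZn : ∀ a ∈ Ring.jacobson A ^ n, ∀ z : Z, inclRightOp k R A (.op a) • z = 0 := by
    intro a ha z
    rw [hn] at ha
    obtain rfl : a = 0 := ha
    rw [MulOpposite.op_zero, map_zero, zero_smul]
  clear hn
  induction n generalizing Z with
  | zero =>
    have : Subsingleton Z := subsingleton_of_forall_eq 0 fun z => by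
      have h1 : (1 : A) ∈ Ring.jacobson A ^ 0 := by
        rw [Submodule.pow_zero, Ideal.one_eq_top]
        exact Submodule.mem_top
      rw [← hZn 1 h1 z, MulOpposite.op_one, map_one, one_smul]
    exact P.prop_of_isZero (DbMod.isZero_of_acyclic _ (HomologicalComplex.acyclic_of_isZero _
      (Functor.map_isZero _ (ModuleCat.isZero_of_subsingleton Z))))
  | succ n ih =>
    -- This is the submodule $ZJ_A$. As the image of $Z\otimes J_A$, with `Z` finitely generated
    -- over `R`, it is finitely generated although $R\otimes A$ need not be noetherian.
    let W := LinearMap.range (idealAct Z J).hom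
    have hL := finite_resLeft Z hZ
    have hJ' : Module.Finite Aᵐᵒᵖ (idealModule J) := inferInstanceAs (Module.Finite Aᵐᵒᵖ J)
    have := finite_tensorObj k R A _ _ hL hJ'
    have hW : Module.Finite (R ⊗[k] A)ᵐᵒᵖ W := inferInstance
    have hW' : Module.Finite (R ⊗[k] A)ᵐᵒᵖ (ModuleCat.of (R ⊗[k] A)ᵐᵒᵖ W) := hW
    have hQ : Module.Finite (R ⊗[k] A)ᵐᵒᵖ (ModuleCat.of (R ⊗[k] A)ᵐᵒᵖ (Z ⧸ W)) :=
      inferInstanceAs (Module.Finite (R ⊗[k] A)ᵐᵒᵖ (Z ⧸ W))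
    have hT : (ShortComplex.mk (ModuleCat.ofHom W.subtype) (ModuleCat.ofHom W.mkQ)
        (ModuleCat.hom_ext (LinearMap.ext fun w =>
          (Submodule.Quotient.mk_eq_zero W).2 w.2))).ShortExact :=
      ModuleCat.shortComplex_shortExact _ (LinearMap.exact_subtype_mkQ W) W.injective_subtype
        W.mkQ_surjective
    refine DbMod.prop_single_of_shortExact P hT (ih _ hW' fun a ha w => ?_) ?_
    · refine Subtype.ext (idealAct_range_smul_eq_zero Z J a (fun j hj z => ?_) w.1 w.2)
      -- For right modules $(zj)a=z(ja)$, and $ja$ lies in the next power of the radical.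
      refine (inclRightOp_smul_smul Z a j.unop z).trans (hZn _ ?_ z)
      rw [Ideal.IsTwoSided.pow_succ]
      exact Ideal.mul_mem_mul (hJ j hj) ha
    · have hB := finite_quotModule π hπ
      have := finite_tensorObj k R A ((resLeft k R A).obj (ModuleCat.of (R ⊗[k] A)ᵐᵒᵖ (Z ⧸ W))) _
        (finite_resLeft _ hQ) hB
      -- On $Z/ZJ_A$ the algebra `A` acts through its separable quotient.
      obtain ⟨r⟩ := nonempty_retract_of_isSeparableAlgebra π hπ hA (ModuleCat.of (R ⊗[k] A)ᵐᵒᵖ (Z ⧸ W)) (by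
        intro a ha z
        obtain ⟨z, rfl⟩ := W.mkQ_surjective z
        refine (map_smul W.mkQ _ z).symm.trans ((Submodule.Quotient.mk_eq_zero W).2 ?_)
        exact ⟨_, idealAct_tmul Z J z ⟨.op a, congrArg MulOpposite.op ha⟩⟩)
      exact DbMod.prop_single_of_retract P r (h _ _ (finite_resLeft _ hQ) hB)

end

end

/-! ### The thick subcategories $\mathcal U^R$ and the theorem. -/

noncomputable section

open scoped ModuleCat

section

variable {D : Type*} [Category D] [HasShift D ℤ]

lemma CategoryTheory.ObjectProperty.isStableUnderShift_of_iff (P : ObjectProperty D)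
    [P.IsClosedUnderIsomorphisms] (h : ∀ X : D, P (X⟦(1 : ℤ)⟧) ↔ P X) :
    P.IsStableUnderShift ℤ where
  isStableUnderShiftBy n :=
    { le_shift := fun X hX => by
        change P (X⟦n⟧)
        have hs (n : ℤ) : P (X⟦n + 1⟧) ↔ P (X⟦n⟧) :=
          (P.prop_iff_of_iso ((shiftFunctorAdd' D n 1 (n + 1) rfl).app X)).trans (h _)
        induction n with
        | zero => exact P.prop_of_iso ((shiftFunctorZero D ℤ).symm.app X) hX
        | succ n ih => exact (hs n).2 ih
        | pred n ih => exact (hs (-n - 1)).1 (by rwa [sub_add_cancel]) }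

lemma CategoryTheory.ObjectProperty.shift_one_iff (P : ObjectProperty D)
    [P.IsClosedUnderIsomorphisms] [P.IsStableUnderShift ℤ] (X : D) : P (X⟦(1 : ℤ)⟧) ↔ P X :=
  ⟨fun h => P.prop_of_iso ((shiftEquiv D (1 : ℤ)).unitIso.symm.app X) (P.le_shift (-1) _ h),
    fun h => P.le_shift (1 : ℤ) X h⟩

end

section

variable (k : Type u) [Field k] (R : Type u) [Ring R] [Algebra k R]
  {A : Type u} [Ring A] [Algebra k A]

/-- The functor `M ⊗ -` on bounded derived categories. -/
def dbTensor (M : ModuleCat.{u} Rᵐᵒᵖ) (hM : Module.Finite Rᵐᵒᵖ M) :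
    DbMod A ⥤ DbMod (R ⊗[k] A) :=
  have := isExactFG_tensorBifunctor_obj k R A M hM
  dbFunctor ((tensorBifunctor k R A).obj M)

instance (M : ModuleCat.{u} Rᵐᵒᵖ) (hM : Module.Finite Rᵐᵒᵖ M) :
    (dbTensor k R (A := A) M hM).CommShift ℤ := by
  unfold dbTensor; infer_instance

instance (M : ModuleCat.{u} Rᵐᵒᵖ) (hM : Module.Finite Rᵐᵒᵖ M) :
    (dbTensor k R (A := A) M hM).IsTriangulated := by
  unfold dbTensor; infer_instance

lemma nonempty_dbTensor_single_iso (M : ModuleCat.{u} Rᵐᵒᵖ) (N : ModuleCat.{u} Aᵐᵒᵖ)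
    (hM : Module.Finite Rᵐᵒᵖ M) (hN : Module.Finite Aᵐᵒᵖ N) :
    Nonempty ((dbTensor k R M hM).obj (DbMod.of _ (DbMod.isBoundedFG_single 0 N)) ≅
      (have := finite_tensorObj k R A M N hM hN;
        DbMod.of _ (DbMod.isBoundedFG_single 0 (tensorObj k R A M N)))) :=
  have := isExactFG_tensorBifunctor_obj k R A M hM
  have := finite_tensorObj k R A M N hM hN
  ⟨dbFunctorObjIso _ (DbMod.isBoundedFG_single 0 N) ≪≫
    DbMod.mapIso _ (DbMod.isBoundedFG_single 0 (tensorObj k R A M N))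
      ((HomologicalComplex.singleMapHomologicalComplex ((tensorBifunctor k R A).obj M) _ 0).app N)⟩

/-- The objects `M ⊗ X` for a module `M` and `X` in `U`, up to isomorphism. -/
def moduleTensor (U : ObjectProperty (DbMod A)) : ObjectProperty (DbMod (R ⊗[k] A)) := fun Z =>
  ∃ (M : ModuleCat.{u} Rᵐᵒᵖ) (hM : Module.Finite Rᵐᵒᵖ M) (X : DbMod A),
    U.isoClosure X ∧ Nonempty (Z ≅ (dbTensor k R M hM).obj X)

variable (U : ObjectProperty (DbMod A))

instance [U.isoClosure.IsStableUnderShift ℤ] :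
    (moduleTensor k R U).IsStableUnderShift ℤ where
  isStableUnderShiftBy n :=
    { le_shift := by
        rintro Z ⟨M, hM, X, hX, ⟨e⟩⟩
        exact ⟨M, hM, X⟦n⟧, U.isoClosure.le_shift n X hX, ⟨(shiftFunctor _ n).mapIso e ≪≫
          ((dbTensor k R M hM).commShiftIso n).symm.app X⟩⟩ }

lemma moduleTensor_le_tensorGenerators : moduleTensor k R U ≤ tensorGenerators k R A U := by
  rintro Z ⟨M, hM, X, hX, ⟨e⟩⟩
  obtain ⟨K, hK, ⟨i⟩⟩ := DbMod.exists_iso_of X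
  have := isExactFG_tensorBifunctor_obj k R A M hM
  exact ⟨_, K, DbMod.isBoundedFG_single 0 M, hK, U.isoClosure.prop_of_iso i hX,
    ⟨e ≪≫ (dbTensor k R M hM).mapIso i ≪≫ dbFunctorObjIso _ hK ≪≫
      DbMod.mapIso _ _ (insertLeftSingleIso (tensorBifunctor k R A) K M)⟩⟩

instance [U.Nonempty] : (moduleTensor k R U).Nonempty :=
  ⟨⟨_, ModuleCat.of Rᵐᵒᵖ Rᵐᵒᵖ, inferInstanceAs (Module.Finite Rᵐᵒᵖ Rᵐᵒᵖ), U.arbitrary,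
    U.le_isoClosure _ U.prop_arbitrary, ⟨Iso.refl _⟩⟩⟩

lemma thickTensor_eq_triangEnvelope [U.Nonempty] :
    thickTensor k R A U = (moduleTensor k R U).triangEnvelope := by
  refine le_antisymm (ObjectProperty.triangEnvelope_le_iff _ |>.2 ?_)
    (ObjectProperty.monotone_triangEnvelope (moduleTensor_le_tensorGenerators k R U))
  rintro Z ⟨L, K, hL, hK, hU, ⟨e⟩⟩
  refine ObjectProperty.prop_of_iso _ e.symm (prop_of_tensorComplex _ hK (fun M hM => ?_) hL)
  have := isExactFG_tensorBifunctor_obj k R A M hM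
  exact ObjectProperty.le_triangEnvelope _ _
    ⟨M, hM, _, hU, ⟨(dbFunctorObjIso ((tensorBifunctor k R A).obj M) hK).symm⟩⟩

/-- Shift stability of `V` turns the vanishing of morphisms into vanishing for all shifts, the
hypothesis of `hom_dbFunctor_tensor_eq_zero`. -/
lemma hom_moduleTensor_eq_zero [Module.Finite k A] {U V : ObjectProperty (DbMod A)}
    [V.isoClosure.IsStableUnderShift ℤ] (h : ∀ X Y, U X → V Y → ∀ f : X ⟶ Y, f = 0)
    (X Y : DbMod (R ⊗[k] A)) (hX : moduleTensor k R U X) (hY : moduleTensor k R V Y)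
    (f : X ⟶ Y) : f = 0 := by
  obtain ⟨M, hM, X, ⟨X', hX', ⟨e⟩⟩, ⟨i⟩⟩ := hX
  obtain ⟨N, hN, Y, hY', ⟨j⟩⟩ := hY
  have := isExactFG_tensorBifunctor_obj k R A M hM
  have := isExactFG_tensorBifunctor_obj k R A N hN
  have h0 : i.inv ≫ f ≫ j.hom = 0 := hom_dbFunctor_tensor_eq_zero (M := M) (M' := N) X Y (fun n φ => by
    obtain ⟨Y', hY', ⟨e'⟩⟩ := V.isoClosure.le_shift n Y hY'
    have := h X' Y' hX' hY' (e.inv ≫ φ ≫ e'.hom)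
    rwa [Preadditive.IsIso.comp_left_eq_zero, Preadditive.IsIso.comp_right_eq_zero] at this)
    (i.inv ≫ f ≫ j.hom)
  rwa [Preadditive.IsIso.comp_left_eq_zero, Preadditive.IsIso.comp_right_eq_zero] at h0

end

end

theorem mainTheorem10 (k : Type u) [Field k] (R : Type u) [Ring R] [Algebra k R]
    (A : Type u) [Ring A] [Algebra k A] [Module.Finite k A]
    (hA : IsSeparableAlgebra k (A ⧸ Ring.jacobson A))
    (U V : ObjectProperty (DbMod A)) (hUV : IsStableTStructure U V) :
    IsStableTStructure (thickTensor k R A U) (thickTensor k R A V) := by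
  have hU := U.isoClosure.isStableUnderShift_of_iff hUV.shift_left
  have hV := V.isoClosure.isStableUnderShift_of_iff hUV.shift_right
  -- Axiom (c) for the zero object shows that neither class is empty, as
  -- `thickTensor_eq_triangEnvelope` demands.
  obtain ⟨Y, Z, -, -, -, hY, hZ, -⟩ := hUV.exists_triangle 0
  have : U.Nonempty := ⟨Y, hY⟩
  have : V.Nonempty := ⟨Z, hZ⟩
  rw [thickTensor_eq_triangEnvelope, thickTensor_eq_triangEnvelope]
  have h0 := ObjectProperty.hom_triangEnvelope_eq_zero (moduleTensor k R U) (moduleTensor k R V)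
    (hom_moduleTensor_eq_zero k R hUV.hom_eq_zero)
  have := ObjectProperty.extensionProduct_isTriangulated _ _ h0
  have := ObjectProperty.extensionProduct_isStableUnderRetracts _ _ h0
  refine ⟨fun X => ?_, fun X => ?_, h0, fun X => ?_⟩
  · rw [ObjectProperty.isoClosure_eq_self]
    exact ObjectProperty.shift_one_iff _ X
  · rw [ObjectProperty.isoClosure_eq_self]
    exact ObjectProperty.shift_one_iff _ X
  -- Extensions of $\mathcal V^R$ by $\mathcal U^R$ form a thick subcategory. For a module $M\otimes
  -- N$ the required triangle is $M\otimes-$ applied to the triangle of $N$.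
  · obtain ⟨Y, Z, f, g, h, hT, hY, hZ⟩ := prop_of_tensorObj hA
      (ObjectProperty.extensionProduct (moduleTensor k R U).triangEnvelope
        (moduleTensor k R V).triangEnvelope) (fun M N hM hN => by
        obtain ⟨Y, Z, f, g, h, hY, hZ, hT⟩ :=
          hUV.exists_triangle (DbMod.of _ (DbMod.isBoundedFG_single 0 N))
        refine ObjectProperty.prop_of_iso _ (nonempty_dbTensor_single_iso k R M N hM hN).some
          ⟨_, _, _, _, _, (dbTensor k R M hM).map_distinguished _ hT, ?_, ?_⟩
        · exact ObjectProperty.le_triangEnvelope _ _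
            ⟨M, hM, Y, U.le_isoClosure _ hY, ⟨Iso.refl _⟩⟩
        · exact ObjectProperty.le_triangEnvelope _ _
            ⟨M, hM, Z, V.le_isoClosure _ hZ, ⟨Iso.refl _⟩⟩) X
    exact ⟨Y, Z, f, g, h, hY, hZ, hT⟩
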